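/- \textbf{Setting.} Let $f\colon M\to\mathbb{S}^3\subset\mathbb{R}^4$ be a smooth immersion of an oriented surface with unit normal field $N$, and give $M$ the Riemann surface structure for which $f$ is conformal. A point is an \emph{umbilic} if the shape operator is a multiple of the identity there. A \emph{curvature line} is a regular $C^1$ curve whose tangent vectors are principal directions (every direction is principal at an umbilic). The \emph{Hopf differential} is $Q=II^{(2,0)}=q\,(dz)^2$ in a local holomorphic coordinate $z$; its zeros are the umbilics. The \emph{index} of $Q$ at an isolated zero $u$ is the winding number of $q/|q|$ along small counterclockwise circles about $u$. A \emph{star umbilic} is an isolated umbilic $u$ at which $Q$ has positive index; this index is the \emph{umbilic order} $o_u$, and we put $o_u=0$ if $u$ is not an umbilic. A star umbilic $u$ is \emph{regular} if its curvature line foliations are asymptotic to the standard star, i.e. to those of $c\,z^{o_u}(dz)^2$ with $c\in\mathbb{C}$, $|c|=1$: in a holomorphic coordinate $z$ centred at $u$, $\frac{q(z)}{|q(z)|}\Big(\frac{z}{|z|}\Big)^{-o_u}\to c$ as $z\to 0$ (for instance, this always holds if $Q$ is holomorphic and not identically zero near $u$). A \emph{curvature line $p$-gon} $P$ is an embedded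 closed topological disk in $M$ with $p$ marked boundary points (the vertices) such that every closed boundary arc with no vertex in its interior is a curvature line, $C^1$ up to its end points; all umbilics in $P\cup\partial P$ are star umbilics, and those on $\partial P$ are regular; and the interior angle at each vertex $u$ is positive. Write this interior angle as $\pi/n_u$ with a real number $n_u>0$. (The interior angle is the total change, inside $P$ near $u$, of the argument of a holomorphic coordinate centred at $u$, from one edge at $u$ to the other.) An umbilic in $P\cup\partial P$ is a vertex umbilic if it is a vertex, an edge umbilic if it is any other boundary point, and a face umbilic if it is an interior point of $P$. \textbf{Theorem (Umbilic excess).} A curvature line $p$-gon $P$ has only finitely many umbilics, and its \emph{umbilic excess} $$\kappa=\sum_{u\text{ vertex}}\frac{o_u+2-n_u}{2n_u}+\sum_{u\text{ edge umbilic}}\frac{o_u}{2}+\sum_{u\text{ face umbilic}}o_u$$ satisfies $$\kappa=\frac{p-4}{2}.$$ (A vertex that is not an umbilic and has interior angle $\pi/2$ contributes $0$ to the first sum, so if all non-umbilic vertices have interior angle $\pi/2$, then $\kappa$ is a sum over the umbilics of $P$ only.) -/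

import Mathlib

open scoped Manifold ContDiff Topology

noncomputable section

/-- The ambient space `ℝ⁴` of the unit sphere `𝕊³`. -/
abbrev E4 : Type := EuclideanSpace ℝ (Fin 4)

/-- The differential at `x` of a map into `ℝ⁴`. -/
def ambientDeriv {M : Type*} [TopologicalSpace M] [ChartedSpace ℂ M] (g : M → E4) (x : M) :
    TangentSpace 𝓘(ℝ, ℂ) x →L[ℝ] E4 := mfderiv 𝓘(ℝ, ℂ) 𝓘(ℝ, E4) g x

/-- An oriented immersed surface in `𝕊³ ⊂ ℝ⁴`, the domain `M` carrying the Riemann surface structure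
for which the immersion `f` is conformal, with a unit normal field `N` of `f` in `𝕊³`. -/
structure SphereSurface (M : Type*) [TopologicalSpace M] [ChartedSpace ℂ M] where
  f : M → E4
  N : M → E4
  smooth_f : ContMDiff 𝓘(ℝ, ℂ) 𝓘(ℝ, E4) ∞ f
  smooth_N : ContMDiff 𝓘(ℝ, ℂ) 𝓘(ℝ, E4) ∞ N
  /-- `f` takes values in `𝕊³`. -/
  norm_f : ∀ x, ‖f x‖ = 1
  /-- `f` is a conformal immersion. -/
  conformal : ∀ x, ∃ c : ℝ, 0 < c ∧
    ∀ v : ℂ, ‖ambientDeriv f x v‖ = c * ‖v‖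
  norm_N : ∀ x, ‖N x‖ = 1
  /-- `N` is tangent to `𝕊³`. -/
  inner_N_f : ∀ x, inner ℝ (N x) (f x) = 0
  /-- `N` is normal to the surface. -/
  inner_N_df : ∀ x, ∀ v : ℂ, inner ℝ (N x) (ambientDeriv f x v) = 0

namespace SphereSurface

variable {M : Type*} [TopologicalSpace M] [ChartedSpace ℂ M] (S : SphereSurface M)

/-- The differential of the immersion. -/
def df (x : M) : TangentSpace 𝓘(ℝ, ℂ) x →L[ℝ] E4 := ambientDeriv S.f x

/-- The differential of the unit normal. -/
def dN (x : M) : TangentSpace 𝓘(ℝ, ℂ) x →L[ℝ] E4 := ambientDeriv S.N x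

/-- `v` is a principal direction at `x`: a nonzero eigenvector of the shape operator
`-df⁻¹ ∘ dN`. At an umbilic every nonzero vector is one. -/
def IsPrincipal (x : M) (v : TangentSpace 𝓘(ℝ, ℂ) x) : Prop :=
  v ≠ 0 ∧ ∃ l : ℝ, S.dN x v = -(l • S.df x v)

/-- `x` is an umbilic: the shape operator at `x` is a multiple of the identity. -/
def IsUmbilic (x : M) : Prop := ∃ l : ℝ, S.dN x = -(l • S.df x)

/-- The second fundamental form `II(v, w) = -⟨df v, dN w⟩` at the point with coordinate `z`
in the chart at `u`. -/
def secondFF (u : M) (z v w : ℂ) : ℝ :=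
  -inner ℝ (fderiv ℝ (S.f ∘ (chartAt ℂ u).symm) z v) (fderiv ℝ (S.N ∘ (chartAt ℂ u).symm) z w)

/-- The coefficient `q` of the Hopf differential `Q = II^{(2,0)} = q (dz)²` in the holomorphic
coordinate `z = x + i y` given by the chart at `u`:
`q = (II(∂x, ∂x) - II(∂y, ∂y) - 2 i II(∂x, ∂y)) / 4`. -/
def hopf (u : M) (z : ℂ) : ℂ :=
  ((S.secondFF u z 1 1 - S.secondFF u z Complex.I Complex.I : ℝ) -
    2 * Complex.I * (S.secondFF u z 1 Complex.I : ℝ)) / 4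

/-- The Hopf differential has index `k` at `u`: on all small circles about `u` it has no zeros, and
the winding number of `q / |q|` along the circle is `k`. -/
def HasIndex (u : M) (k : ℤ) : Prop :=
  ∀ᶠ r : ℝ in 𝓝[>] 0, ∃ A : ℝ → ℝ, Continuous A ∧
    (∀ t : ℝ, S.hopf u (circleMap (chartAt ℂ u u) r t) ≠ 0 ∧
      S.hopf u (circleMap (chartAt ℂ u u) r t) =
        ‖S.hopf u (circleMap (chartAt ℂ u u) r t)‖ * Complex.exp (A t * Complex.I)) ∧
    A (2 * Real.pi) - A 0 = 2 * Real.pi * k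

open Classical in
/-- The order of `u`: the index of the Hopf differential at `u`
(so it is `0` at points that are not umbilics). -/
def umbilicOrder (u : M) : ℤ := if h : ∃ k : ℤ, S.HasIndex u k then h.choose else 0

theorem HasIndex.unique {S : SphereSurface M} {u : M} {k l : ℤ}
    (hk : S.HasIndex u k) (hl : S.HasIndex u l) : k = l := by
  obtain ⟨r, ⟨A, hA, hA1, hA2⟩, ⟨B, hB, hB1, hB2⟩⟩ := (hk.and hl).exists
  have key : ∀ t, ∃ m : ℤ, A t = B t + m * (2 * Real.pi) := by
    intro t
    obtain ⟨h0, h1⟩ := hA1 t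
    obtain ⟨-, h2⟩ := hB1 t
    have hn : ((‖S.hopf u (circleMap (chartAt ℂ u u) r t)‖ : ℝ) : ℂ) ≠ 0 := by
      exact_mod_cast norm_ne_zero_iff.mpr h0
    have h3 := mul_left_cancel₀ hn (h1.symm.trans h2)
    obtain ⟨m, hm⟩ := Complex.exp_eq_exp_iff_exists_int.mp h3
    refine ⟨m, ?_⟩
    have h4 := congrArg Complex.im hm
    simpa using h4
  choose m hm using key
  have hpi := Real.pi_pos
  have hc : Continuous m := by
    rw [Int.isClosedEmbedding_coe_real.isInducing.continuous_iff]
    have : ((fun n : ℤ => (n : ℝ)) ∘ m) = fun t => (A t - B t) / (2 * Real.pi) := by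
      funext t
      simp only [Function.comp]
      rw [hm t]
      field_simp
      ring
    rw [this]
    fun_prop
  have h5 : m (2 * Real.pi) = m 0 := PreconnectedSpace.constant inferInstance hc
  have h6 := hm (2 * Real.pi)
  have h7 := hm 0
  rw [h5] at h6
  have h8 : 2 * Real.pi * (k : ℝ) = 2 * Real.pi * l := by linarith
  exact_mod_cast mul_left_cancel₀ (by positivity) h8

theorem HasIndex.umbilicOrder_eq {S : SphereSurface M} {u : M} {k : ℤ} (hk : S.HasIndex u k) :
    S.umbilicOrder u = k := by
  have h : ∃ k : ℤ, S.HasIndex u k := ⟨k, hk⟩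
  rw [umbilicOrder, dif_pos h]
  exact h.choose_spec.unique hk

/-- A star umbilic: an isolated umbilic at which the Hopf differential has positive index. -/
def IsStarUmbilic (u : M) : Prop :=
  S.IsUmbilic u ∧ (∀ᶠ x in 𝓝[≠] u, ¬ S.IsUmbilic x) ∧ ∃ k : ℤ, 0 < k ∧ S.HasIndex u k

/-- The curvature line foliations at `u` are asymptotic to those of the standard star `c zᵏ (dz)²`,
where `k` is the order of `u`: `q / |q| · (z / |z|)⁻ᵏ` has a limit `c` at `u`,
for the coordinate `z` centred at `u`. -/
def IsRegularAt (u : M) : Prop :=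
  ∃ c : ℂ, Filter.Tendsto
    (fun z : ℂ => (S.hopf u z / ‖S.hopf u z‖) /
      ((z - chartAt ℂ u u) / ‖z - chartAt ℂ u u‖) ^ S.umbilicOrder u)
    (𝓝[≠] (chartAt ℂ u u)) (𝓝 c)

/-- On the interval `J`, the curve `γ` is a curvature line: it is `C¹` (up to the end points)
and its velocity is everywhere nonzero and principal. -/
def IsCurvatureLineOn (γ : ℝ → M) (J : Set ℝ) : Prop :=
  ContMDiffOn 𝓘(ℝ, ℝ) 𝓘(ℝ, ℂ) 1 γ J ∧
    ∀ t ∈ J, S.IsPrincipal (γ t) (mfderivWithin 𝓘(ℝ, ℝ) 𝓘(ℝ, ℂ) γ J t (1 : ℝ))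

end SphereSurface

/-- The disk `Φ` (a map on the closed unit disk) has interior angle `φ` at its boundary point with
parameter `w`, `|w| = 1`: inside the disk near this point, a continuous branch `A` of the argument of
the holomorphic coordinate centred at the point changes by `φ` between the two boundary arcs. -/
def HasInteriorAngle {M : Type*} [TopologicalSpace M] [ChartedSpace ℂ M]
    (Φ : ℂ → M) (w : ℂ) (φ : ℝ) : Prop :=
  ∃ (r : ℝ) (A : ℂ → ℝ) (α β : ℝ), 0 < r ∧
    Set.MapsTo Φ (Metric.closedBall 0 1 ∩ Metric.ball w r) (chartAt ℂ (Φ w)).source ∧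
    ContinuousOn A ((Metric.closedBall 0 1 ∩ Metric.ball w r) \ {w}) ∧
    (∀ y ∈ (Metric.closedBall 0 1 ∩ Metric.ball w r) \ {w},
      chartAt ℂ (Φ w) (Φ y) - chartAt ℂ (Φ w) (Φ w) =
        ‖chartAt ℂ (Φ w) (Φ y) - chartAt ℂ (Φ w) (Φ w)‖ * Complex.exp (A y * Complex.I)) ∧
    Filter.Tendsto (fun t : ℝ => A (circleMap 0 1 t)) (𝓝[>] w.arg) (𝓝 α) ∧
    Filter.Tendsto (fun t : ℝ => A (circleMap 0 1 t)) (𝓝[<] w.arg) (𝓝 β) ∧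
    |β - α| = φ

/-- A curvature line `p`-gon on the surface `S`: an embedded closed topological disk, parametrised by
the closed unit disk, with `p` marked boundary points (vertices), whose edges are curvature lines,
and all of whose umbilics are star umbilics, those on the boundary being regular. -/
structure CurvatureLinePolygon {M : Type*} [TopologicalSpace M] [ChartedSpace ℂ M]
    (S : SphereSurface M) (p : ℕ) where
  Φ : ℂ → M
  continuousOn : ContinuousOn Φ (Metric.closedBall 0 1)
  injOn : Set.InjOn Φ (Metric.closedBall 0 1)
  /-- The parameters of the vertices. -/
  V : Finset ℂ
  V_subset : (V : Set ℂ) ⊆ Metric.sphere 0 1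
  card_V : V.card = p
  /-- Every closed boundary arc without a vertex in its interior is a curvature line. -/
  edge : ∀ s t : ℝ, s < t → (∀ τ ∈ Set.Ioo s t, circleMap 0 1 τ ∉ V) →
    S.IsCurvatureLineOn (fun τ => Φ (circleMap 0 1 τ)) (Set.Icc s t)
  star : ∀ w ∈ Metric.closedBall (0 : ℂ) 1, S.IsUmbilic (Φ w) → S.IsStarUmbilic (Φ w)
  regular : ∀ w ∈ Metric.sphere (0 : ℂ) 1, S.IsUmbilic (Φ w) → S.IsRegularAt (Φ w)
  /-- The vertex numbers: the interior angle at the vertex with parameter `w` is `π / n w`. -/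
  n : ℂ → ℝ
  n_pos : ∀ w ∈ V, 0 < n w
  angle : ∀ w ∈ V, HasInteriorAngle Φ w (Real.pi / n w)

namespace CurvatureLinePolygon

variable {M : Type*} [TopologicalSpace M] [ChartedSpace ℂ M] {S : SphereSurface M} {p : ℕ}
  (P : CurvatureLinePolygon S p)

/-- The umbilics in the polygon, boundary included. -/
def umbilics : Set M := {u ∈ P.Φ '' Metric.closedBall 0 1 | S.IsUmbilic u}

/-- The umbilics in the interior of the polygon. -/
def faceUmbilics : Set M := {u ∈ P.Φ '' Metric.ball 0 1 | S.IsUmbilic u}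

/-- The umbilics on the boundary of the polygon that are not vertices. -/
def edgeUmbilics : Set M := {u ∈ P.Φ '' (Metric.sphere 0 1 \ P.V) | S.IsUmbilic u}

/-- The umbilic excess. All vertices are included, those that are not umbilics with order `0`; such a
vertex contributes nothing if its interior angle is `π / 2`. -/
def umbilicExcess : ℝ :=
  (∑ w ∈ P.V, ((S.umbilicOrder (P.Φ w) : ℝ) + 2 - P.n w) / (2 * P.n w)) +
  (∑ᶠ u ∈ P.edgeUmbilics, (1 / 2 : ℝ) * S.umbilicOrder u) +
  (∑ᶠ u ∈ P.faceUmbilics, (S.umbilicOrder u : ℝ))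

end CurvatureLinePolygon

end

/-! The proof is Hopf's secant argument for the Umlaufsatz, with the Hopf differential Q in place of
a constant frame. For two parameters x ≠ y in the closed disk, evaluate Q at x on the square of the
tangential part of the chord f(y) - f(x). This number (`hopfSecant`, and `secantForm` in terms of
parameters) does not depend on charts, is continuous, and for x close to y vanishes only if x is an
umbilic. With x = e^{iw} and y = e^{i(w+ε)} its argument can be followed over a strip above the real
w-axis from which the vertices and umbilics on the axis are removed. Its gain over the period 2π is
computed twice.

On a circle that encloses all face umbilics the gain splits. The direction of the chord turns once,
which counts twice because Q is quadratic; the base point winds around the face umbilics, which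
contributes their total order. Both carry the degree d of the parametrisation, so the gain is 2πd(∑
o_u + 2), see `winding_secantForm`.

On the boundary let ε tend to 0 from above. The chord becomes tangent to a curvature line, where Q
is real, so the limit of the argument is a multiple of π and is locally constant away from vertices
and umbilics (`exists_tendsto_of_smooth`). At a vertex or edge umbilic with order o and interior
angle φ, regularity gives Q the phase of c z^o. Across the point the argument of z changes by -dφ
and that of the tangent by d(π - φ), so the limit jumps by -doφ + 2d(π - φ) = d(2π - (o + 2)φ), see
`exists_jump`. Equating the gain with the sum of the jumps and cancelling d gives
`sum_umbilicOrder`; inserting φ = π/n_u at vertices and φ = π at edge umbilics gives the theorem.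

The disk is embedded only topologically, with C¹ sides, so degrees and turning cannot be read off
from derivatives of the parametrisation. They come instead from continuous logarithms of (Z y - Z
x)/(y - x)^d for an injective coordinate Z (`IsSecantLog`). Exchanging two boundary points shows
that d is odd (`IsSecantLog.swap_eq`), and the side of an edge on which the disk lies shows that d =
±1 (`exists_side`, `degree_eq`). The same side information fixes the sign and range of the angle
between the two edges at a corner. -/

section

open Set

/-! ### Logarithms, winding and an argument principle for continuous functions. -/

/-- Homotopy lifting for the exponential. -/
theorem exists_log_of_homotopy {A : Type*} [TopologicalSpace A] {S : Set A} {H : ℝ × A → ℂ}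
    (hH : ContinuousOn H (Icc 0 1 ×ˢ S)) (h0 : ∀ t ∈ Icc (0 : ℝ) 1, ∀ a ∈ S, H (t, a) ≠ 0)
    {m : A → ℂ} (hm : ContinuousOn m S) (hm0 : ∀ a ∈ S, Complex.exp (m a) = H (0, a)) :
    ∃ L : A → ℂ, ContinuousOn L S ∧ ∀ a ∈ S, Complex.exp (L a) = H (1, a) := by
  classical
  let K : C(unitInterval × S, {z : ℂ // z ≠ 0}) :=
    ⟨fun p => ⟨H ((p.1 : ℝ), (p.2 : A)), h0 _ p.1.2 _ p.2.2⟩, by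
      refine Continuous.subtype_mk ?_ _
      refine hH.comp_continuous (by fun_prop) ?_
      intro p
      exact ⟨p.1.2, p.2.2⟩⟩
  let f : C(S, ℂ) := ⟨fun a => m a, continuousOn_iff_continuous_domRestrict.mp hm⟩
  have hK : ∀ a, K (0, a) = (⟨_, (f a).exp_ne_zero⟩ : {z : ℂ // z ≠ 0}) := by
    intro a
    apply Subtype.ext
    exact (hm0 a a.2).symm
  let F := Complex.isCoveringMap_exp.liftHomotopy K f hK
  have hF : ∀ p, Complex.exp (F p) = H ((p.1 : ℝ), (p.2 : A)) := by
    intro p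
    exact congrArg Subtype.val (congrFun (Complex.isCoveringMap_exp.liftHomotopy_lifts K f hK) p)
  refine ⟨fun a => if h : a ∈ S then F (1, ⟨a, h⟩) else 0, ?_, ?_⟩
  · rw [continuousOn_iff_continuous_domRestrict]
    have : S.domRestrict (fun a => if h : a ∈ S then F (1, ⟨a, h⟩) else 0) = fun a => F (1, a) := by
      funext a
      simp
    rw [this]
    fun_prop
  · intro a ha
    simp only [ha, dif_pos]
    exact hF (1, ⟨a, ha⟩)

/-- Contracting to the centre `c` deforms g into the constant g(c), which has a logarithm; the
logarithm lifts back along the homotopy. -/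
theorem StarConvex.exists_log {E : Type*} [AddCommGroup E] [Module ℝ E] [TopologicalSpace E]
    [ContinuousAdd E] [ContinuousSMul ℝ E] {S : Set E} {c : E} (hS : StarConvex ℝ c S)
    {g : E → ℂ} (hg : ContinuousOn g S) (h0 : ∀ x ∈ S, g x ≠ 0) :
    ∃ L : E → ℂ, ContinuousOn L S ∧ ∀ x ∈ S, Complex.exp (L x) = g x := by
  rcases S.eq_empty_or_nonempty with rfl | hne
  · exact ⟨0, by simp, by simp⟩
  have hc : c ∈ S := hS.mem hne
  have hmem : ∀ t ∈ Icc (0 : ℝ) 1, ∀ x ∈ S, (1 - t) • c + t • x ∈ S := fun t ht x hx =>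
    hS hx (by linarith [ht.2]) ht.1 (by ring)
  obtain ⟨L, hL, hL1⟩ := exists_log_of_homotopy (S := S)
    (H := fun p : ℝ × E => g ((1 - p.1) • c + p.1 • p.2)) (m := fun _ => Complex.log (g c))
    (hg.comp (Continuous.continuousOn (by fun_prop)) fun p hp => hmem _ hp.1 _ hp.2)
    (fun t ht a ha => h0 _ (hmem t ht a ha)) continuousOn_const
    (fun a ha => by simp [Complex.exp_log (h0 c hc)])
  exact ⟨L, hL, fun x hx => by simpa using hL1 x hx⟩

/-- Two continuous logarithms on a preconnected set differ by a constant in `2πiℤ`. -/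
theorem IsPreconnected.log_unique {A : Type*} [TopologicalSpace A] {S : Set A}
    (hS : IsPreconnected S) {L K : A → ℂ} (hL : ContinuousOn L S) (hK : ContinuousOn K S)
    (h : ∀ x ∈ S, Complex.exp (L x) = Complex.exp (K x)) :
    ∃ n : ℤ, ∀ x ∈ S, L x = K x + n * (2 * Real.pi * Complex.I) := by
  rcases S.eq_empty_or_nonempty with rfl | ⟨x0, hx0⟩
  · exact ⟨0, by simp⟩
  have key : ∀ x, ∃ n : ℤ, x ∈ S → L x = K x + n * (2 * Real.pi * Complex.I) := by
    intro x
    by_cases hx : x ∈ S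
    · obtain ⟨n, hn⟩ := Complex.exp_eq_exp_iff_exists_int.mp (h x hx)
      exact ⟨n, fun _ => hn⟩
    · exact ⟨0, fun h => absurd h hx⟩
  choose n hn using key
  -- The integer is a continuous function of the point, hence constant on a preconnected set.
  have hc : ContinuousOn n S := by
    rw [Int.isClosedEmbedding_coe_real.isInducing.continuousOn_iff]
    have : ContinuousOn (fun x => ((L x - K x) / (2 * Real.pi * Complex.I)).re) S := by
      refine Complex.continuous_re.comp_continuousOn ?_
      exact (hL.sub hK).div_const _
    refine this.congr fun x hx => ?_
    have h2 : (2 * Real.pi * Complex.I : ℂ) ≠ 0 := Complex.two_pi_I_ne_zero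
    simp only [Function.comp]
    rw [hn x hx, add_sub_cancel_left, mul_div_assoc, div_self h2]
    simp
  refine ⟨n x0, fun x hx => ?_⟩
  rw [hn x hx, hS.constant hc hx hx0]

theorem IsPreconnected.arg_unique {A : Type*} [TopologicalSpace A] {S : Set A}
    (hS : IsPreconnected S) {L K : A → ℝ} (hL : ContinuousOn L S) (hK : ContinuousOn K S)
    (h : ∀ x ∈ S, Complex.exp (L x * Complex.I) = Complex.exp (K x * Complex.I)) :
    ∃ n : ℤ, ∀ x ∈ S, L x = K x + n * (2 * Real.pi) := by
  obtain ⟨n, hn⟩ := hS.log_unique (L := fun x => L x * Complex.I) (K := fun x => K x * Complex.I)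
    (by fun_prop) (by fun_prop) h
  refine ⟨n, fun x hx => ?_⟩
  have := congrArg Complex.im (hn x hx)
  simpa using this

/-- A continuous nonvanishing function on a punctured disk is a power times an exponential. -/
theorem exists_zpow_mul_exp {ρ : ℝ} (hρ : 0 < ρ) {g : ℂ → ℂ}
    (hg : ContinuousOn g {v | 0 < ‖v‖ ∧ ‖v‖ < ρ}) (h0 : ∀ v, 0 < ‖v‖ → ‖v‖ < ρ → g v ≠ 0) :
    ∃ (m : ℤ) (l : ℂ → ℂ), ContinuousOn l {v | 0 < ‖v‖ ∧ ‖v‖ < ρ} ∧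
      ∀ v, 0 < ‖v‖ → ‖v‖ < ρ → g v = v ^ m * Complex.exp (l v) := by
  -- The half plane that covers the punctured disk under the exponential.
  set H : Set ℂ := {ζ | ζ.re < Real.log ρ} with hH
  have hconv : Convex ℝ H := convex_halfSpace_re_lt _
  have hexp : MapsTo Complex.exp H {v | 0 < ‖v‖ ∧ ‖v‖ < ρ} := by
    intro ζ hζ
    refine ⟨by simp, ?_⟩
    rw [Complex.norm_exp]
    exact (Real.lt_log_iff_exp_lt hρ).mp hζ
  have hne : (((Real.log ρ - 1 : ℝ) : ℂ)) ∈ H := by simp [hH]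
  obtain ⟨L, hL, hL1⟩ := (hconv.starConvex hne).exists_log (g := fun ζ => g (Complex.exp ζ))
    (hg.comp (by fun_prop) hexp) (fun ζ hζ => h0 _ (hexp hζ).1 (hexp hζ).2)
  have hshift : MapsTo (fun ζ => ζ + 2 * Real.pi * Complex.I) H H := by
    intro ζ hζ
    simpa [hH] using hζ
  -- The monodromy: the deck transformation changes the lifted logarithm by 2πi m, and m is the
  -- exponent sought. Subtracting mζ makes the logarithm periodic, so that it descends to the
  -- punctured disk.
  obtain ⟨m, hm⟩ := hconv.isPreconnected.log_unique
    (L := fun ζ => L (ζ + 2 * Real.pi * Complex.I)) (hL.comp (by fun_prop) hshift) hL (by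
      intro ζ hζ
      rw [hL1 _ (hshift hζ), hL1 _ hζ, Complex.exp_periodic ζ])
  set P : ℂ → ℂ := fun ζ => L ζ - m * ζ with hP
  have hPc : ContinuousOn P H := by fun_prop
  have hP1 : ∀ ζ ∈ H, P (ζ + 2 * Real.pi * Complex.I) = P ζ := by
    intro ζ hζ
    simp only [hP]
    rw [hm ζ hζ]
    ring
  have hPn : ∀ n : ℤ, ∀ ζ ∈ H, P (ζ + n * (2 * Real.pi * Complex.I)) = P ζ := by
    intro n
    have hmem : ∀ n : ℤ, ∀ ζ ∈ H, ζ + n * (2 * Real.pi * Complex.I) ∈ H := by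
      intro n ζ hζ
      simpa [hH] using hζ
    induction n using Int.induction_on with
    | zero => simp
    | succ k ih =>
      intro ζ hζ
      rw [← ih ζ hζ, ← hP1 _ (hmem k ζ hζ)]
      congr 1; push_cast; ring
    | pred k ih =>
      intro ζ hζ
      rw [← ih ζ hζ, ← hP1 _ (hmem _ ζ hζ)]
      congr 1; push_cast; ring
  have hPe : ∀ ζ ∈ H, ∀ ξ, Complex.exp ζ = Complex.exp ξ → P ζ = P ξ := by
    intro ζ hζ ξ h
    obtain ⟨n, hn⟩ := Complex.exp_eq_exp_iff_exists_int.mp h.symm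
    rw [hn, hPn n ζ hζ]
  have hlog : ∀ v : ℂ, 0 < ‖v‖ → ‖v‖ < ρ → Complex.log v ∈ H := by
    intro v hv hv'
    simp only [hH, mem_ofPred_eq, Complex.log_re]
    exact Real.log_lt_log hv hv'
  refine ⟨m, fun v => P (Complex.log v), ?_, ?_⟩
  · intro v hv
    by_cases hs : v ∈ Complex.slitPlane
    · have : ContinuousAt (fun v => P (Complex.log v)) v := by
        have h1 : ContinuousAt P (Complex.log v) :=
          hPc.continuousAt ((isOpen_lt Complex.continuous_re continuous_const).mem_nhds
            (hlog v hv.1 hv.2))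
        exact ContinuousAt.comp h1 (continuousAt_clog hs)
      exact this.continuousWithinAt
    · have hv0 : v ≠ 0 := norm_pos_iff.mp hv.1
      have hs' : -v ∈ Complex.slitPlane := by
        rw [Complex.mem_slitPlane_iff] at hs ⊢
        push Not at hs
        refine Or.inl ?_
        have : v.re ≠ 0 := fun h => hv0 (Complex.ext h hs.2)
        simp only [Complex.neg_re]
        have := lt_of_le_of_ne hs.1 this
        linarith
      -- On the negative axis, where the principal logarithm jumps, log(-u) + πi is a continuous
      -- lift, and periodicity of `P` makes it give the same value.
      have heq : ∀ u : ℂ, 0 < ‖u‖ → ‖u‖ < ρ →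
          P (Complex.log u) = P (Complex.log (-u) + Real.pi * Complex.I) := by
        intro u hu hu'
        refine hPe _ (hlog u hu hu') _ ?_
        have hu0 : u ≠ 0 := norm_pos_iff.mp hu
        rw [Complex.exp_add, Complex.exp_log hu0, Complex.exp_log (neg_ne_zero.mpr hu0),
          Complex.exp_pi_mul_I]
        ring
      have h1 : ContinuousAt P (Complex.log (-v) + Real.pi * Complex.I) := by
        refine hPc.continuousAt ((isOpen_lt Complex.continuous_re continuous_const).mem_nhds ?_)
        have := hlog (-v) (by simpa using hv.1) (by simpa using hv.2)
        simpa [hH] using this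
      have h2 : ContinuousAt (fun u => P (Complex.log (-u) + Real.pi * Complex.I)) v := by
        refine ContinuousAt.comp (g := P) (f := fun u => Complex.log (-u) + Real.pi * Complex.I) h1 ?_
        exact (ContinuousAt.comp (g := Complex.log) (f := fun u : ℂ => -u)
          (continuousAt_clog hs') (by fun_prop)).add continuousAt_const
      exact h2.continuousWithinAt.congr (fun u hu => heq u hu.1 hu.2) (heq v hv.1 hv.2)
  · intro v hv hv'
    have hv0 : v ≠ 0 := norm_pos_iff.mp hv
    have h1 := hL1 _ (hlog v hv hv')
    simp only [Complex.exp_log hv0] at h1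
    have h2 : L (Complex.log v) = m * Complex.log v + P (Complex.log v) := by simp [hP]
    rw [← h1, h2, Complex.exp_add, Complex.exp_int_mul, Complex.exp_log hv0]

/-- The argument principle for continuous functions on a disk. -/
theorem exists_prod_zpow_mul_exp {R : ℝ} (hR : 0 < R) (A : Finset ℂ) (m : ℂ → ℤ)
    (hA : ∀ a ∈ A, ‖a‖ < R) (h : ℂ → ℂ) (hc : ContinuousOn h (Metric.closedBall 0 R))
    (h0 : ∀ w ∈ Metric.closedBall (0 : ℂ) R, w ∉ A → h w ≠ 0)
    (hloc : ∀ a ∈ A, ∃ (ρ : ℝ) (g : ℂ → ℂ), 0 < ρ ∧ ContinuousOn g {v | 0 < ‖v‖ ∧ ‖v‖ < ρ} ∧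
      ∀ v, 0 < ‖v‖ → ‖v‖ < ρ → h (a + v) = v ^ m a * Complex.exp (g v)) :
    ∃ L : ℂ → ℂ, ContinuousOn L (Metric.sphere 0 R) ∧
      ∀ w ∈ Metric.sphere (0 : ℂ) R, h w = (∏ a ∈ A, (w - a) ^ m a) * Complex.exp (L w) := by
  classical
  induction A using Finset.induction_on generalizing h with
  | empty =>
    obtain ⟨L, hL, hL1⟩ := ((convex_closedBall (0 : ℂ) R).starConvex
      (Metric.mem_closedBall_self hR.le)).exists_log hc (fun w hw => h0 w hw (by simp))
    refine ⟨L, hL.mono Metric.sphere_subset_closedBall, fun w hw => ?_⟩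
    simp [hL1 w (Metric.sphere_subset_closedBall hw)]
  | insert a A haA ih =>
    obtain ⟨ρ, g, hρ, hg, hga⟩ := hloc a (Finset.mem_insert_self _ _)
    -- a radius isolating `a`
    obtain ⟨r, hr, hrρ, hrR, hrA⟩ : ∃ r : ℝ, 0 < r ∧ r < ρ ∧ r + ‖a‖ < R ∧
        ∀ b ∈ A, r < ‖b - a‖ := by
      have h1 : ∀ᶠ r in 𝓝[>] (0 : ℝ), 0 < r := self_mem_nhdsWithin
      have h2 : ∀ᶠ r in 𝓝[>] (0 : ℝ), r < ρ := nhdsWithin_le_nhds (Iio_mem_nhds hρ)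
      have h3 : ∀ᶠ r in 𝓝[>] (0 : ℝ), r < R - ‖a‖ :=
        nhdsWithin_le_nhds (Iio_mem_nhds (by linarith [hA a (Finset.mem_insert_self _ _)]))
      have h4 : ∀ᶠ r in 𝓝[>] (0 : ℝ), ∀ b ∈ A, r < ‖b - a‖ := by
        rw [Filter.eventually_all_finset]
        intro b hb
        refine nhdsWithin_le_nhds (Iio_mem_nhds ?_)
        rw [norm_pos_iff, sub_ne_zero]
        rintro rfl
        exact haA hb
      obtain ⟨r, h1, h2, h3, h4⟩ := (h1.and (h2.and (h3.and h4))).exists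
      exact ⟨r, h1, h2, by linarith, h4⟩
    -- A cutoff: 1 within r/2 of `a`, 0 beyond r.
    set χ : ℂ → ℝ := fun w => max 0 (min 1 (2 - 2 * ‖w - a‖ / r)) with hχ
    have hχc : Continuous χ := by fun_prop
    have hχ1 : ∀ w, ‖w - a‖ < r / 2 → χ w = 1 := by
      intro w hw
      have : 1 ≤ 2 - 2 * ‖w - a‖ / r := by
        have : 2 * ‖w - a‖ / r ≤ 1 := by rw [div_le_one hr]; linarith
        linarith
      simp [hχ, min_eq_left this]
    have hχ0 : ∀ w, r ≤ ‖w - a‖ → χ w = 0 := by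
      intro w hw
      have : 2 - 2 * ‖w - a‖ / r ≤ 0 := by
        have : 2 ≤ 2 * ‖w - a‖ / r := by rw [le_div_iff₀ hr]; linarith
        linarith
      simp only [hχ]
      rw [min_eq_right (by linarith), max_eq_left this]
    -- Removes the zero or pole at `a`: the power is divided out, and the remaining exponential is
    -- damped to the constant 1 near `a`. Beyond distance r only the division is left, so the circle
    -- of radius R sees no other change.
    set k : ℂ → ℂ := fun w =>
      if w = a then 1 else h w * (w - a) ^ (-m a) * Complex.exp (-(χ w * g (w - a))) with hk
    have hkout : ∀ w, r ≤ ‖w - a‖ → k w = h w * (w - a) ^ (-m a) := by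
      intro w hw
      have : w ≠ a := by
        rintro rfl
        simp at hw
        linarith
      simp [hk, this, hχ0 w hw]
    have hkin : ∀ w, ‖w - a‖ < r / 2 → k w = 1 := by
      intro w hw
      by_cases hwa : w = a
      · simp [hk, hwa]
      · have h1 : w - a ≠ 0 := sub_ne_zero.mpr hwa
        have := hga (w - a) (norm_pos_iff.mpr h1) (by linarith)
        rw [add_sub_cancel] at this
        simp only [hk, hwa, if_false, hχ1 w hw, this]
        rw [zpow_neg, Complex.ofReal_one, one_mul, Complex.exp_neg]
        field_simp [Complex.exp_ne_zero, zpow_ne_zero]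
    have hkc : ContinuousOn k (Metric.closedBall 0 R) := by
      intro w hw
      by_cases hwa : w = a
      · have : k =ᶠ[𝓝 w] fun _ => 1 := by
          filter_upwards [Metric.ball_mem_nhds w (half_pos hr)] with x hx
          apply hkin
          rw [← hwa]
          simpa [dist_eq_norm] using hx
        exact (continuousAt_const.congr this.symm).continuousWithinAt
      have hne : ∀ᶠ x in 𝓝 w, x ≠ a := isOpen_ne.mem_nhds hwa
      have hz : ContinuousAt (fun x : ℂ => (x - a) ^ (-m a)) w :=
        ContinuousAt.zpow₀ (by fun_prop) _ (Or.inl (sub_ne_zero.mpr hwa))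
      by_cases hwr : ‖w - a‖ < ρ
      · have h1 : ContinuousAt (fun x => g (x - a)) w := by
          have : ContinuousAt g (w - a) := by
            refine hg.continuousAt (IsOpen.mem_nhds ?_ ⟨norm_pos_iff.mpr (sub_ne_zero.mpr hwa), hwr⟩)
            exact (isOpen_lt continuous_const continuous_norm).inter
              (isOpen_lt continuous_norm continuous_const)
          exact ContinuousAt.comp (g := g) (f := fun x => x - a) this (by fun_prop)
        have h2 : ContinuousWithinAt
            (fun x => h x * (x - a) ^ (-m a) * Complex.exp (-(χ x * g (x - a))))
            (Metric.closedBall 0 R) w := by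
          refine ((hc w hw).mul hz.continuousWithinAt).mul (ContinuousAt.continuousWithinAt ?_)
          have : ContinuousAt (fun x => (χ x : ℂ)) w := by fun_prop
          exact Complex.continuous_exp.continuousAt.comp (this.mul h1).neg
        refine h2.congr_of_eventuallyEq ?_ (by simp [hk, hwa])
        filter_upwards [nhdsWithin_le_nhds hne] with x hx
        simp [hk, hx]
      · have h2 : ContinuousWithinAt (fun x => h x * (x - a) ^ (-m a))
            (Metric.closedBall 0 R) w := (hc w hw).mul hz.continuousWithinAt
        refine h2.congr_of_eventuallyEq ?_ (hkout w (by linarith))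
        have : ∀ᶠ x in 𝓝 w, r < ‖x - a‖ :=
          (isOpen_lt continuous_const (by fun_prop : Continuous fun x => ‖x - a‖)).mem_nhds
            (show r < ‖w - a‖ by linarith)
        filter_upwards [nhdsWithin_le_nhds this] with x hx
        exact hkout x hx.le
    obtain ⟨L, hL, hL1⟩ := ih (fun b hb => hA b (Finset.mem_insert_of_mem hb)) k hkc (by
      intro w hw hwA
      by_cases hwa : w = a
      · simp [hk, hwa]
      · simp only [hk, hwa, if_false]
        exact mul_ne_zero (mul_ne_zero (h0 w hw (by simp [hwa, hwA]))
          (zpow_ne_zero _ (sub_ne_zero.mpr hwa))) (Complex.exp_ne_zero _)) (by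
      intro b hb
      obtain ⟨ρ', g', hρ', hg', hga'⟩ := hloc b (Finset.mem_insert_of_mem hb)
      -- Keeps b + v outside the cutoff disk about `a`, where (b + v - a)^(-m a) has a continuous
      -- logarithm that is absorbed into `g'`.
      set r' := min ρ' (‖b - a‖ - r) with hr'
      have hr'0 : 0 < r' := lt_min hρ' (by linarith [hrA b hb])
      have hfar : ∀ v : ℂ, ‖v‖ < r' → r < ‖b + v - a‖ := by
        intro v hv
        have h1 : ‖b - a‖ ≤ ‖b + v - a‖ + ‖v‖ := by
          calc ‖b - a‖ = ‖(b + v - a) - v‖ := by congr 1; ring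
            _ ≤ _ := norm_sub_le _ _
        have := lt_of_lt_of_le hv (min_le_right _ _)
        linarith
      have hne : ∀ v : ℂ, ‖v‖ < r' → b + v - a ≠ 0 := by
        intro v hv h
        have := hfar v hv
        rw [h, norm_zero] at this
        linarith
      obtain ⟨l, hl, hl1⟩ := ((convex_ball (0 : ℂ) r').starConvex
        (Metric.mem_ball_self hr'0)).exists_log (g := fun v => (b + v - a) ^ (-m a)) (by
          intro v hv
          have h1 : ContinuousAt (fun v : ℂ => b + v - a) v := by fun_prop
          exact (h1.zpow₀ _ (Or.inl (hne v (by simpa using hv)))).continuousWithinAt)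
          (fun v hv => zpow_ne_zero _ (hne v (by simpa using hv)))
      refine ⟨r', fun v => g' v + l v, hr'0, ?_, ?_⟩
      · refine (hg'.mono fun v hv => ⟨hv.1, hv.2.trans_le (min_le_left _ _)⟩).add
          (hl.mono fun v hv => ?_)
        simpa using hv.2
      · intro v hv hv'
        rw [hkout _ (hfar v hv').le, hga' v hv (hv'.trans_le (min_le_left _ _)), Complex.exp_add,
          hl1 v (by simpa using hv')]
        ring)
    refine ⟨L, hL, fun w hw => ?_⟩
    have hwn : ‖w‖ = R := by simpa using hw
    have hfar : r ≤ ‖w - a‖ := by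
      have : ‖w‖ ≤ ‖w - a‖ + ‖a‖ := by
        calc ‖w‖ = ‖(w - a) + a‖ := by congr 1; ring
          _ ≤ _ := norm_add_le _ _
      linarith
    have hwa : w - a ≠ 0 := by
      intro h
      rw [h, norm_zero] at hfar
      linarith
    have h1 := hL1 w hw
    rw [hkout w hfar, zpow_neg] at h1
    rw [Finset.prod_insert haA, mul_assoc, ← h1]
    field_simp

/-! ### Logarithms of secants of an injective plane map. -/

/-- `μ` is a logarithm of `(Z y - Z x) / (y - x) ^ d` on pairs of distinct points of `N`. -/
structure IsSecantLog (N : Set ℂ) (Z : ℂ → ℂ) (d : ℤ) (μ : ℂ × ℂ → ℂ) : Prop where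
  continuousOn : ContinuousOn μ {p | p.1 ∈ N ∧ p.2 ∈ N ∧ p.1 ≠ p.2}
  eq : ∀ x ∈ N, ∀ y ∈ N, x ≠ y → Z y - Z x = (y - x) ^ d * Complex.exp (μ (x, y))

/-- By convexity every pair (x, y) can be moved to (c, c + τ(y - x)) without its points colliding.
There the degree and the logarithm are those of Z - Z(c) on a punctured disk about c, and homotopy
lifting carries the logarithm back. -/
theorem Convex.exists_isSecantLog {N : Set ℂ} (hN : Convex ℝ N) {c : ℂ} {ρ C : ℝ} (hρ : 0 < ρ)
    (hc : Metric.ball c ρ ⊆ N) (hC : ∀ x ∈ N, ‖x‖ ≤ C) {Z : ℂ → ℂ} (hZ : ContinuousOn Z N)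
    (hinj : InjOn Z N) : ∃ (d : ℤ) (μ : ℂ × ℂ → ℂ), IsSecantLog N Z d μ := by
  have hcv : ∀ v : ℂ, ‖v‖ < ρ → c + v ∈ N := fun v hv => hc (by simpa using hv)
  have hcN : c ∈ N := by simpa using hcv 0 (by simpa using hρ)
  have hC0 : 0 ≤ C := (norm_nonneg _).trans (hC c hcN)
  obtain ⟨d, l, hl, hl1⟩ := exists_zpow_mul_exp (g := fun v => Z (c + v) - Z c) hρ
    ((hZ.comp (by fun_prop) fun v hv => hcv v hv.2).sub continuousOn_const) (by
      intro v hv hv' h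
      have := hinj (hcv v hv') hcN (sub_eq_zero.mp h)
      simp only [add_eq_left] at this
      simp [this] at hv)
  -- Differences in `N` have norm at most 2C, so τ brings them below ρ; the added 1 avoids division
  -- by zero.
  set τ : ℝ := min 1 (ρ / (2 * C + 1)) with hτ
  have hτ0 : 0 < τ := lt_min one_pos (by positivity)
  have hτ1 : τ ≤ 1 := min_le_left _ _
  have hsmall : ∀ x ∈ N, ∀ y ∈ N, ‖(τ : ℂ) * (y - x)‖ < ρ := by
    intro x hx y hy
    rw [norm_mul, Complex.norm_real, Real.norm_of_nonneg hτ0.le]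
    have h1 : ‖y - x‖ ≤ 2 * C := (norm_sub_le _ _).trans (by linarith [hC x hx, hC y hy])
    have h2 : τ * (2 * C + 1) ≤ ρ := by
      have := min_le_right 1 (ρ / (2 * C + 1))
      rwa [← hτ, le_div_iff₀ (by linarith)] at this
    nlinarith
  set S : Set (ℂ × ℂ) := {p | p.1 ∈ N ∧ p.2 ∈ N ∧ p.1 ≠ p.2} with hS
  set X : ℝ × (ℂ × ℂ) → ℂ := fun q => (1 - q.1 : ℝ) • c + q.1 • q.2.1 with hX
  set Y : ℝ × (ℂ × ℂ) → ℂ := fun q =>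
    (1 - q.1 : ℝ) • (c + τ * (q.2.2 - q.2.1)) + q.1 • q.2.2 with hY
  have hXm : MapsTo X (Icc 0 1 ×ˢ S) N := by
    rintro ⟨t, x, y⟩ ⟨ht, hx, hy, hxy⟩
    exact hN hcN hx (by linarith [ht.2]) ht.1 (by ring)
  have hYm : MapsTo Y (Icc 0 1 ×ˢ S) N := by
    rintro ⟨t, x, y⟩ ⟨ht, hx, hy, hxy⟩
    exact hN (hcv _ (hsmall x hx y hy)) hy (by linarith [ht.2]) ht.1 (by ring)
  -- Along the homotopy the difference stays a positive multiple of y - x, so the points stay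
  -- distinct and injectivity keeps the secant nonzero.
  have hXY : ∀ q, Y q - X q = ((1 - q.1) * τ + q.1 : ℝ) * (q.2.2 - q.2.1) := by
    intro q
    simp only [hX, hY, Complex.real_smul]
    push_cast
    ring
  have hlam : ∀ t ∈ Icc (0 : ℝ) 1, 0 < (1 - t) * τ + t := by
    rintro t ⟨h0, h1⟩
    rcases h1.lt_or_eq with h | h
    · have := mul_pos (sub_pos.mpr h) hτ0
      linarith
    · subst h; simp
  have hne : ∀ q ∈ Icc (0 : ℝ) 1 ×ˢ S, Y q - X q ≠ 0 := by
    rintro ⟨t, x, y⟩ ⟨ht, hx, hy, hxy⟩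
    rw [hXY]
    exact mul_ne_zero (by exact_mod_cast (hlam t ht).ne') (sub_ne_zero.mpr hxy.symm)
  obtain ⟨μ, hμ, hμ1⟩ := exists_log_of_homotopy (S := S)
    (H := fun q => (Z (Y q) - Z (X q)) * (Y q - X q) ^ (-d))
    (m := fun p => l (τ * (p.2 - p.1))) (by
      refine ((hZ.comp (by fun_prop) hYm).sub (hZ.comp (by fun_prop) hXm)).mul ?_
      intro q hq
      have : ContinuousAt (fun q => Y q - X q) q := by fun_prop
      exact (this.zpow₀ _ (Or.inl (hne q hq))).continuousWithinAt) (by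
      intro t ht p hp
      refine mul_ne_zero ?_ (zpow_ne_zero _ (hne _ ⟨ht, hp⟩))
      intro h
      exact hne (t, p) ⟨ht, hp⟩ (sub_eq_zero.mpr (hinj (hYm ⟨ht, hp⟩) (hXm ⟨ht, hp⟩)
        (sub_eq_zero.mp h)))) (by
      refine hl.comp (by fun_prop) ?_
      rintro ⟨x, y⟩ ⟨hx, hy, hxy⟩
      refine ⟨norm_pos_iff.mpr ?_, hsmall x hx y hy⟩
      exact mul_ne_zero (by exact_mod_cast hτ0.ne') (sub_ne_zero.mpr hxy.symm)) (by
      rintro ⟨x, y⟩ ⟨hx, hy, hxy⟩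
      have h0 : (τ : ℂ) * (y - x) ≠ 0 :=
        mul_ne_zero (by exact_mod_cast hτ0.ne') (sub_ne_zero.mpr hxy.symm)
      have := hl1 (τ * (y - x)) (norm_pos_iff.mpr h0) (hsmall x hx y hy)
      simp only [hX, hY, sub_zero, one_smul, zero_smul, add_zero, add_sub_cancel_left]
      rw [this, zpow_neg]
      field_simp [zpow_ne_zero])
  refine ⟨d, μ, hμ, fun x hx y hy hxy => ?_⟩
  have := hμ1 (x, y) ⟨hx, hy, hxy⟩
  simp only [hX, hY, sub_self, zero_smul, one_smul, zero_add] at this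
  rw [this, zpow_neg]
  field_simp [zpow_ne_zero, sub_ne_zero.mpr hxy.symm]

theorem IsPreconnected.eq_of_exp_eq {A : Type*} [TopologicalSpace A] {S : Set A}
    (hS : IsPreconnected S) {L : A → ℂ} (hL : ContinuousOn L S) {e : ℂ}
    (h : ∀ x ∈ S, Complex.exp (L x) = e) {x y : A} (hx : x ∈ S) (hy : y ∈ S) : L x = L y := by
  obtain ⟨n, hn⟩ := hS.log_unique hL (continuousOn_const (c := L x)) (by
    intro z hz
    rw [h z hz, h x hx])
  have h1 := hn x hx
  rw [hn y hy, ← h1]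

/-- If `exp (i P)` converges along a locally connected set, then so does the continuous
function `P`. -/
theorem exists_tendsto_of_tendsto_exp {E : Type*} [PseudoMetricSpace E]
    {S : Set E} {x : E} (hS : ∀ ρ > 0, IsPreconnected (Metric.ball x ρ ∩ S)) {P : E → ℝ} (hP : ContinuousOn P S)
    {e : ℂ} (he : ‖e‖ = 1)
    (h : Filter.Tendsto (fun y => Complex.exp (P y * Complex.I)) (𝓝[S] x) (𝓝 e)) :
    ∃ a : ℝ, Complex.exp (a * Complex.I) = e ∧ Filter.Tendsto P (𝓝[S] x) (𝓝 a) := by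
  have hea : Complex.exp (Complex.arg e * Complex.I) = e := by
    have := Complex.norm_mul_exp_arg_mul_I e
    rwa [he, Complex.ofReal_one, one_mul] at this
  set a := Complex.arg e
  have h1 : Filter.Tendsto (fun y => Complex.exp ((P y - a : ℝ) * Complex.I)) (𝓝[S] x) (𝓝 1) := by
    have := h.mul_const (Complex.exp (-(a * Complex.I)))
    rw [← hea, ← Complex.exp_add, add_neg_cancel, Complex.exp_zero] at this
    refine this.congr fun y => ?_
    rw [← Complex.exp_add]
    congr 1
    push_cast
    ring
  have h2 : ∀ᶠ y in 𝓝[S] x, Complex.exp ((P y - a : ℝ) * Complex.I) ∈ Complex.slitPlane :=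
    h1 (Complex.isOpen_slitPlane.mem_nhds (by simp))
  obtain ⟨ρ, hρ, hb⟩ := Metric.mem_nhdsWithin_iff.mp h2
  set T := Metric.ball x ρ ∩ S
  have hTS : ContinuousOn P T := hP.mono inter_subset_right
  have hTn : 𝓝[S] x = 𝓝[T] x := by
    refine (nhdsWithin_inter_of_mem ?_).symm
    exact nhdsWithin_le_nhds (Metric.ball_mem_nhds x hρ)
  -- Near x the values exp(i(P - a)) lie in the slit plane, so P is the principal branch plus a
  -- multiple of 2π, a single one because the set is connected.
  obtain ⟨n, hn⟩ := (hS ρ hρ).arg_unique (L := P)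
    (K := fun y => a + Complex.arg (Complex.exp ((P y - a : ℝ) * Complex.I))) hTS (by
      refine continuousOn_const.add fun y hy => ?_
      refine ContinuousAt.comp_continuousWithinAt (g := Complex.arg)
        (Complex.continuousAt_arg (hb hy)) ?_
      have : ContinuousWithinAt P T y := hTS y hy
      fun_prop) (by
      intro y hy
      have := Complex.norm_mul_exp_arg_mul_I (Complex.exp ((P y - a : ℝ) * Complex.I))
      rw [Complex.norm_exp_ofReal_mul_I, Complex.ofReal_one, one_mul] at this
      rw [Complex.ofReal_add, add_mul, Complex.exp_add, this, ← Complex.exp_add]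
      congr 1
      push_cast
      ring)
  refine ⟨a + n * (2 * Real.pi), ?_, ?_⟩
  · rw [← hea, Complex.exp_eq_exp_iff_exists_int]
    exact ⟨n, by push_cast; ring⟩
  · have h3 : Filter.Tendsto (fun y => a + Complex.arg (Complex.exp ((P y - a : ℝ) * Complex.I))
        + n * (2 * Real.pi)) (𝓝[S] x) (𝓝 (a + n * (2 * Real.pi))) := by
      have h4 : ContinuousAt Complex.arg 1 := Complex.continuousAt_arg (by simp)
      have := (h4.tendsto.comp h1).const_add a
      simp only [Complex.arg_one, add_zero] at this
      exact this.add_const _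
    refine h3.congr' ?_
    rw [hTn]
    filter_upwards [self_mem_nhdsWithin] with y hy
    exact (hn y hy).symm

theorem Convex.exists_tendsto_of_tendsto_exp {E : Type*} [NormedAddCommGroup E] [NormedSpace ℝ E]
    {S : Set E} (hS : Convex ℝ S) {x : E} {P : E → ℝ} (hP : ContinuousOn P S)
    {e : ℂ} (he : ‖e‖ = 1)
    (h : Filter.Tendsto (fun y => Complex.exp (P y * Complex.I)) (𝓝[S] x) (𝓝 e)) :
    ∃ a : ℝ, Complex.exp (a * Complex.I) = e ∧ Filter.Tendsto P (𝓝[S] x) (𝓝 a) :=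
  _root_.exists_tendsto_of_tendsto_exp
    (fun ρ _ => ((convex_ball x ρ).inter hS).isPreconnected) hP he h

/-! ### Secants on a half disk. -/

/-- The part in the closed upper half plane of a disk about the origin. -/
def halfDisk (r : ℝ) : Set ℂ := {w | 0 ≤ w.im ∧ ‖w‖ < r}

theorem convex_halfDisk (r : ℝ) : Convex ℝ (halfDisk r) := by
  have : halfDisk r = {w : ℂ | 0 ≤ w.im} ∩ Metric.ball 0 r := by
    ext w; simp [halfDisk]
  rw [this]
  exact (convex_halfSpace_im_ge 0).inter (convex_ball 0 r)

/-- A half disk minus a point of the real axis is connected. -/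
theorem isPreconnected_inter_im_nonneg {B : Set ℂ} (hB : Convex ℝ B) {x : ℝ} {c : ℂ} (hc : c ∈ B)
    (hc0 : 0 < c.im) : IsPreconnected {w | w ∈ B ∧ 0 ≤ w.im ∧ w ≠ x} := by
  have hne : c ≠ x := by
    rintro rfl
    simp at hc0
  have hcm : c ∈ {w | w ∈ B ∧ 0 ≤ w.im ∧ w ≠ x} := ⟨hc, hc0.le, hne⟩
  -- The set is star-shaped about `c`: a segment from `c` can reach the real axis only at its other
  -- end.
  refine IsConnected.isPreconnected (IsPathConnected.isConnected
    (StarConvex.isPathConnected (a := c) ?_ hcm))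
  intro w hw a b ha hb hab
  refine ⟨hB hc hw.1 ha hb hab, ?_, ?_⟩
  · have := hw.2.1
    simp only [Complex.add_im, Complex.smul_im, smul_eq_mul]
    positivity
  · intro h
    rcases ha.eq_or_lt with rfl | ha'
    · simp only [zero_add] at hab
      subst hab
      simp only [zero_smul, one_smul, zero_add] at h
      exact hw.2.2 h
    · have h1 := congrArg Complex.im h
      simp only [Complex.add_im, Complex.smul_im, smul_eq_mul, Complex.ofReal_im] at h1
      have := mul_nonneg hb hw.2.1
      have := mul_pos ha' hc0
      linarith

namespace IsSecantLog

variable {N : Set ℂ} {Z : ℂ → ℂ} {d : ℤ} {μ : ℂ × ℂ → ℂ}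

/-- The difference of `μ` at a pair and at the swapped pair has constant exponential. -/
theorem exp_swap (h : IsSecantLog N Z d μ) {x y : ℂ} (hx : x ∈ N) (hy : y ∈ N) (hxy : x ≠ y) :
    Complex.exp (μ (y, x) - μ (x, y)) = (-1) ^ (d + 1) := by
  have h1 := h.eq x hx y hy hxy
  have h2 := h.eq y hy x hx hxy.symm
  have h3 : (x - y : ℂ) ^ d = (-1) ^ d * (y - x) ^ d := by
    rw [← mul_zpow]; congr 1; ring
  have h4 : (y - x : ℂ) ^ d ≠ 0 := zpow_ne_zero _ (sub_ne_zero.mpr hxy.symm)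
  rw [h3] at h2
  have h5 : (y - x) ^ d * Complex.exp (μ (x, y)) =
      (y - x) ^ d * (-((-1) ^ d * Complex.exp (μ (y, x)))) := by
    linear_combination (-1 : ℂ) * h1 - h2
  have h6 := mul_left_cancel₀ h4 h5
  rw [Complex.exp_sub, h6, zpow_add₀ (by norm_num), zpow_one]
  have h7 : ((-1 : ℂ) ^ d) * (-1) ^ d = 1 := by
    rw [← mul_zpow]; simp
  have h8 : ((-1 : ℂ) ^ d) ≠ 0 := zpow_ne_zero _ (by norm_num)
  field_simp
  linear_combination h7

/-- The difference of μ between a pair and its swap has constant exponential, so it is constant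
along paths of pairs. Moving one point at a time through `p` joins (x, y) to (y, x) without
collision, so the difference has the same value at both. But the swap changes its sign, so it is
zero, and (-1)^(d+1) = 1. -/
theorem swap_eq (h : IsSecantLog N Z d μ) (hN : Convex ℝ N) {p : ℂ} (hp : p ∈ N) (hp0 : 0 < p.im)
    {x y : ℝ} (hx : (x : ℂ) ∈ N) (hy : (y : ℂ) ∈ N) (hxy : x ≠ y) :
    μ (y, x) = μ (x, y) ∧ Odd d := by
  set c : ℂ × ℂ → ℂ := fun q => μ (q.2, q.1) - μ q with hc
  have hcc : ContinuousOn c {q | q.1 ∈ N ∧ q.2 ∈ N ∧ q.1 ≠ q.2} := by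
    refine ContinuousOn.sub (h.continuousOn.comp (by fun_prop) ?_) h.continuousOn
    rintro ⟨a, b⟩ ⟨ha, hb, hab⟩
    exact ⟨hb, ha, hab.symm⟩
  have hexp : ∀ q ∈ {q : ℂ × ℂ | q.1 ∈ N ∧ q.2 ∈ N ∧ q.1 ≠ q.2},
      Complex.exp (c q) = (-1) ^ (d + 1) := by
    rintro ⟨a, b⟩ ⟨ha, hb, hab⟩
    exact h.exp_swap ha hb hab
  -- moving one of the points between the real axis and `p`
  have hmove : ∀ (f : ℝ → ℂ × ℂ), Continuous f →
      (∀ t ∈ Icc (0 : ℝ) 1, f t ∈ {q : ℂ × ℂ | q.1 ∈ N ∧ q.2 ∈ N ∧ q.1 ≠ q.2}) →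
      c (f 0) = c (f 1) := by
    intro f hf hfm
    exact isPreconnected_Icc.eq_of_exp_eq (L := fun t => c (f t)) (S := Icc (0 : ℝ) 1)
      (hcc.comp hf.continuousOn hfm) (fun t ht => hexp _ (hfm t ht)) (by simp) (by simp)
  have hseg : ∀ a b : ℝ, (a : ℂ) ∈ N → a ≠ b → ∀ t ∈ Icc (0 : ℝ) 1,
      ((1 - t) • (a : ℂ) + t • p ∈ N ∧ (1 - t) • (a : ℂ) + t • p ≠ b) := by
    intro a b ha hab t ht
    refine ⟨hN ha hp (by linarith [ht.2]) ht.1 (by ring), fun h => ?_⟩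
    have h1 := congrArg Complex.im h
    simp only [Complex.add_im, Complex.smul_im, smul_eq_mul, Complex.ofReal_im, mul_zero,
      zero_add] at h1
    rcases mul_eq_zero.mp h1 with h2 | h2
    · subst h2
      simp only [sub_zero, one_smul, zero_smul, add_zero] at h
      exact hab (by exact_mod_cast h)
    · exact hp0.ne' h2
  have h1 : c (x, y) = c (p, y) := by
    have := hmove (fun t => ((1 - t) • (x : ℂ) + t • p, (y : ℂ))) (by fun_prop)
      (fun t ht => ⟨(hseg x y hx hxy t ht).1, hy, (hseg x y hx hxy t ht).2⟩)
    simpa using this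
  have h2 : c (p, y) = c (p, x) := by
    have hpr : ∀ t : ℝ, p ≠ (1 - t) • (y : ℂ) + t • (x : ℂ) := by
      intro t h
      rw [h] at hp0
      simp at hp0
    have := hmove (fun t => (p, (1 - t) • (y : ℂ) + t • (x : ℂ))) (by fun_prop)
      (fun t ht => ⟨hp, hN hy hx (by linarith [ht.2]) ht.1 (by ring), hpr t⟩)
    simpa using this
  have h3 : c (y, x) = c (p, x) := by
    have := hmove (fun t => ((1 - t) • (y : ℂ) + t • p, (x : ℂ))) (by fun_prop)
      (fun t ht => ⟨(hseg y x hy hxy.symm t ht).1, hx, (hseg y x hy hxy.symm t ht).2⟩)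
    simpa using this
  have h4 : c (x, y) = c (y, x) := by rw [h1, h2, h3]
  have h5 : μ (y, x) = μ (x, y) := by
    simp only [hc] at h4
    linear_combination h4 / 2
  refine ⟨h5, ?_⟩
  have h6 := h.exp_swap hx hy (by exact_mod_cast hxy)
  rw [h5, sub_self, Complex.exp_zero] at h6
  by_contra hodd
  rw [Int.not_odd_iff_even] at hodd
  rw [Odd.neg_one_zpow hodd.add_one] at h6
  norm_num at h6

end IsSecantLog

theorem exp_im_mul_I_eq {z m : ℂ} {c : ℝ} (hc : 0 < c) (h : z = c * Complex.exp m) :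
    Complex.exp (m.im * Complex.I) = z / ‖z‖ := by
  have h1 : Complex.exp m = Real.exp m.re * Complex.exp (m.im * Complex.I) := by
    rw [Complex.ofReal_exp, ← Complex.exp_add, Complex.re_add_im]
  have h2 : ‖z‖ = c * Real.exp m.re := by
    rw [h, norm_mul, Complex.norm_real, Complex.norm_exp, Real.norm_of_nonneg hc.le]
  have h3 : (c : ℂ) ≠ 0 := by exact_mod_cast hc.ne'
  have h4 : (Real.exp m.re : ℂ) ≠ 0 := by exact_mod_cast (Real.exp_pos _).ne'
  rw [h2, h, h1]
  push_cast at h4 ⊢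
  field_simp

theorem eq_norm_mul_exp_of_eq {z : ℂ} {a : ℝ} (hz : z ≠ 0)
    (h : Complex.exp (a * Complex.I) = z / ‖z‖) : z = ‖z‖ * Complex.exp (a * Complex.I) := by
  have : (‖z‖ : ℂ) ≠ 0 := by exact_mod_cast norm_ne_zero_iff.mpr hz
  rw [h]
  field_simp

theorem tendsto_div_norm {α : Type*} {l : Filter α} {f : α → ℂ} {e : ℂ} (he : e ≠ 0)
    (h : Filter.Tendsto f l (𝓝 e)) :
    Filter.Tendsto (fun x => f x / ‖f x‖) l (𝓝 (e / ‖e‖)) := by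
  refine h.div ((Complex.continuous_ofReal.tendsto _).comp h.norm) ?_
  exact_mod_cast norm_ne_zero_iff.mpr he

theorem norm_div_norm_eq_one {e : ℂ} (he : e ≠ 0) : ‖e / (‖e‖ : ℂ)‖ = 1 := by
  rw [norm_div, Complex.norm_real, norm_norm, div_self (norm_ne_zero_iff.mpr he)]

theorem ofReal_mem_halfDisk {r t : ℝ} (h : |t| < r) : (t : ℂ) ∈ halfDisk r := by
  refine ⟨by simp, ?_⟩
  rwa [Complex.norm_real]

theorem continuousOn_arg_upper :
    ContinuousOn Complex.arg {w | 0 ≤ w.im ∧ w ≠ 0} := by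
  rintro w ⟨hw, hw0⟩
  by_cases hs : w ∈ Complex.slitPlane
  · exact (Complex.continuousAt_arg hs).continuousWithinAt
  · rw [Complex.mem_slitPlane_iff] at hs
    push Not at hs
    have : w.re ≠ 0 := fun h => hw0 (Complex.ext h hs.2)
    refine (Complex.continuousWithinAt_arg_of_re_neg_of_im_zero (lt_of_le_of_ne hs.1 this)
      hs.2).mono fun z hz => hz.1

/-- The branch of the argument of `Z y - Z x` given by a secant logarithm. -/
noncomputable def secantArg (d : ℤ) (μ : ℂ × ℂ → ℂ) (x : ℝ) (y : ℂ) : ℝ :=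
  d * Complex.arg (y - x) + (μ (x, y)).im

namespace IsSecantLog

variable {r : ℝ} {Z : ℂ → ℂ} {d : ℤ} {μ : ℂ × ℂ → ℂ}

theorem continuousOn_secantArg (h : IsSecantLog (halfDisk r) Z d μ) {x : ℝ} (hx : |x| < r) :
    ContinuousOn (secantArg d μ x) {y | y ∈ halfDisk r ∧ y ≠ x} := by
  refine ContinuousOn.add (continuousOn_const.mul (continuousOn_arg_upper.comp (by fun_prop) ?_))
    (Complex.continuous_im.comp_continuousOn (h.continuousOn.comp (by fun_prop) ?_))
  · intro y hy
    exact ⟨by simpa using hy.1.1, sub_ne_zero.mpr hy.2⟩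
  · intro y hy
    exact ⟨ofReal_mem_halfDisk hx, hy.1, hy.2.symm⟩

theorem exp_secantArg (h : IsSecantLog (halfDisk r) Z d μ) {x : ℝ} (hx : |x| < r) {y : ℂ}
    (hy : y ∈ halfDisk r) (hxy : y ≠ x) :
    Complex.exp (secantArg d μ x y * Complex.I) = (Z y - Z x) / ‖Z y - Z x‖ := by
  have h1 := h.eq x (ofReal_mem_halfDisk hx) y hy hxy.symm
  have h0 : y - x ≠ 0 := sub_ne_zero.mpr hxy
  have h2 : Z y - Z x = (1 : ℝ) * Complex.exp (d * Complex.log (y - x) + μ (x, y)) := by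
    rw [h1, Complex.exp_add, Complex.exp_int_mul, Complex.exp_log h0]
    simp
  rw [← exp_im_mul_I_eq one_pos h2]
  congr 2
  simp [secantArg, Complex.log_im]

/-- For p.1 < p.2 the power of p.2 - p.1 is positive, so Im μ is an argument of the difference
quotient; convexity of `S` lets convergence pass from the direction to the argument. -/
theorem exists_tendsto_im (h : IsSecantLog (halfDisk r) Z d μ) (hr : 0 < r) {S : Set (ℝ × ℝ)}
    (hS : Convex ℝ S) (hlt : ∀ p ∈ S, p.1 < p.2) {e : ℂ} (he : e ≠ 0)
    (ht : Filter.Tendsto (fun p : ℝ × ℝ => (Z p.2 - Z p.1) / (p.2 - p.1 : ℝ)) (𝓝[S] 0) (𝓝 e)) :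
    ∃ a : ℝ, Complex.exp (a * Complex.I) = e / ‖e‖ ∧
      Filter.Tendsto (fun p : ℝ × ℝ => (μ (p.1, p.2)).im) (𝓝[S] 0) (𝓝 a) := by
  set T := Metric.ball (0 : ℝ × ℝ) r ∩ S
  have hTn : 𝓝[S] (0 : ℝ × ℝ) = 𝓝[T] 0 := by
    refine (nhdsWithin_inter_of_mem ?_).symm
    exact nhdsWithin_le_nhds (Metric.ball_mem_nhds _ hr)
  have hT : ∀ p ∈ T, |p.1| < r ∧ |p.2| < r ∧ p.1 < p.2 := by
    rintro ⟨s, t⟩ ⟨h1, h2⟩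
    rw [mem_ball_zero_iff, Prod.norm_def, max_lt_iff] at h1
    exact ⟨h1.1, h1.2, hlt _ h2⟩
  have hcont : ContinuousOn (fun p : ℝ × ℝ => (μ (p.1, p.2)).im) T := by
    refine Complex.continuous_im.comp_continuousOn (h.continuousOn.comp (by fun_prop) ?_)
    intro p hp
    obtain ⟨h1, h2, h3⟩ := hT p hp
    exact ⟨ofReal_mem_halfDisk h1, ofReal_mem_halfDisk h2, fun h => h3.ne (Complex.ofReal_injective h)⟩
  rw [hTn] at ht ⊢
  refine ((convex_ball _ _).inter hS).exists_tendsto_of_tendsto_exp hcont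
    (norm_div_norm_eq_one he) ?_
  refine (tendsto_div_norm he ht).congr' ?_
  filter_upwards [self_mem_nhdsWithin] with p hp
  obtain ⟨h1, h2, h3⟩ := hT p hp
  have h4 : (p.1 : ℂ) ≠ p.2 := by exact_mod_cast h3.ne
  have h5 := h.eq _ (ofReal_mem_halfDisk h1) _ (ofReal_mem_halfDisk h2) h4
  have h6 : 0 < p.2 - p.1 := sub_pos.mpr h3
  rw [exp_im_mul_I_eq (z := (Z p.2 - Z p.1) / (p.2 - p.1 : ℝ)) (c := (p.2 - p.1) ^ (d - 1))
    (by positivity)]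
  rw [h5, zpow_sub_one₀ h6.ne']
  push_cast
  ring

end IsSecantLog

/-! ### Corners with C¹ sides: the side of an edge, the degree and the angle. -/

/-- `Z` is a continuous injection of a half disk sending `0` to `0`, whose restriction to the real
axis has the one-sided velocities `e` and `e'` at `0` in the strict sense. -/
structure IsPlaneCorner (Z : ℂ → ℂ) (r : ℝ) (e e' : ℂ) : Prop where
  pos : 0 < r
  zero : Z 0 = 0
  continuousOn : ContinuousOn Z (halfDisk r)
  injOn : InjOn Z (halfDisk r)
  ne : e ≠ 0
  ne' : e' ≠ 0
  front : Filter.Tendsto (fun p : ℝ × ℝ => (Z p.2 - Z p.1) / (p.2 - p.1 : ℝ))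
    (𝓝[{p | 0 ≤ p.1 ∧ p.1 < p.2}] 0) (𝓝 e)
  back : Filter.Tendsto (fun p : ℝ × ℝ => (Z p.2 - Z p.1) / (p.2 - p.1 : ℝ))
    (𝓝[{p | p.1 < p.2 ∧ p.2 ≤ 0}] 0) (𝓝 e')

namespace IsPlaneCorner

variable {Z : ℂ → ℂ} {r : ℝ} {e e' : ℂ}

/-- All difference quotients along the front edge are close to e, so Z s and Z t - Z s make an acute
angle and moving outwards increases the norm. -/
theorem exists_strictMonoOn_norm (h : IsPlaneCorner Z r e e') :
    ∃ κ, 0 < κ ∧ κ < r ∧ StrictMonoOn (fun t : ℝ => ‖Z t‖) (Icc 0 κ) := by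
  have h1 : ∀ᶠ p : ℝ × ℝ in 𝓝[{p | 0 ≤ p.1 ∧ p.1 < p.2}] 0,
      ‖(Z p.2 - Z p.1) / (p.2 - p.1 : ℝ) / e - 1‖ < 1 / 4 := by
    have := (h.front.div_const e).sub_const 1
    rw [div_self h.ne, sub_self] at this
    have := this.norm
    rw [norm_zero] at this
    exact this (Iio_mem_nhds (by norm_num))
  obtain ⟨ρ, hρ, hb⟩ := Metric.mem_nhdsWithin_iff.mp h1
  obtain ⟨κ, hκ, hκ'⟩ := exists_between (lt_min hρ h.pos)
  have hq : ∀ s t : ℝ, 0 ≤ s → s < t → t ≤ κ →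
      ‖(Z t - Z s) / (t - s : ℝ) / e - 1‖ < 1 / 4 := by
    intro s t hs hst ht
    have hκρ := hκ'.trans_le (min_le_left _ _)
    refine hb (a := ((s, t) : ℝ × ℝ)) ⟨?_, hs, hst⟩
    rw [mem_ball_zero_iff, Prod.norm_def, max_lt_iff]
    simp only [Real.norm_eq_abs]
    rw [abs_of_nonneg hs, abs_of_nonneg (hs.trans hst.le)]
    constructor <;> linarith
  refine ⟨κ, hκ, hκ'.trans_le (min_le_right _ _), ?_⟩
  intro s hs t ht hst
  obtain ⟨v, hv, hvt⟩ : ∃ v : ℂ, ‖v - 1‖ < 1 / 4 ∧ Z t = Z s + (t - s : ℝ) * v * e := by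
    refine ⟨_, hq s t hs.1 hst ht.2, ?_⟩
    have h2 : ((t - s : ℝ) : ℂ) ≠ 0 := by exact_mod_cast (sub_pos.mpr hst).ne'
    field_simp [h.ne]
    ring
  obtain ⟨u, hu, hut⟩ : ∃ u : ℂ, ‖u - 1‖ < 1 / 4 ∧ Z s = s * u * e := by
    rcases hs.1.eq_or_lt with h0 | h0
    · refine ⟨1, by norm_num, ?_⟩
      rw [← h0]
      simp [h.zero]
    · refine ⟨_, hq 0 s le_rfl h0 hs.2, ?_⟩
      have h2 : (s : ℂ) ≠ 0 := by exact_mod_cast h0.ne'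
      simp only [Complex.ofReal_zero, h.zero, sub_zero]
      field_simp [h.ne]
  simp only
  rw [hvt, hut, ← add_mul, norm_mul (s * u) e, norm_mul (s * u + _) e]
  refine mul_lt_mul_of_pos_right ?_ (norm_pos_iff.mpr h.ne)
  rw [← sq_lt_sq₀ (norm_nonneg _) (norm_nonneg _), ← Complex.normSq_eq_norm_sq,
    ← Complex.normSq_eq_norm_sq, Complex.normSq_apply, Complex.normSq_apply]
  simp only [Complex.add_re, Complex.add_im, Complex.re_ofReal_mul, Complex.im_ofReal_mul]
  have b1 := abs_lt.mp ((Complex.abs_re_le_norm _).trans_lt hu)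
  have b2 := abs_lt.mp ((Complex.abs_im_le_norm _).trans_lt hu)
  have b3 := abs_lt.mp ((Complex.abs_re_le_norm _).trans_lt hv)
  have b4 := abs_lt.mp ((Complex.abs_im_le_norm _).trans_lt hv)
  simp only [Complex.sub_re, Complex.sub_im, Complex.one_re, Complex.one_im, sub_zero] at b1 b2 b3 b4
  -- With u and v within 1/4 of 1, the real part of u times the conjugate of v exceeds 9/16 - 1/16,
  -- hence is positive.
  have c1 : 9 / 16 < u.re * v.re := by nlinarith
  have c2 : -(1 / 16) < u.im * v.im := by
    have : |u.im * v.im| < 1 / 16 := by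
      rw [abs_mul]
      have := abs_lt.mpr b2
      have := abs_lt.mpr b4
      have := abs_nonneg u.im
      have := abs_nonneg v.im
      nlinarith
    exact (abs_lt.mp this).1
  have c3 : 0 ≤ s * (t - s) := mul_nonneg hs.1 (sub_pos.mpr hst).le
  have c4 : 0 < (t - s) ^ 2 * (v.re ^ 2 + v.im ^ 2) := by
    have : 0 < t - s := sub_pos.mpr hst
    have : 0 < v.re := by linarith
    positivity
  have c5 : 0 ≤ s * (t - s) * (u.re * v.re + u.im * v.im) := mul_nonneg c3 (by linarith)
  nlinarith

/-- Near a corner, the image of the interior of the half disk lies on one side of the image of the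
positive real axis. -/
theorem exists_side (h : IsPlaneCorner Z r e e') {A : ℂ → ℝ} {α β : ℝ}
    (hA : ContinuousOn A {y | y ∈ halfDisk r ∧ y ≠ (0 : ℝ)})
    (hAe : ∀ y ∈ halfDisk r, y ≠ (0 : ℝ) → Complex.exp (A y * Complex.I) = Z y / ‖Z y‖)
    (hα : Filter.Tendsto (fun t : ℝ => A t) (𝓝[>] 0) (𝓝 α))
    (hβ : Filter.Tendsto (fun t : ℝ => A t) (𝓝[<] 0) (𝓝 β)) :
    ∃ σ : ℤ, (σ = 1 ∨ σ = -1) ∧ 0 ≤ σ * (β - α) ∧ σ * (β - α) ≤ 2 * Real.pi ∧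
      ∃ κ, 0 < κ ∧ κ < r ∧ StrictMonoOn (fun t : ℝ => ‖Z t‖) (Icc 0 κ) ∧
        ∀ y : ℂ, 0 < y.im → ‖y‖ < κ → ∀ t ∈ Icc (0 : ℝ) κ, ‖Z t‖ = ‖Z y‖ →
          0 < σ * (A y - A t) ∧ σ * (A y - A t) < 2 * Real.pi := by
  have hpi := Real.pi_pos
  obtain ⟨κ, hκ, hκr, hmono⟩ := h.exists_strictMonoOn_norm
  have hmem : ∀ t : ℝ, t ∈ Icc 0 κ → (t : ℂ) ∈ halfDisk r := fun t ht =>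
    ofReal_mem_halfDisk (by rw [abs_of_nonneg ht.1]; exact ht.2.trans_lt hκr)
  have hZt : ContinuousOn (fun t : ℝ => ‖Z t‖) (Icc 0 κ) :=
    (h.continuousOn.comp (by fun_prop) fun t ht => hmem t ht).norm
  have h0mem : (0 : ℂ) ∈ halfDisk r := by simpa using hmem 0 (by simp [hκ.le])
  have hZκ : 0 < ‖Z κ‖ := by
    have := hmono (by simp [hκ.le] : (0 : ℝ) ∈ Icc 0 κ) (by simp [hκ.le]) hκ
    simpa [h.zero] using this
  -- the radius in which every norm is attained on the front edge
  obtain ⟨r1, hr1, hr1κ, hr1Z⟩ : ∃ r1, 0 < r1 ∧ r1 ≤ κ ∧ ∀ y ∈ halfDisk r1, ‖Z y‖ < ‖Z κ‖ := by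
    have := (h.continuousOn 0 h0mem).norm
    rw [ContinuousWithinAt, h.zero, norm_zero] at this
    obtain ⟨ρ, hρ, hb⟩ := Metric.mem_nhdsWithin_iff.mp (this (Iio_mem_nhds hZκ))
    refine ⟨min ρ κ, lt_min hρ hκ, min_le_right _ _, fun y hy => ?_⟩
    refine hb (a := y) ⟨?_, hy.1, hy.2.trans_le ((min_le_right _ _).trans hκr.le)⟩
    simpa using hy.2.trans_le (min_le_left _ _)
  -- `T y` is the parameter at which the circle about 0 through Z y meets the front edge; it is
  -- unique because the norm is strictly monotone there.
  have hT : ∀ y : ℂ, ∃ t : ℝ, y ∈ halfDisk r1 → t ∈ Icc 0 κ ∧ ‖Z t‖ = ‖Z y‖ := by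
    intro y
    by_cases hy : y ∈ halfDisk r1
    · obtain ⟨t, ht, hty⟩ := intermediate_value_Icc hκ.le hZt (show ‖Z y‖ ∈ Icc _ _ by
        simp only [Complex.ofReal_zero, h.zero, norm_zero]
        exact ⟨norm_nonneg _, (hr1Z y hy).le⟩)
      exact ⟨t, fun _ => ⟨ht, hty⟩⟩
    · exact ⟨0, fun h => absurd h hy⟩
  choose T hT using hT
  have hr1r : halfDisk r1 ⊆ halfDisk r := fun y hy => ⟨hy.1, hy.2.trans_le (hr1κ.trans hκr.le)⟩
  have hTuniq : ∀ y ∈ halfDisk r1, ∀ t ∈ Icc (0 : ℝ) κ, ‖Z t‖ = ‖Z y‖ → T y = t := by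
    intro y hy t ht hty
    exact hmono.injOn (hT y hy).1 ht (by simp only [(hT y hy).2, hty])
  have hTc : ContinuousOn T (halfDisk r1) := by
    intro y hy
    have hZy : ContinuousWithinAt (fun z => ‖Z z‖) (halfDisk r1) y :=
      ((h.continuousOn y (hr1r hy)).mono hr1r).norm
    obtain ⟨hy1, hy2⟩ := hT y hy
    refine tendsto_order.mpr ⟨fun a ha => ?_, fun a ha => ?_⟩
    · rcases lt_or_ge a 0 with h0 | h0
      · filter_upwards [self_mem_nhdsWithin] with z hz
        exact h0.trans_le (hT z hz).1.1
      · have haκ : a ∈ Icc 0 κ := ⟨h0, ha.le.trans hy1.2⟩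
        have h1 : ‖Z a‖ < ‖Z y‖ := by
          rw [← hy2]; exact hmono haκ hy1 ha
        filter_upwards [self_mem_nhdsWithin, hZy (Ioi_mem_nhds h1)] with z hz hz1
        have hz1 : ‖Z a‖ < ‖Z z‖ := hz1
        rw [← (hT z hz).2] at hz1
        exact (hmono.lt_iff_lt haκ (hT z hz).1).mp hz1
    · rcases lt_or_ge κ a with h0 | h0
      · filter_upwards [self_mem_nhdsWithin] with z hz
        exact (hT z hz).1.2.trans_lt h0
      · have haκ : a ∈ Icc 0 κ := ⟨hy1.1.trans ha.le, h0⟩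
        have h1 : ‖Z y‖ < ‖Z a‖ := by
          rw [← hy2]; exact hmono hy1 haκ ha
        filter_upwards [self_mem_nhdsWithin, hZy (Iio_mem_nhds h1)] with z hz hz1
        have hz1 : ‖Z z‖ < ‖Z a‖ := hz1
        rw [← (hT z hz).2] at hz1
        exact (hmono.lt_iff_lt (hT z hz).1 haκ).mp hz1
  have hT0 : ∀ y ∈ halfDisk r1, y ≠ (0 : ℝ) → T y ≠ 0 := by
    intro y hy hy0 hTy
    have h1 := (hT y hy).2
    rw [hTy, Complex.ofReal_zero, h.zero, norm_zero] at h1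
    refine hy0 ?_
    rw [Complex.ofReal_zero]
    refine h.injOn (hr1r hy) h0mem ?_
    rw [h.zero, norm_eq_zero.mp h1.symm]
  -- The angle along that circle from the front edge to Z y.
  set om : ℂ → ℝ := fun y => A y - A (T y) with hom
  have homc : ContinuousOn om {y | y ∈ halfDisk r1 ∧ y ≠ (0 : ℝ)} := by
    refine (hA.mono fun y hy => ⟨hr1r hy.1, hy.2⟩).sub (hA.comp ?_ ?_)
    · exact Complex.continuous_ofReal.comp_continuousOn (hTc.mono fun y hy => hy.1)
    · intro y hy
      exact ⟨hmem _ (hT y hy.1).1, fun h => hT0 y hy.1 hy.2 (Complex.ofReal_injective h)⟩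
  -- the interior part
  set U : Set ℂ := {y | y ∈ halfDisk r1 ∧ 0 < y.im} with hU
  have hUsub : U ⊆ {y | y ∈ halfDisk r1 ∧ y ≠ (0 : ℝ)} := by
    rintro y ⟨hy, hy0⟩
    refine ⟨hy, ?_⟩
    rintro rfl
    simp at hy0
  have hUconv : Convex ℝ U := (convex_halfDisk r1).inter (convex_halfSpace_im_gt 0)
  -- Otherwise Z y would lie on the front edge, against injectivity. Hence over the connected
  -- interior `om` stays between two consecutive multiples of 2π.
  have homne : ∀ y ∈ U, ∀ n : ℤ, om y ≠ 2 * Real.pi * n := by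
    intro y hy n hn
    have hy' := hUsub hy
    obtain ⟨hT1, hT2⟩ := hT y hy.1
    have e1 := hAe y (hr1r hy.1) hy'.2
    have e2 := hAe (T y) (hmem _ hT1) (by exact_mod_cast hT0 y hy.1 hy'.2)
    have h3 : A y = A (T y) + 2 * Real.pi * n := by rw [← hn]; simp [hom]
    have h4 : Complex.exp (A y * Complex.I) = Complex.exp (A (T y) * Complex.I) := by
      rw [Complex.exp_eq_exp_iff_exists_int]
      refine ⟨n, ?_⟩
      rw [h3]; push_cast; ring
    rw [e1, e2, hT2] at h4
    have hZ0 : (‖Z y‖ : ℂ) ≠ 0 := by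
      intro h5
      have h5 : Z y = 0 := by simpa using h5
      refine hy'.2 ?_
      rw [Complex.ofReal_zero]
      exact h.injOn (hr1r hy.1) h0mem (by rw [h5, h.zero])
    have h6 : Z y = Z (T y) := by
      field_simp at h4
      exact h4
    have h7 := h.injOn (hr1r hy.1) (hmem _ hT1) h6
    have h8 := hy.2
    rw [h7] at h8
    simp at h8
  have hy0U : ((r1 / 2 : ℝ) * Complex.I) ∈ U := by
    refine ⟨⟨by simp; positivity, ?_⟩, by simp; positivity⟩
    rw [norm_mul, Complex.norm_real, Complex.norm_I, Real.norm_of_nonneg (by positivity)]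
    linarith
  set m : ℤ := ⌊om ((r1 / 2 : ℝ) * Complex.I) / (2 * Real.pi)⌋ with hm
  have homcU := homc.mono hUsub
  have hbounds : ∀ y ∈ U, 2 * Real.pi * m < om y ∧ om y < 2 * Real.pi * (m + 1) := by
    intro y hy
    have f1 : 2 * Real.pi * m ≤ om ((r1 / 2 : ℝ) * Complex.I) := by
      have := Int.floor_le (om ((r1 / 2 : ℝ) * Complex.I) / (2 * Real.pi))
      rw [le_div_iff₀ (by positivity)] at this
      linarith
    have f2 : om ((r1 / 2 : ℝ) * Complex.I) < 2 * Real.pi * (m + 1) := by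
      have := Int.lt_floor_add_one (om ((r1 / 2 : ℝ) * Complex.I) / (2 * Real.pi))
      rw [div_lt_iff₀ (by positivity)] at this
      linarith
    constructor
    · by_contra hlt
      push Not at hlt
      obtain ⟨z, hz, hz1⟩ := hUconv.isPreconnected.intermediate_value hy hy0U homcU ⟨hlt, f1⟩
      exact homne z hz m hz1
    · by_contra hlt
      push Not at hlt
      obtain ⟨z, hz, hz1⟩ := hUconv.isPreconnected.intermediate_value hy0U hy homcU ⟨f2.le, hlt⟩
      exact homne z hz (m + 1) (by rw [hz1]; push_cast; ring)
  -- passing to the real axis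
  have hclos : ∀ s : ℝ, s ≠ 0 → |s| < r1 → 2 * Real.pi * m ≤ om s ∧ om s ≤ 2 * Real.pi * (m + 1) := by
    intro s hs hsr
    have hsm : (s : ℂ) ∈ {y | y ∈ halfDisk r1 ∧ y ≠ (0 : ℝ)} :=
      ⟨ofReal_mem_halfDisk hsr, by exact_mod_cast hs⟩
    have hpath : Filter.Tendsto (fun τ : ℝ => (s : ℂ) + τ * Complex.I) (𝓝[>] 0)
        (𝓝[{y | y ∈ halfDisk r1 ∧ y ≠ (0 : ℝ)}] (s : ℂ)) ∧
        ∀ᶠ τ : ℝ in 𝓝[>] 0, (s : ℂ) + τ * Complex.I ∈ U := by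
      have c1 : Filter.Tendsto (fun τ : ℝ => (s : ℂ) + τ * Complex.I) (𝓝 0) (𝓝 (s : ℂ)) := by
        have : ContinuousAt (fun τ : ℝ => (s : ℂ) + τ * Complex.I) 0 := by fun_prop
        simpa [ContinuousAt] using this
      have c1' := c1.mono_left (nhdsWithin_le_nhds (s := Ioi 0))
      have c2 : ∀ᶠ τ : ℝ in 𝓝[>] 0, (s : ℂ) + τ * Complex.I ∈ U := by
        have c3 : ∀ᶠ τ : ℝ in 𝓝[>] 0, ‖(s : ℂ) + τ * Complex.I‖ < r1 :=
          c1'.norm (Iio_mem_nhds (by simpa using hsr))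
        filter_upwards [c3, self_mem_nhdsWithin] with τ hτ hτ0
        have hτ0 : 0 < τ := hτ0
        exact ⟨⟨by simp [hτ0.le], hτ⟩, by simp [hτ0]⟩
      refine ⟨tendsto_nhdsWithin_iff.mpr ⟨c1', ?_⟩, c2⟩
      filter_upwards [c2] with τ hτ using hUsub hτ
    have hlim := (homc s hsm).tendsto.comp hpath.1
    constructor
    · refine ge_of_tendsto hlim ?_
      filter_upwards [hpath.2] with τ hτ using (hbounds _ hτ).1.le
    · refine le_of_tendsto hlim ?_
      filter_upwards [hpath.2] with τ hτ using (hbounds _ hτ).2.le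
  -- On the front edge itself `om` is 0, which leaves only the intervals (0, 2π) and (-2π, 0): these
  -- are the two sides σ = 1 and σ = -1.
  have hfront := hclos (r1 / 2) (by positivity) (by rw [abs_of_pos (by positivity)]; linarith)
  have hom0 : om ((r1 / 2 : ℝ) : ℂ) = 0 := by
    have : T ((r1 / 2 : ℝ) : ℂ) = r1 / 2 :=
      hTuniq _ (ofReal_mem_halfDisk (by rw [abs_of_pos (by positivity)]; linarith)) _
        ⟨by positivity, by linarith⟩ rfl
    simp only [hom, this, sub_self]
  rw [hom0] at hfront
  have hm01 : m = 0 ∨ m = -1 := by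
    have g1 : (m : ℝ) ≤ 0 := by
      by_contra hcon
      push Not at hcon
      have := mul_pos (mul_pos two_pos hpi) hcon
      linarith
    have g2 : (-1 : ℝ) ≤ m := by
      by_contra hcon
      push Not at hcon
      have := mul_neg_of_pos_of_neg (mul_pos two_pos hpi) (show (m : ℝ) + 1 < 0 by linarith)
      linarith
    have g1' : m ≤ 0 := by exact_mod_cast g1
    have g2' : -1 ≤ m := by exact_mod_cast g2
    omega
  -- Approaching the corner along the back edge, `T` tends to 0 from above, so `om` tends to β - α.
  have hlimβ : 2 * Real.pi * m ≤ β - α ∧ β - α ≤ 2 * Real.pi * (m + 1) := by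
    have hTt : Filter.Tendsto (fun s : ℝ => T s) (𝓝[<] 0) (𝓝[>] 0) := by
      have c0 : T (0 : ℂ) = 0 := hTuniq 0 ⟨by simp, by simpa using hr1⟩ 0 ⟨le_rfl, hκ.le⟩ (by simp)
      have c1 : Filter.Tendsto (fun s : ℝ => (s : ℂ)) (𝓝[<] 0) (𝓝[halfDisk r1] (0 : ℂ)) := by
        refine tendsto_nhdsWithin_iff.mpr ⟨?_, ?_⟩
        · have : ContinuousAt (fun s : ℝ => (s : ℂ)) 0 := by fun_prop
          have := this.tendsto.mono_left (nhdsWithin_le_nhds (s := Iio 0))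
          simpa using this
        · filter_upwards [nhdsWithin_le_nhds (Ioo_mem_nhds (neg_lt_zero.mpr hr1) hr1)] with s hs
          exact ofReal_mem_halfDisk (abs_lt.mpr hs)
      have c2 := (hTc 0 ⟨by simp, by simpa using hr1⟩).tendsto.comp c1
      rw [c0] at c2
      refine tendsto_nhdsWithin_iff.mpr ⟨c2, ?_⟩
      filter_upwards [nhdsWithin_le_nhds (Ioo_mem_nhds (neg_lt_zero.mpr hr1) hr1),
        self_mem_nhdsWithin] with s hs hs0
      have hs0 : s < 0 := hs0
      have hsm := ofReal_mem_halfDisk (abs_lt.mpr hs)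
      exact lt_of_le_of_ne (hT _ hsm).1.1 (hT0 _ hsm (by exact_mod_cast hs0.ne)).symm
    have hlim := hβ.sub (hα.comp hTt)
    have hev : ∀ᶠ s : ℝ in 𝓝[<] 0, 2 * Real.pi * m ≤ om s ∧ om s ≤ 2 * Real.pi * (m + 1) := by
      filter_upwards [nhdsWithin_le_nhds (Ioo_mem_nhds (neg_lt_zero.mpr hr1) hr1),
        self_mem_nhdsWithin] with s hs hs0
      have hs0 : s < 0 := hs0
      exact hclos s hs0.ne (abs_lt.mpr hs)
    exact ⟨ge_of_tendsto hlim (hev.mono fun s hs => hs.1),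
      le_of_tendsto hlim (hev.mono fun s hs => hs.2)⟩
  have hκ1 : StrictMonoOn (fun t : ℝ => ‖Z t‖) (Icc 0 (r1 / 2)) :=
    hmono.mono (Icc_subset_Icc_right (by linarith))
  have hfinal : ∀ y : ℂ, 0 < y.im → ‖y‖ < r1 / 2 → ∀ t ∈ Icc (0 : ℝ) (r1 / 2), ‖Z t‖ = ‖Z y‖ →
      2 * Real.pi * m < A y - A t ∧ A y - A t < 2 * Real.pi * (m + 1) := by
    intro y hy hyr t ht hty
    have hyU : y ∈ U := ⟨⟨hy.le, by linarith⟩, hy⟩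
    have := hTuniq y hyU.1 t ⟨ht.1, ht.2.trans (by linarith)⟩ hty
    have hb := hbounds y hyU
    simp only [hom, this] at hb
    exact hb
  rcases hm01 with h0 | h0
  · rw [h0] at hlimβ hfinal
    refine ⟨1, Or.inl rfl, ?_, ?_, r1 / 2, by positivity, by linarith, hκ1, ?_⟩
    · have := hlimβ.1; push_cast at this ⊢; linarith
    · have := hlimβ.2; push_cast at this ⊢; linarith
    · intro y hy hyr t ht hty
      have := hfinal y hy hyr t ht hty
      push_cast at this ⊢
      constructor <;> linarith [this.1, this.2]
  · rw [h0] at hlimβ hfinal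
    refine ⟨-1, Or.inr rfl, ?_, ?_, r1 / 2, by positivity, by linarith, hκ1, ?_⟩
    · have := hlimβ.2; push_cast at this ⊢; linarith
    · have := hlimβ.1; push_cast at this ⊢; linarith
    · intro y hy hyr t ht hty
      have := hfinal y hy hyr t ht hty
      push_cast at this ⊢
      constructor <;> linarith [this.1, this.2]

end IsPlaneCorner

theorem exp_arg_mul_I_eq {z : ℂ} (hz : z ≠ 0) :
    Complex.exp (Complex.arg z * Complex.I) = z / ‖z‖ := by
  have h : (‖z‖ : ℂ) ≠ 0 := by exact_mod_cast norm_ne_zero_iff.mpr hz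
  rw [eq_div_iff h, mul_comm]
  exact Complex.norm_mul_exp_arg_mul_I z

theorem continuous_dslope_exp : Continuous (dslope Complex.exp 0) := by
  rw [continuous_iff_continuousAt]
  intro x
  by_cases hx : x = 0
  · rw [hx, continuousAt_dslope_same]
    exact Complex.differentiable_exp 0
  · rw [continuousAt_dslope_of_ne hx]
    fun_prop

theorem exp_sub_one_eq (z : ℂ) : Complex.exp z - 1 = z * dslope Complex.exp 0 z := by
  have := sub_smul_dslope Complex.exp 0 z
  simpa using this.symm

/-- The slope is (exp z - 1)/z, which tends to 1; it turns secants from a point into logarithmic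
coordinates at the cost of a small argument. -/
theorem eventually_dslope_exp {η : ℝ} (hη : 0 < η) : ∀ᶠ z in 𝓝 (0 : ℂ),
    dslope Complex.exp 0 z ∈ Complex.slitPlane ∧ |Complex.arg (dslope Complex.exp 0 z)| < η := by
  have h1 : dslope Complex.exp 0 0 = 1 := by simp
  have h2 : Filter.Tendsto (dslope Complex.exp 0) (𝓝 0) (𝓝 1) := by
    have := continuous_dslope_exp.tendsto 0
    rwa [h1] at this
  have h3 : ContinuousAt Complex.arg 1 := Complex.continuousAt_arg (by simp)
  have h4 := (h3.tendsto.comp h2).abs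
  rw [Complex.arg_one, abs_zero] at h4
  have h5 : ∀ᶠ z in 𝓝 (0 : ℂ), dslope Complex.exp 0 z ∈ Complex.slitPlane :=
    h2 (Complex.isOpen_slitPlane.mem_nhds (by simp))
  exact h5.and (h4 (Iio_mem_nhds hη))

theorem tendsto_pair_front : Filter.Tendsto (fun t : ℝ => ((0 : ℝ), t)) (𝓝[>] 0)
    (𝓝[{p : ℝ × ℝ | 0 ≤ p.1 ∧ p.1 < p.2}] 0) := by
  refine tendsto_nhdsWithin_iff.mpr ⟨?_, ?_⟩
  · have : ContinuousAt (fun t : ℝ => ((0 : ℝ), t)) 0 := by fun_prop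
    exact this.tendsto.mono_left nhdsWithin_le_nhds
  · filter_upwards [self_mem_nhdsWithin] with t ht
    exact ⟨le_rfl, ht⟩

theorem tendsto_pair_back : Filter.Tendsto (fun t : ℝ => (t, (0 : ℝ))) (𝓝[<] 0)
    (𝓝[{p : ℝ × ℝ | p.1 < p.2 ∧ p.2 ≤ 0}] 0) := by
  refine tendsto_nhdsWithin_iff.mpr ⟨?_, ?_⟩
  · have : ContinuousAt (fun t : ℝ => (t, (0 : ℝ))) 0 := by fun_prop
    exact this.tendsto.mono_left nhdsWithin_le_nhds
  · filter_upwards [self_mem_nhdsWithin] with t ht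
    exact ⟨ht, le_rfl⟩

theorem secantArg_of_lt {d : ℤ} {μ : ℂ × ℂ → ℂ} {x y : ℝ} (h : x < y) :
    secantArg d μ x y = (μ (x, y)).im := by
  rw [secantArg, ← Complex.ofReal_sub, Complex.arg_ofReal_of_nonneg (sub_pos.mpr h).le]
  simp

theorem secantArg_of_gt {d : ℤ} {μ : ℂ × ℂ → ℂ} {x y : ℝ} (h : y < x) :
    secantArg d μ x y = d * Real.pi + (μ (x, y)).im := by
  rw [secantArg, ← Complex.ofReal_sub, Complex.arg_ofReal_of_neg (sub_neg.mpr h)]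

/-- Convexity of these sets of pairs is what lets the argument of the difference quotient converge,
not only its direction. -/
theorem convex_front : Convex ℝ {p : ℝ × ℝ | 0 ≤ p.1 ∧ p.1 < p.2} := by
  rintro ⟨a, b⟩ ⟨h1, h2⟩ ⟨a', b'⟩ ⟨h1', h2'⟩ u v hu hv huv
  simp only [Prod.smul_mk, Prod.mk_add_mk, smul_eq_mul, mem_ofPred_eq] at *
  refine ⟨by positivity, ?_⟩
  rcases hu.eq_or_lt with h | h
  · have : v = 1 := by linarith
    subst this; subst h; simpa using h2'
  · have := mul_lt_mul_of_pos_left h2 h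
    have := mul_le_mul_of_nonneg_left h2'.le hv
    linarith

theorem convex_back : Convex ℝ {p : ℝ × ℝ | p.1 < p.2 ∧ p.2 ≤ 0} := by
  rintro ⟨a, b⟩ ⟨h2, h1⟩ ⟨a', b'⟩ ⟨h2', h1'⟩ u v hu hv huv
  simp only [Prod.smul_mk, Prod.mk_add_mk, smul_eq_mul, mem_ofPred_eq] at *
  refine ⟨?_, by nlinarith⟩
  rcases hu.eq_or_lt with h | h
  · have : v = 1 := by linarith
    subst this; subst h; simpa using h2'
  · have := mul_lt_mul_of_pos_left h2 h
    have := mul_le_mul_of_nonneg_left h2'.le hv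
    linarith

namespace IsPlaneCorner

variable {Z : ℂ → ℂ} {r : ℝ} {e e' : ℂ} {d : ℤ} {μ : ℂ × ℂ → ℂ}

theorem swap_eq (h : IsPlaneCorner Z r e e') (hμ : IsSecantLog (halfDisk r) Z d μ) {x y : ℝ}
    (hx : |x| < r) (hy : |y| < r) (hxy : x ≠ y) : μ (y, x) = μ (x, y) ∧ Odd d := by
  have hr := h.pos
  refine hμ.swap_eq (convex_halfDisk r) (p := (r / 2 : ℝ) * Complex.I) ⟨?_, ?_⟩ ?_
    (ofReal_mem_halfDisk hx) (ofReal_mem_halfDisk hy) hxy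
  · simp; positivity
  · rw [norm_mul, Complex.norm_real, Complex.norm_I, Real.norm_of_nonneg (by positivity)]
    linarith
  · simp [hr]

/-- The degree of a secant logarithm at a corner is determined by the side on which the image of the
half disk lies. -/
theorem degree_eq (h : IsPlaneCorner Z r e e') (hμ : IsSecantLog (halfDisk r) Z d μ) {α : ℝ}
    (hα : Filter.Tendsto (fun p : ℝ × ℝ => (μ (p.1, p.2)).im)
      (𝓝[{p | 0 ≤ p.1 ∧ p.1 < p.2}] 0) (𝓝 α)) {σ : ℤ} (hσ : σ = 1 ∨ σ = -1) {κ : ℝ} (hκ : 0 < κ)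
    (hκr : κ < r) (hmono : StrictMonoOn (fun t : ℝ => ‖Z t‖) (Icc 0 κ))
    (hside : ∀ y : ℂ, 0 < y.im → ‖y‖ < κ → ∀ t ∈ Icc (0 : ℝ) κ, ‖Z t‖ = ‖Z y‖ →
      0 < σ * (secantArg d μ 0 y - secantArg d μ 0 t)) : d = σ := by
  have hpi := Real.pi_pos
  have hr := h.pos
  -- the front triangle on which `Im μ` is close to `α`
  obtain ⟨κ', hκ', hκ'κ, htri⟩ : ∃ κ', 0 < κ' ∧ κ' ≤ κ ∧ ∀ s t : ℝ, 0 ≤ s → s < t → t < κ' →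
      |(μ (s, t)).im - α| < Real.pi / 8 := by
    have h1 : ∀ᶠ p : ℝ × ℝ in 𝓝[{p | 0 ≤ p.1 ∧ p.1 < p.2}] 0,
        |(μ (p.1, p.2)).im - α| < Real.pi / 8 := by
      have := (hα.sub_const α).abs
      rw [sub_self, abs_zero] at this
      exact this (Iio_mem_nhds (by positivity))
    obtain ⟨ρ, hρ, hb⟩ := Metric.mem_nhdsWithin_iff.mp h1
    refine ⟨min ρ κ, lt_min hρ hκ, min_le_right _ _, fun s t hs hst ht => ?_⟩
    have := ht.trans_le (min_le_left _ _)
    refine hb (a := ((s, t) : ℝ × ℝ)) ⟨?_, hs, hst⟩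
    rw [mem_ball_zero_iff, Prod.norm_def, max_lt_iff]
    simp only [Real.norm_eq_abs]
    rw [abs_of_nonneg hs, abs_of_nonneg (hs.trans hst.le)]
    constructor <;> linarith
  set x : ℝ := κ' / 2 with hx
  have hx0 : 0 < x := by positivity
  have hxκ : x ∈ Icc 0 κ := ⟨hx0.le, by linarith⟩
  have hxr : |x| < r := by rw [abs_of_pos hx0]; linarith
  have hxm : (x : ℂ) ∈ halfDisk r := ofReal_mem_halfDisk hxr
  have hx0' : (x : ℂ) ≠ (0 : ℝ) := by exact_mod_cast hx0.ne'
  have h00 : |(0 : ℝ)| < r := by simpa using hr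
  have h0m : (0 : ℂ) ∈ halfDisk r := by simpa using ofReal_mem_halfDisk h00
  have hZne : ∀ y ∈ halfDisk r, y ≠ (0 : ℝ) → Z y ≠ 0 := by
    intro y hy hy0 hZ
    refine hy0 ?_
    rw [Complex.ofReal_zero]
    exact h.injOn hy h0m (by rw [hZ, h.zero])
  set A : ℂ → ℝ := secantArg d μ 0 with hA
  have hAc := hμ.continuousOn_secantArg h00
  have hAe : ∀ y ∈ halfDisk r, y ≠ (0 : ℝ) → Complex.exp (A y * Complex.I) = Z y / ‖Z y‖ := by
    intro y hy hy0
    have := hμ.exp_secantArg h00 hy hy0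
    rwa [Complex.ofReal_zero, h.zero, sub_zero] at this
  -- the logarithmic coordinate
  set Λ : ℂ → ℂ := fun y =>
    (Real.log ‖Z y‖ - Real.log ‖Z x‖ : ℝ) + (A y - A x : ℝ) * Complex.I with hΛ
  have hΛc : ContinuousOn Λ {y | y ∈ halfDisk r ∧ y ≠ (0 : ℝ)} := by
    refine ContinuousOn.add (Complex.continuous_ofReal.comp_continuousOn (ContinuousOn.sub ?_
      continuousOn_const)) ((Complex.continuous_ofReal.comp_continuousOn
      (hAc.sub continuousOn_const)).mul continuousOn_const)
    exact ((h.continuousOn.mono fun y hy => hy.1).norm).log fun y hy =>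
      norm_ne_zero_iff.mpr (hZne y hy.1 hy.2)
  have hΛx : Λ x = 0 := by simp [hΛ]
  have hΛexp : ∀ y ∈ halfDisk r, y ≠ (0 : ℝ) → Z y = Z x * Complex.exp (Λ y) := by
    intro y hy hy0
    have n1 : (‖Z y‖ : ℂ) ≠ 0 := by exact_mod_cast norm_ne_zero_iff.mpr (hZne y hy hy0)
    have n2 : (‖Z x‖ : ℂ) ≠ 0 := by exact_mod_cast norm_ne_zero_iff.mpr (hZne x hxm hx0')
    have n3 := hZne x hxm hx0'
    have e1 : Complex.exp ((Real.log ‖Z y‖ - Real.log ‖Z x‖ : ℝ) : ℂ) = ‖Z y‖ / ‖Z x‖ := by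
      rw [← Complex.ofReal_exp, Real.exp_sub, Real.exp_log (norm_pos_iff.mpr (hZne y hy hy0)),
        Real.exp_log (norm_pos_iff.mpr (hZne x hxm hx0'))]
      push_cast
      rfl
    simp only [hΛ]
    rw [Complex.exp_add, e1, Complex.ofReal_sub, sub_mul, Complex.exp_sub, hAe y hy hy0,
      hAe x hxm hx0']
    field_simp
  have hsmall : ∀ᶠ y in 𝓝[{y | y ∈ halfDisk r ∧ y ≠ (0 : ℝ)}] (x : ℂ),
      dslope Complex.exp 0 (Λ y) ∈ Complex.slitPlane ∧
        |Complex.arg (dslope Complex.exp 0 (Λ y))| < Real.pi / 8 := by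
    have := hΛc x ⟨hxm, hx0'⟩
    rw [ContinuousWithinAt, hΛx] at this
    exact this (eventually_dslope_exp (by positivity))
  obtain ⟨ρ, hρ, hb⟩ := Metric.mem_nhdsWithin_iff.mp hsmall
  set r2 : ℝ := min ρ (x / 2) with hr2
  have hr20 : 0 < r2 := lt_min hρ (by positivity)
  have hr2x : r2 ≤ x / 2 := min_le_right _ _
  set S : Set ℂ := {w | w ∈ Metric.ball (x : ℂ) r2 ∧ 0 ≤ w.im ∧ w ≠ x} with hS
  have hSκ : ∀ w ∈ S, ‖w‖ < κ := by
    rintro w ⟨hw, -, -⟩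
    rw [mem_ball_iff_norm] at hw
    have : ‖w‖ ≤ ‖w - x‖ + ‖(x : ℂ)‖ := by
      calc ‖w‖ = ‖(w - x) + x‖ := by congr 1; ring
        _ ≤ _ := norm_add_le _ _
    rw [Complex.norm_real, Real.norm_of_nonneg hx0.le] at this
    linarith
  have hSN : ∀ w ∈ S, w ∈ halfDisk r ∧ w ≠ (0 : ℝ) := by
    intro w hw
    refine ⟨⟨hw.2.1, (hSκ w hw).trans hκr⟩, ?_⟩
    rintro rfl
    have := hw.1
    rw [mem_ball_iff_norm, Complex.ofReal_zero, zero_sub, norm_neg, Complex.norm_real,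
      Real.norm_of_nonneg hx0.le] at this
    linarith
  have hSb : ∀ w ∈ S, dslope Complex.exp 0 (Λ w) ∈ Complex.slitPlane ∧
        |Complex.arg (dslope Complex.exp 0 (Λ w))| < Real.pi / 8 := fun w hw =>
    hb ⟨Metric.ball_subset_ball (min_le_left _ _) hw.1, hSN w hw⟩
  have hSconn : IsPreconnected S := by
    refine isPreconnected_inter_im_nonneg (convex_ball _ _)
      (c := x + (r2 / 2 : ℝ) * Complex.I) ?_ ?_
    · rw [mem_ball_iff_norm, add_sub_cancel_left, norm_mul, Complex.norm_I, Complex.norm_real,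
        Real.norm_of_nonneg (by positivity)]
      linarith
    · simp [hr20]
  have hσ2 : (σ : ℝ) * σ = 1 := by rcases hσ with rfl | rfl <;> norm_num
  have hσ0 : (σ : ℝ) ≠ 0 := fun h0 => by rw [h0] at hσ2; norm_num at hσ2
  -- In the coordinate Λ, the circle about 0 through Z x is the imaginary axis. Rotation by -σi
  -- makes D positive on the points of this circle in the disk, so D avoids the negative real axis
  -- and has a continuous principal argument.
  set D : ℂ → ℂ := fun y => -(σ : ℂ) * Complex.I * Λ y with hD
  have hDre : ∀ y, (D y).re = σ * (A y - A x) := by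
    intro y
    simp [hD, hΛ]
  have hDim : ∀ y, (D y).im = -(σ * (Real.log ‖Z y‖ - Real.log ‖Z x‖)) := by
    intro y
    simp [hD, hΛ]
  have hDslit : ∀ y ∈ S, D y ∈ Complex.slitPlane := by
    intro y hy
    rw [Complex.mem_slitPlane_iff, hDre, hDim]
    by_cases h0 : Real.log ‖Z y‖ - Real.log ‖Z x‖ = 0
    · left
      have h1 : ‖Z y‖ = ‖Z x‖ :=
        Real.log_injOn_pos (norm_pos_iff.mpr (hZne y (hSN y hy).1 (hSN y hy).2))
          (norm_pos_iff.mpr (hZne x hxm hx0')) (sub_eq_zero.mp h0)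
      rcases hy.2.1.eq_or_lt with h2 | h2
      · exfalso
        have hyre : y = (y.re : ℂ) := Complex.ext (by simp) (by simp [h2])
        have hyb := hy.1
        rw [hyre, mem_ball_iff_norm, ← Complex.ofReal_sub, Complex.norm_real,
          Real.norm_eq_abs, abs_lt] at hyb
        rw [hyre] at h1
        have := hmono.injOn (x₁ := y.re) (x₂ := x) ⟨by linarith, by linarith⟩ hxκ h1
        exact hy.2.2 (by rw [hyre, this])
      · exact hside y h2 (hSκ y hy) x hxκ h1.symm
    · right
      exact neg_ne_zero.mpr (mul_ne_zero hσ0 h0)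
  have hI : Complex.exp ((σ * (Real.pi / 2) : ℝ) * Complex.I) = σ * Complex.I := by
    rcases hσ with rfl | rfl
    · push_cast; rw [one_mul, Complex.exp_pi_div_two_mul_I, one_mul]
    · push_cast; rw [neg_one_mul, neg_mul, Complex.exp_neg, Complex.exp_pi_div_two_mul_I]
      simp
  -- Z y - Z x = Z x (exp Λ - 1) = Z x · σi · D · (exp Λ - 1)/Λ gives an explicit argument of the
  -- secant from x, up to one multiple of 2π on the connected set `S`.
  obtain ⟨n, hn⟩ := hSconn.arg_unique (L := secantArg d μ x)
    (K := fun y => A x + σ * (Real.pi / 2) + Complex.arg (D y) +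
      Complex.arg (dslope Complex.exp 0 (Λ y)))
    ((hμ.continuousOn_secantArg hxr).mono fun y hy => ⟨(hSN y hy).1, hy.2.2⟩) (by
      have hΛS : ContinuousOn Λ S := hΛc.mono hSN
      have hDS : ContinuousOn D S := by fun_prop
      refine (continuousOn_const.add ?_).add ?_
      · intro y hy
        exact ContinuousAt.comp_continuousWithinAt (g := Complex.arg)
          (Complex.continuousAt_arg (hDslit y hy)) (hDS y hy)
      · intro y hy
        exact ContinuousAt.comp_continuousWithinAt (g := Complex.arg)
          (Complex.continuousAt_arg (hSb y hy).1)
          (continuous_dslope_exp.comp_continuousOn hΛS y hy)) (by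
      intro y hy
      obtain ⟨hyN, hy0⟩ := hSN y hy
      have hE := Complex.slitPlane_ne_zero (hSb y hy).1
      have hDy := Complex.slitPlane_ne_zero (hDslit y hy)
      have e0 : Z y - Z x = Z x * (σ * Complex.I) * D y * dslope Complex.exp 0 (Λ y) := by
        have e1 : Z y - Z x = Z x * (Λ y * dslope Complex.exp 0 (Λ y)) := by
          rw [← exp_sub_one_eq, hΛexp y hyN hy0]
          ring
        rw [e1]
        simp only [hD]
        have e2 : (σ : ℂ) * σ = 1 := by exact_mod_cast hσ2
        linear_combination (-(Z x * Λ y * dslope Complex.exp 0 (Λ y))) * e2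
          + (Z x * Λ y * dslope Complex.exp 0 (Λ y) * σ * σ) * Complex.I_mul_I
      have e3 : ‖(σ : ℂ) * Complex.I‖ = 1 := by
        rw [← hI]
        exact Complex.norm_exp_ofReal_mul_I _
      rw [hμ.exp_secantArg hxr hyN hy.2.2, e0, norm_mul, norm_mul, norm_mul, e3]
      push_cast at hI ⊢
      rw [add_mul, add_mul, add_mul, Complex.exp_add, Complex.exp_add, Complex.exp_add, hI,
        exp_arg_mul_I_eq hE, exp_arg_mul_I_eq hDy, hAe x hxm hx0']
      field_simp)
  -- evaluation at two points on the real axis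
  have hyS : ∀ t : ℝ, t = r2 / 2 ∨ t = -(r2 / 2) → ((x + t : ℝ) : ℂ) ∈ S := by
    intro t ht
    refine ⟨?_, by simp, ?_⟩
    · rw [mem_ball_iff_norm, ← Complex.ofReal_sub, add_sub_cancel_left, Complex.norm_real,
        Real.norm_eq_abs]
      rcases ht with rfl | rfl
      · rw [abs_of_pos (by positivity)]; linarith
      · rw [abs_neg, abs_of_pos (by positivity)]; linarith
    · intro hcon
      have : x + t = x := by exact_mod_cast hcon
      rcases ht with rfl | rfl <;> linarith
  have hp := hyS (r2 / 2) (Or.inl rfl)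
  have hm := hyS (-(r2 / 2)) (Or.inr rfl)
  have hnp := hn _ hp
  have hnm := hn _ hm
  rw [secantArg_of_lt (by linarith)] at hnp
  rw [secantArg_of_gt (by linarith),
    ← (h.swap_eq hμ hxr (y := x + -(r2 / 2)) (by rw [abs_lt]; constructor <;> linarith)
      (by intro hcon; linarith)).1] at hnm
  have hodd := (h.swap_eq hμ hxr h00 hx0.ne').2
  -- Passing from the right to the left of x changes the argument by dπ through μ and by the change
  -- of arg D through the formula. The four remaining terms are off by less than π/8 each, and the
  -- signs of arg D confine d to -1 < d < 3 or to -3 < d < 1, where only one odd number is left.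
  have t1 := abs_lt.mp (htri x (x + r2 / 2) hx0.le (by linarith) (by linarith))
  have t2 := abs_lt.mp (htri (x + -(r2 / 2)) x (by linarith) (by linarith) (by linarith))
  have t3 := abs_lt.mp (hSb _ hp).2
  have t4 := abs_lt.mp (hSb _ hm).2
  have l1 : Real.log ‖Z x‖ < Real.log ‖Z ((x + r2 / 2 : ℝ) : ℂ)‖ :=
    Real.log_lt_log (norm_pos_iff.mpr (hZne x hxm hx0'))
      (hmono hxκ (a := x) (b := x + r2 / 2) ⟨by linarith, by linarith⟩ (by linarith))
  have l2 : Real.log ‖Z ((x + -(r2 / 2) : ℝ) : ℂ)‖ < Real.log ‖Z x‖ :=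
    Real.log_lt_log (norm_pos_iff.mpr (hZne _ (hSN _ hm).1 (hSN _ hm).2))
      (hmono (a := x + -(r2 / 2)) (b := x) ⟨by linarith, by linarith⟩ hxκ (by linarith))
  have i1 := hDim ((x + r2 / 2 : ℝ) : ℂ)
  have i2 := hDim ((x + -(r2 / 2) : ℝ) : ℂ)
  have b1 := Complex.arg_le_pi (D ((x + r2 / 2 : ℝ) : ℂ))
  have b2 := Complex.neg_pi_lt_arg (D ((x + r2 / 2 : ℝ) : ℂ))
  have b3 := Complex.arg_le_pi (D ((x + -(r2 / 2) : ℝ) : ℂ))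
  have b4 := Complex.neg_pi_lt_arg (D ((x + -(r2 / 2) : ℝ) : ℂ))
  obtain ⟨k, hk⟩ := hodd
  rcases hσ with hσ1 | hσ1
  · rw [hσ1] at i1 i2
    simp only [Int.cast_one] at i1 i2
    have s1 : Complex.arg (D ((x + r2 / 2 : ℝ) : ℂ)) < 0 := Complex.arg_neg_iff.mpr (by linarith)
    have s2 : 0 ≤ Complex.arg (D ((x + -(r2 / 2) : ℝ) : ℂ)) :=
      Complex.arg_nonneg_iff.mpr (by linarith)
    have u1 : -1 < (d : ℝ) := by
      by_contra hcon
      have := mul_le_mul_of_nonneg_right (not_lt.mp hcon) hpi.le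
      linarith
    have u2 : (d : ℝ) < 3 := by
      by_contra hcon
      have := mul_le_mul_of_nonneg_right (not_lt.mp hcon) hpi.le
      linarith
    have u1' : -1 < d := by exact_mod_cast u1
    have u2' : d < 3 := by exact_mod_cast u2
    omega
  · rw [hσ1] at i1 i2
    simp only [Int.cast_one, Int.cast_neg] at i1 i2
    have s1 : 0 ≤ Complex.arg (D ((x + r2 / 2 : ℝ) : ℂ)) :=
      Complex.arg_nonneg_iff.mpr (by linarith)
    have s2 : Complex.arg (D ((x + -(r2 / 2) : ℝ) : ℂ)) < 0 :=
      Complex.arg_neg_iff.mpr (by linarith)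
    have u1 : (d : ℝ) < 1 := by
      by_contra hcon
      have := mul_le_mul_of_nonneg_right (not_lt.mp hcon) hpi.le
      linarith
    have u2 : -3 < (d : ℝ) := by
      by_contra hcon
      have := mul_le_mul_of_nonneg_right (not_lt.mp hcon) hpi.le
      linarith
    have u1' : d < 1 := by exact_mod_cast u1
    have u2' : -3 < d := by exact_mod_cast u2
    omega

/-- Local analysis of a corner: the directions of the edges, the interior angle and the turning of
the tangent. -/
theorem exists_angles (h : IsPlaneCorner Z r e e') (hμ : IsSecantLog (halfDisk r) Z d μ) :
    ∃ α β : ℝ, Complex.exp (α * Complex.I) = e / ‖e‖ ∧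
      Complex.exp ((β - d * Real.pi : ℝ) * Complex.I) = e' / ‖e'‖ ∧
      Filter.Tendsto (fun p : ℝ × ℝ => (μ (p.1, p.2)).im)
        (𝓝[{p | 0 ≤ p.1 ∧ p.1 < p.2}] 0) (𝓝 α) ∧
      Filter.Tendsto (fun p : ℝ × ℝ => (μ (p.1, p.2)).im)
        (𝓝[{p | p.1 < p.2 ∧ p.2 ≤ 0}] 0) (𝓝 (β - d * Real.pi)) ∧
      Filter.Tendsto (fun t : ℝ => secantArg d μ 0 t) (𝓝[>] 0) (𝓝 α) ∧
      Filter.Tendsto (fun t : ℝ => secantArg d μ 0 t) (𝓝[<] 0) (𝓝 β) ∧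
      (d = 1 ∨ d = -1) ∧ 0 ≤ d * (β - α) ∧ d * (β - α) ≤ 2 * Real.pi := by
  have hr := h.pos
  have h00 : |(0 : ℝ)| < r := by simpa using hr
  obtain ⟨α, hα1, hα⟩ := hμ.exists_tendsto_im h.pos convex_front (fun p hp => hp.2) h.ne h.front
  obtain ⟨β', hβ1, hβ⟩ := hμ.exists_tendsto_im h.pos convex_back (fun p hp => hp.1) h.ne' h.back
  have ha : Filter.Tendsto (fun t : ℝ => secantArg d μ 0 t) (𝓝[>] 0) (𝓝 α) := by
    refine (hα.comp tendsto_pair_front).congr' ?_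
    filter_upwards [self_mem_nhdsWithin] with t ht
    rw [secantArg_of_lt ht]
    rfl
  have hb : Filter.Tendsto (fun t : ℝ => secantArg d μ 0 t) (𝓝[<] 0)
      (𝓝 (β' + d * Real.pi)) := by
    refine ((hβ.comp tendsto_pair_back).add_const (d * Real.pi)).congr' ?_
    filter_upwards [self_mem_nhdsWithin,
      nhdsWithin_le_nhds (Ioo_mem_nhds (neg_lt_zero.mpr hr) hr)] with t ht ht2
    have ht : t < 0 := ht
    rw [secantArg_of_gt ht, ← (h.swap_eq hμ h00 (abs_lt.mpr ht2) ht.ne').1, add_comm]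
    rfl
  obtain ⟨σ, hσ, hσ1, hσ2, κ, hκ, hκr, hmono, hside⟩ := h.exists_side
    (hμ.continuousOn_secantArg h00) (fun y hy hy0 => by
      have := hμ.exp_secantArg h00 hy hy0
      rwa [Complex.ofReal_zero, h.zero, sub_zero] at this) ha hb
  have hd : d = σ := h.degree_eq hμ hα hσ hκ hκr hmono
    (fun y hy hyκ t ht hty => (hside y hy hyκ t ht hty).1)
  refine ⟨α, β' + d * Real.pi, hα1, by rwa [add_sub_cancel_right], hα,
    by rwa [add_sub_cancel_right], ha, hb, ?_, ?_, ?_⟩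
  · rw [hd]; exact hσ
  · nth_rw 1 [hd]; exact hσ1
  · nth_rw 1 [hd]; exact hσ2

end IsPlaneCorner

/-! ### Step functions. -/

/-- The total variation of a step function is the sum of its jumps. -/
theorem sub_eq_sum_jumps {a b : ℝ} (hab : a ≤ b) {S : Finset ℝ} (hS : ∀ θ ∈ S, a < θ ∧ θ < b)
    {M c : ℝ → ℝ} (hM : ∀ t ∈ Icc a b, t ∉ S → ∀ᶠ t' in 𝓝 t, M t' = M t)
    (hl : ∀ θ ∈ S, Filter.Tendsto M (𝓝[<] θ) (𝓝 (M θ)))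
    (hr : ∀ θ ∈ S, Filter.Tendsto M (𝓝[>] θ) (𝓝 (M θ + c θ))) :
    M b - M a = ∑ θ ∈ S, c θ := by
  -- The model step function; the strict inequality makes it left continuous at the jumps, as `M`
  -- is.
  set J : ℝ → ℝ := fun t => ∑ θ ∈ S, if θ < t then c θ else 0 with hJ
  have hstep : ∀ θ t : ℝ, θ ≠ t →
      ∀ᶠ t' in 𝓝 t, (if θ < t' then c θ else 0) = if θ < t then c θ else 0 := by
    intro θ t h
    rcases lt_or_gt_of_ne h with h | h
    · filter_upwards [Ioi_mem_nhds h] with t' ht'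
      rw [if_pos h, if_pos (show θ < t' from ht')]
    · filter_upwards [Iio_mem_nhds h] with t' ht'
      rw [if_neg (not_lt.mpr h.le), if_neg (not_lt.mpr (le_of_lt (show t' < θ from ht')))]
  have hloc : ∀ t ∈ Icc a b, t ∉ S → ∀ᶠ t' in 𝓝 t, M t' - J t' = M t - J t := by
    intro t ht htS
    have h1 : ∀ᶠ t' in 𝓝 t, ∀ θ ∈ S,
        (if θ < t' then c θ else 0) = if θ < t then c θ else 0 := by
      rw [Filter.eventually_all_finset]
      intro θ hθ
      exact hstep θ t (fun h => htS (h ▸ hθ))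
    filter_upwards [hM t ht htS, h1] with t' h2 h3
    rw [h2, hJ]
    simp only
    rw [Finset.sum_congr rfl h3]
  have hc : ContinuousOn (fun t => M t - J t) (Icc a b) := by
    intro t ht
    refine ContinuousAt.continuousWithinAt ?_
    by_cases htS : t ∈ S
    · rw [continuousAt_iff_continuous_left'_right']
      constructor
      · refine (hl t htS).sub (tendsto_finsetSum _ fun θ hθ => ?_)
        by_cases h : θ = t
        · subst h
          refine tendsto_const_nhds.congr' ?_
          filter_upwards [self_mem_nhdsWithin] with t' ht'
          rw [if_neg (lt_irrefl _), if_neg (not_lt.mpr (le_of_lt (show t' < θ from ht')))]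
        · exact tendsto_const_nhds.congr'
            (nhdsWithin_le_nhds ((hstep θ t h).mono fun t' h' => h'.symm))
      · have h1 : M t - J t = (M t + c t) -
            ∑ θ ∈ S, ((if θ < t then c θ else 0) + if θ = t then c θ else 0) := by
          rw [Finset.sum_add_distrib, Finset.sum_ite_eq' S t c, if_pos htS]
          simp only [hJ]
          ring
        change Filter.Tendsto (fun t => M t - J t) (𝓝[>] t) (𝓝 (M t - J t))
        rw [h1]
        refine (hr t htS).sub (tendsto_finsetSum _ fun θ hθ => ?_)
        by_cases h : θ = t
        · subst h
          refine tendsto_const_nhds.congr' ?_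
          filter_upwards [self_mem_nhdsWithin] with t' ht'
          rw [if_neg (lt_irrefl _), if_pos rfl, if_pos (show θ < t' from ht'), zero_add]
        · rw [if_neg h, add_zero]
          exact tendsto_const_nhds.congr'
            (nhdsWithin_le_nhds ((hstep θ t h).mono fun t' h' => h'.symm))
    · exact continuousAt_const.congr ((hloc t ht htS).mono fun t' h' => h'.symm)
  -- `M - J` is continuous with zero derivative off a finite set, hence has equal values at both
  -- ends.
  have hint := MeasureTheory.integral_eq_of_hasDerivAt_off_countable (a := a) (b := b)
    (fun t => M t - J t) (fun _ => 0) S.countable_toSet (by rwa [uIcc_of_le hab]) (by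
      intro t ht
      rw [min_eq_left hab, max_eq_right hab] at ht
      have h1 := hloc t (Ioo_subset_Icc_self ht.1) ht.2
      exact (hasDerivAt_const t (M t - J t)).congr_of_eventuallyEq h1) (by simp)
  rw [intervalIntegral.integral_zero] at hint
  have hJa : J a = 0 := Finset.sum_eq_zero fun θ hθ => if_neg (not_lt.mpr (hS θ hθ).1.le)
  have hJb : J b = ∑ θ ∈ S, c θ := Finset.sum_congr rfl fun θ hθ => if_pos (hS θ hθ).2
  simp only [hJa, hJb] at hint
  linarith

/-! ### The surface in charts: second fundamental form and Hopf differential. -/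

theorem isManifold_real_of_complex (M : Type*) [TopologicalSpace M] [ChartedSpace ℂ M]
    [IsManifold 𝓘(ℂ) ω M] : IsManifold 𝓘(ℝ, ℂ) ∞ M := by
  refine isManifold_of_contDiffOn _ _ _ fun e e' he he' => ?_
  have h := (HasGroupoid.compatible (G := contDiffGroupoid ω 𝓘(ℂ)) he he')
  rw [contDiffGroupoid, mem_groupoid_of_pregroupoid] at h
  have h1 : ContDiffOn ℂ ω (e.symm ≫ₕ e') (e.symm ≫ₕ e').source := by
    have := h.1
    simpa [contDiffPregroupoid] using this
  have h2 : ContDiffOn ℝ ∞ (e.symm ≫ₕ e') (e.symm ≫ₕ e').source :=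
    (h1.restrict_scalars ℝ).of_le le_top
  simpa using h2

section Charts

variable {M : Type*} [TopologicalSpace M] [ChartedSpace ℂ M]

theorem ContMDiff.contDiffOn_comp_chart_symm [IsManifold 𝓘(ℂ) ω M] {g : M → E4}
    (hg : ContMDiff 𝓘(ℝ, ℂ) 𝓘(ℝ, E4) ∞ g) (u : M) :
    ContDiffOn ℝ ∞ (g ∘ (chartAt ℂ u).symm) (chartAt ℂ u).target := by
  have := isManifold_real_of_complex M
  rw [← contMDiffOn_iff_contDiffOn]
  exact hg.comp_contMDiffOn (contMDiffOn_chart_symm (I := 𝓘(ℝ, ℂ)) (x := u))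

theorem ambientDeriv_eq [IsManifold 𝓘(ℂ) ω M] {g : M → E4}
    (hg : ContMDiff 𝓘(ℝ, ℂ) 𝓘(ℝ, E4) ∞ g) (x : M) :
    ambientDeriv g x = fderiv ℝ (g ∘ (chartAt ℂ x).symm) (chartAt ℂ x x) := by
  have h : MDifferentiableAt 𝓘(ℝ, ℂ) 𝓘(ℝ, E4) g x :=
    (hg x).mdifferentiableAt (by simp)
  have key : fderivWithin ℝ (g ∘ (chartAt ℂ x).symm) (range id) (chartAt ℂ x x) =
      fderiv ℝ (g ∘ (chartAt ℂ x).symm) (chartAt ℂ x x) := by rw [range_id, fderivWithin_univ]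
  exact h.mfderiv.trans key

/-- Change of coordinates between two charts. -/
theorem exists_transition [IsManifold 𝓘(ℂ) ω M] (u v x : M) (hu : x ∈ (chartAt ℂ u).source)
    (hv : x ∈ (chartAt ℂ v).source) :
    ∃ τ : ℂ, τ ≠ 0 ∧ ∀ g : M → E4, ContMDiff 𝓘(ℝ, ℂ) 𝓘(ℝ, E4) ∞ g → ∀ h : ℂ,
      fderiv ℝ (g ∘ (chartAt ℂ u).symm) (chartAt ℂ u x) h =
        fderiv ℝ (g ∘ (chartAt ℂ v).symm) (chartAt ℂ v x) (τ * h) := by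
  have key : ∀ u v : M, x ∈ (chartAt ℂ u).source → x ∈ (chartAt ℂ v).source →
      DifferentiableAt ℂ (chartAt ℂ v ∘ (chartAt ℂ u).symm) (chartAt ℂ u x) := by
    intro u v hu hv
    have h1 : ContMDiffOn 𝓘(ℂ) 𝓘(ℂ) ω (chartAt ℂ v ∘ (chartAt ℂ u).symm)
        ((chartAt ℂ u).target ∩ (chartAt ℂ u).symm ⁻¹' (chartAt ℂ v).source) :=
      (contMDiffOn_chart (I := 𝓘(ℂ)) (x := v)).comp'
        (contMDiffOn_chart_symm (I := 𝓘(ℂ)) (x := u))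
    have h2 := h1.contDiffOn
    have hopen : IsOpen ((chartAt ℂ u).target ∩ (chartAt ℂ u).symm ⁻¹' (chartAt ℂ v).source) :=
      (chartAt ℂ u).isOpen_inter_preimage_symm (chartAt ℂ v).open_source
    refine ((h2.differentiableOn (by simp)) _ ?_).differentiableAt (hopen.mem_nhds ?_)
    all_goals
      refine ⟨(chartAt ℂ u).map_source hu, ?_⟩
      simpa [(chartAt ℂ u).left_inv hu] using hv
  have h1 := (key u v hu hv).hasDerivAt
  have h2 := (key v u hv hu).hasDerivAt
  -- τ is the complex derivative of the transition map; it is nonzero because the inverse transition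
  -- is differentiable too.
  set a := deriv (chartAt ℂ v ∘ (chartAt ℂ u).symm) (chartAt ℂ u x) with ha
  have hval : (chartAt ℂ v ∘ (chartAt ℂ u).symm) (chartAt ℂ u x) = chartAt ℂ v x := by
    simp [(chartAt ℂ u).left_inv hu]
  have hnear : ∀ᶠ z in 𝓝 (chartAt ℂ u x), z ∈ (chartAt ℂ u).target ∧
      (chartAt ℂ u).symm z ∈ (chartAt ℂ v).source := by
    have hopen : IsOpen ((chartAt ℂ u).target ∩ (chartAt ℂ u).symm ⁻¹' (chartAt ℂ v).source) :=
      (chartAt ℂ u).isOpen_inter_preimage_symm (chartAt ℂ v).open_source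
    refine hopen.mem_nhds ⟨(chartAt ℂ u).map_source hu, ?_⟩
    simpa [(chartAt ℂ u).left_inv hu] using hv
  refine ⟨a, ?_, ?_⟩
  · intro h0
    rw [← hval] at h2
    have h3 := h2.comp _ h1
    rw [h0, mul_zero] at h3
    have h4 : HasDerivAt (fun z : ℂ => z) 0 (chartAt ℂ u x) := by
      refine h3.congr_of_eventuallyEq ?_
      filter_upwards [hnear] with z hz
      simp [(chartAt ℂ v).left_inv hz.2, (chartAt ℂ u).right_inv hz.1]
    exact one_ne_zero ((hasDerivAt_id _).unique h4)
  · intro g hg h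
    have h5 : DifferentiableAt ℝ (g ∘ (chartAt ℂ v).symm) (chartAt ℂ v x) :=
      ((hg.contDiffOn_comp_chart_symm v).differentiableOn (by simp) _
        ((chartAt ℂ v).map_source hv)).differentiableAt
        ((chartAt ℂ v).open_target.mem_nhds ((chartAt ℂ v).map_source hv))
    have h6 := h1.hasFDerivAt.restrictScalars ℝ
    have h7 := h5.hasFDerivAt
    rw [← hval] at h7
    have h8 := h7.comp _ h6
    have h9 : (g ∘ (chartAt ℂ v).symm) ∘ (chartAt ℂ v ∘ (chartAt ℂ u).symm)
        =ᶠ[𝓝 (chartAt ℂ u x)] g ∘ (chartAt ℂ u).symm := by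
      filter_upwards [hnear] with z hz
      simp [(chartAt ℂ v).left_inv hz.2]
    rw [← h9.fderiv_eq, h8.fderiv, hval]
    simp [mul_comm]

end Charts

namespace SphereSurface

variable {M : Type*} [TopologicalSpace M] [ChartedSpace ℂ M] (S : SphereSurface M)

/-- The immersion in the chart at `u`. -/
noncomputable abbrev fc (u : M) : ℂ → E4 := S.f ∘ (chartAt ℂ u).symm

/-- The unit normal in the chart at `u`. -/
noncomputable abbrev Nc (u : M) : ℂ → E4 := S.N ∘ (chartAt ℂ u).symm

theorem secondFF_add_left (u : M) (z v v' w : ℂ) :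
    S.secondFF u z (v + v') w = S.secondFF u z v w + S.secondFF u z v' w := by
  simp [secondFF, inner_add_left]; ring

theorem secondFF_add_right (u : M) (z v w w' : ℂ) :
    S.secondFF u z v (w + w') = S.secondFF u z v w + S.secondFF u z v w' := by
  simp [secondFF, inner_add_right]; ring

theorem secondFF_smul_left (u : M) (z v w : ℂ) (a : ℝ) :
    S.secondFF u z (a • v) w = a * S.secondFF u z v w := by
  rw [secondFF, map_smul, real_inner_smul_left, secondFF, mul_neg]

theorem secondFF_smul_right (u : M) (z v w : ℂ) (a : ℝ) :
    S.secondFF u z v (a • w) = a * S.secondFF u z v w := by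
  rw [secondFF, map_smul, real_inner_smul_right, secondFF, mul_neg]

variable [IsManifold 𝓘(ℂ) ω M]

theorem contDiffAt_fc (u : M) {z : ℂ} (hz : z ∈ (chartAt ℂ u).target) :
    ContDiffAt ℝ ∞ (S.fc u) z :=
  (S.smooth_f.contDiffOn_comp_chart_symm u).contDiffAt ((chartAt ℂ u).open_target.mem_nhds hz)

theorem contDiffAt_Nc (u : M) {z : ℂ} (hz : z ∈ (chartAt ℂ u).target) :
    ContDiffAt ℝ ∞ (S.Nc u) z :=
  (S.smooth_N.contDiffOn_comp_chart_symm u).contDiffAt ((chartAt ℂ u).open_target.mem_nhds hz)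

theorem df_eq (x : M) : S.df x = fderiv ℝ (S.fc x) (chartAt ℂ x x) := ambientDeriv_eq S.smooth_f x

theorem dN_eq (x : M) : S.dN x = fderiv ℝ (S.Nc x) (chartAt ℂ x x) := ambientDeriv_eq S.smooth_N x

/-- The hypothesis concerns the chart centred at each point; the holomorphic transition to the chart
at `u` scales all lengths by |τ|. -/
theorem conformal_chart (u : M) {z : ℂ} (hz : z ∈ (chartAt ℂ u).target) :
    ∃ c : ℝ, 0 < c ∧ ∀ v : ℂ, ‖fderiv ℝ (S.fc u) z v‖ = c * ‖v‖ := by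
  set x := (chartAt ℂ u).symm z with hx
  have hxz : chartAt ℂ u x = z := (chartAt ℂ u).right_inv hz
  obtain ⟨c, hc, hcv⟩ := S.conformal x
  obtain ⟨τ, hτ, hg⟩ := exists_transition u x x ((chartAt ℂ u).map_target hz) (mem_chart_source ℂ x)
  refine ⟨c * ‖τ‖, mul_pos hc (norm_pos_iff.mpr hτ), fun v => ?_⟩
  have := hg S.f S.smooth_f v
  rw [hxz] at this
  rw [this, mul_assoc, ← norm_mul, ← hcv (τ * v), ambientDeriv_eq S.smooth_f x]
  rfl

theorem inner_N_df_chart (u : M) {z : ℂ} (hz : z ∈ (chartAt ℂ u).target) (v : ℂ) :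
    inner ℝ (S.Nc u z) (fderiv ℝ (S.fc u) z v) = 0 := by
  set x := (chartAt ℂ u).symm z with hx
  have hxz : chartAt ℂ u x = z := (chartAt ℂ u).right_inv hz
  obtain ⟨τ, hτ, hg⟩ := exists_transition u x x ((chartAt ℂ u).map_target hz) (mem_chart_source ℂ x)
  have h1 := S.inner_N_df x (τ * v)
  rw [ambientDeriv_eq S.smooth_f x] at h1
  have h2 := hg S.f S.smooth_f v
  rw [hxz] at h2
  rw [h2]
  exact h1

theorem inner_fderiv_fc (u : M) {z : ℂ} (hz : z ∈ (chartAt ℂ u).target) :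
    inner ℝ (fderiv ℝ (S.fc u) z 1) (fderiv ℝ (S.fc u) z Complex.I) = (0 : ℝ) ∧
      ‖fderiv ℝ (S.fc u) z 1‖ = ‖fderiv ℝ (S.fc u) z Complex.I‖ ∧
      0 < ‖fderiv ℝ (S.fc u) z 1‖ := by
  obtain ⟨c, hc, hcv⟩ := S.conformal_chart u hz
  refine ⟨?_, by simp [hcv], by simp [hcv, hc]⟩
  rw [real_inner_eq_norm_add_mul_self_sub_norm_mul_self_sub_norm_mul_self_div_two, ← map_add,
    hcv, hcv, hcv]
  have h1 : ‖(1 + Complex.I : ℂ)‖ * ‖(1 + Complex.I : ℂ)‖ = 2 := by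
    rw [← sq, ← Complex.normSq_eq_norm_sq, Complex.normSq_apply]
    norm_num
  simp only [norm_one, Complex.norm_I]
  linear_combination c ^ 2 * h1 / 2

theorem inner_f_df_chart (u : M) {z : ℂ} (hz : z ∈ (chartAt ℂ u).target) (v : ℂ) :
    inner ℝ (S.fc u z) (fderiv ℝ (S.fc u) z v) = 0 := by
  have h1 := ((S.contDiffAt_fc u hz).differentiableAt (by simp)).hasFDerivAt
  have h2 := h1.inner ℝ h1
  have h3 : (fun y => inner ℝ (S.fc u y) (S.fc u y)) = fun _ => (1 : ℝ) := by
    funext y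
    have : ‖S.fc u y‖ = 1 := S.norm_f _
    rw [real_inner_self_eq_norm_sq, this, one_pow]
  rw [h3] at h2
  have h4 := congrArg (fun L => L v) (h2.unique (hasFDerivAt_const (1 : ℝ) z))
  simp [fderivInnerCLM_apply] at h4
  rw [real_inner_comm] at h4 ⊢
  simp only [Function.comp_apply]
  linarith

theorem inner_N_dN_chart (u : M) {z : ℂ} (hz : z ∈ (chartAt ℂ u).target) (v : ℂ) :
    inner ℝ (S.Nc u z) (fderiv ℝ (S.Nc u) z v) = 0 := by
  have h1 := ((S.contDiffAt_Nc u hz).differentiableAt (by simp)).hasFDerivAt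
  have h2 := h1.inner ℝ h1
  have h3 : (fun y => inner ℝ (S.Nc u y) (S.Nc u y)) = fun _ => (1 : ℝ) := by
    funext y
    have : ‖S.Nc u y‖ = 1 := S.norm_N _
    rw [real_inner_self_eq_norm_sq, this, one_pow]
  rw [h3] at h2
  have h4 := congrArg (fun L => L v) (h2.unique (hasFDerivAt_const (1 : ℝ) z))
  simp [fderivInnerCLM_apply] at h4
  rw [real_inner_comm] at h4 ⊢
  simp only [Function.comp_apply]
  linarith

theorem inner_f_dN_chart (u : M) {z : ℂ} (hz : z ∈ (chartAt ℂ u).target) (v : ℂ) :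
    inner ℝ (S.fc u z) (fderiv ℝ (S.Nc u) z v) = 0 := by
  have h1 := ((S.contDiffAt_Nc u hz).differentiableAt (by simp)).hasFDerivAt
  have h1' := ((S.contDiffAt_fc u hz).differentiableAt (by simp)).hasFDerivAt
  have h2 := h1.inner ℝ h1'
  have h3 : (fun y => inner ℝ (S.Nc u y) (S.fc u y)) = fun _ => (0 : ℝ) := by
    funext y
    exact S.inner_N_f _
  rw [h3] at h2
  have h4 := congrArg (fun L => L v) (h2.unique (hasFDerivAt_const (0 : ℝ) z))
  have h5 := S.inner_N_df_chart u hz v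
  simp [fderivInnerCLM_apply] at h4
  simp only [Function.comp_apply] at h5 ⊢
  rw [real_inner_comm]
  linarith

/-- The second fundamental form is symmetric. -/
theorem secondFF_symm (u : M) {z : ℂ} (hz : z ∈ (chartAt ℂ u).target) (v w : ℂ) :
    S.secondFF u z v w = S.secondFF u z w v := by
  have hf := S.contDiffAt_fc u hz
  have hsymm : IsSymmSndFDerivAt ℝ (S.fc u) z := hf.isSymmSndFDerivAt (by
    rw [minSmoothness_of_isRCLikeNormedField]
    exact WithTop.coe_le_coe.mpr (le_top : (2 : ℕ∞) ≤ ⊤))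
  have hd : DifferentiableAt ℝ (fderiv ℝ (S.fc u)) z :=
    (hf.fderiv_right (m := 1) (by norm_cast)).differentiableAt (by simp)
  -- Differentiate ⟨N, df v⟩ = 0 in the direction w; the second derivative of f is symmetric.
  have key : ∀ v w : ℂ, S.secondFF u z v w =
      inner ℝ (S.Nc u z) (fderiv ℝ (fderiv ℝ (S.fc u)) z w v) := by
    intro v w
    have h1 := ((S.contDiffAt_Nc u hz).differentiableAt (by simp)).hasFDerivAt
    have h2 : HasFDerivAt (fun y => fderiv ℝ (S.fc u) y v)
        ((fderiv ℝ (fderiv ℝ (S.fc u)) z).flip v) z := by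
      have := hd.hasFDerivAt.clm_apply (hasFDerivAt_const v z)
      simpa using this
    have h3 := h1.inner ℝ h2
    have h4 : (fun y => inner ℝ (S.Nc u y) (fderiv ℝ (S.fc u) y v)) =ᶠ[𝓝 z] fun _ => (0 : ℝ) := by
      filter_upwards [(chartAt ℂ u).open_target.mem_nhds hz] with y hy
      exact S.inner_N_df_chart u hy v
    have h5 := congrArg (fun L => L w)
      (h3.unique ((hasFDerivAt_const (0 : ℝ) z).congr_of_eventuallyEq h4))
    simp [fderivInnerCLM_apply] at h5
    rw [secondFF, real_inner_comm]
    simp only [Function.comp_apply]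
    linarith
  rw [key, key, hsymm.eq w v]

/-- `Q(τ, τ)` in terms of the second fundamental form in the directions `τ` and `i τ`. -/
theorem hopf_mul_sq (u : M) {z : ℂ} (hz : z ∈ (chartAt ℂ u).target) (τ : ℂ) :
    S.hopf u z * τ ^ 2 = ((S.secondFF u z τ τ - S.secondFF u z (τ * Complex.I) (τ * Complex.I) : ℝ) -
      2 * Complex.I * (S.secondFF u z τ (τ * Complex.I) : ℝ)) / 4 := by
  have h1 : τ = τ.re • (1 : ℂ) + τ.im • Complex.I := by
    apply Complex.ext <;> simp
  have h2 : τ * Complex.I = (-τ.im) • (1 : ℂ) + τ.re • Complex.I := by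
    apply Complex.ext <;> simp
  have h3 := S.secondFF_symm u hz Complex.I 1
  have e1 : S.secondFF u z τ τ = τ.re ^ 2 * S.secondFF u z 1 1 +
      2 * τ.re * τ.im * S.secondFF u z 1 Complex.I +
      τ.im ^ 2 * S.secondFF u z Complex.I Complex.I := by
    rw [h1]
    simp only [secondFF_add_left, secondFF_add_right, secondFF_smul_left, secondFF_smul_right, h3]
    simp
    ring
  have e2 : S.secondFF u z (τ * Complex.I) (τ * Complex.I) = τ.im ^ 2 * S.secondFF u z 1 1 -
      2 * τ.re * τ.im * S.secondFF u z 1 Complex.I +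
      τ.re ^ 2 * S.secondFF u z Complex.I Complex.I := by
    rw [h2]
    simp only [secondFF_add_left, secondFF_add_right, secondFF_smul_left, secondFF_smul_right, h3]
    ring
  have e3 : S.secondFF u z τ (τ * Complex.I) = -(τ.re * τ.im) * S.secondFF u z 1 1 +
      (τ.re ^ 2 - τ.im ^ 2) * S.secondFF u z 1 Complex.I +
      τ.re * τ.im * S.secondFF u z Complex.I Complex.I := by
    rw [h2]
    nth_rw 1 [h1]
    simp only [secondFF_add_left, secondFF_add_right, secondFF_smul_left, secondFF_smul_right, h3]
    ring
  rw [e1, e2, e3, hopf]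
  nth_rw 1 [← Complex.re_add_im τ]
  push_cast
  linear_combination ((S.secondFF u z 1 1 - S.secondFF u z Complex.I Complex.I : ℂ) * τ.im ^ 2 / 4 -
      (S.secondFF u z 1 Complex.I : ℂ) * τ.re * τ.im -
      Complex.I * S.secondFF u z 1 Complex.I * τ.im ^ 2 / 2) * Complex.I_sq

end SphereSurface

/-- A vector of `ℝ⁴` orthogonal to four pairwise orthogonal nonzero vectors vanishes. -/
theorem E4.eq_zero_of_inner_eq_zero {a b c d v : E4} (ha : a ≠ 0) (hb : b ≠ 0) (hc : c ≠ 0)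
    (hd : d ≠ 0) (hab : inner ℝ a b = (0 : ℝ)) (hac : inner ℝ a c = (0 : ℝ))
    (had : inner ℝ a d = (0 : ℝ)) (hbc : inner ℝ b c = (0 : ℝ)) (hbd : inner ℝ b d = (0 : ℝ))
    (hcd : inner ℝ c d = (0 : ℝ)) (hva : inner ℝ a v = (0 : ℝ)) (hvb : inner ℝ b v = (0 : ℝ))
    (hvc : inner ℝ c v = (0 : ℝ)) (hvd : inner ℝ d v = (0 : ℝ)) : v = 0 := by
  by_contra hv
  have h : LinearIndependent ℝ ![a, b, c, d, v] := by
    refine linearIndependent_of_ne_zero_of_inner_eq_zero (𝕜 := ℝ) ?_ ?_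
    · intro i; fin_cases i <;> simpa
    · intro i j hij
      fin_cases i <;> fin_cases j <;> first | exact absurd rfl hij | simpa | (rw [real_inner_comm]; simpa)
  have := h.fintype_card_le_finrank
  simp at this

/-! ### Tangential parts of chords and the chart-free value of Q on them. -/

namespace SphereSurface

variable {M : Type*} [TopologicalSpace M] [ChartedSpace ℂ M] (S : SphereSurface M)

/-- The component, in the coordinate of the chart at `u`, of the tangential part of `F ∈ ℝ⁴`. -/
noncomputable def secant (u : M) (z : ℂ) (F : E4) : ℂ :=
  ((inner ℝ (fderiv ℝ (S.fc u) z 1) F : ℝ) +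
    (inner ℝ (fderiv ℝ (S.fc u) z Complex.I) F : ℝ) * Complex.I) /
      ((‖fderiv ℝ (S.fc u) z 1‖ ^ 2 : ℝ) : ℂ)

/-- The value of the Hopf differential at `x` on the tangential part of the secant from `x` to
`y`. -/
noncomputable def hopfSecant (x y : M) : ℂ :=
  S.hopf x (chartAt ℂ x x) * S.secant x (chartAt ℂ x x) (S.f y - S.f x) ^ 2

theorem secant_add (u : M) (z : ℂ) (F F' : E4) :
    S.secant u z (F + F') = S.secant u z F + S.secant u z F' := by
  rw [secant, secant, secant, inner_add_right, inner_add_right]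
  push_cast
  ring

variable [IsManifold 𝓘(ℂ) ω M]

/-- Polarisation of conformality: the metric induced by f is c² times the Euclidean one. -/
theorem exists_inner_fderiv_fc (u : M) {z : ℂ} (hz : z ∈ (chartAt ℂ u).target) :
    ∃ c : ℝ, 0 < c ∧ ∀ v w : ℂ, inner ℝ (fderiv ℝ (S.fc u) z v) (fderiv ℝ (S.fc u) z w) =
      c ^ 2 * (v.re * w.re + v.im * w.im) := by
  obtain ⟨c, hc, hcv⟩ := S.conformal_chart u hz
  refine ⟨c, hc, fun v w => ?_⟩
  rw [real_inner_eq_norm_add_mul_self_sub_norm_mul_self_sub_norm_mul_self_div_two, ← map_add,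
    hcv, hcv, hcv]
  have h : ∀ v : ℂ, ‖v‖ * ‖v‖ = v.re * v.re + v.im * v.im := fun v => by
    rw [← sq, ← Complex.normSq_eq_norm_sq, Complex.normSq_apply]
  have h1 := h v
  have h2 := h w
  have h3 := h (v + w)
  simp only [Complex.add_re, Complex.add_im] at h3
  linear_combination c ^ 2 / 2 * h3 - c ^ 2 / 2 * h1 - c ^ 2 / 2 * h2

theorem secant_fderiv (u : M) {z : ℂ} (hz : z ∈ (chartAt ℂ u).target) (v : ℂ) :
    S.secant u z (fderiv ℝ (S.fc u) z v) = v := by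
  obtain ⟨c, hc, h⟩ := S.exists_inner_fderiv_fc u hz
  have h1 : (c : ℂ) ≠ 0 := by exact_mod_cast hc.ne'
  rw [secant, ← real_inner_self_eq_norm_sq, h, h, h]
  simp only [Complex.one_re, Complex.one_im, Complex.I_re, Complex.I_im]
  push_cast
  field_simp
  apply Complex.ext <;> simp

/-- Im(q v²) is a multiple of II(v, iv). For principal v this is a multiple of ⟨df(iv), df(v)⟩,
which vanishes by conformality. -/
theorem im_hopf_mul_sq_eq_zero {x : M} {v : ℂ} (hv : S.IsPrincipal x v) :
    (S.hopf x (chartAt ℂ x x) * v ^ 2).im = 0 := by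
  obtain ⟨-, l, hl⟩ := hv
  have hz := mem_chart_target ℂ x
  rw [S.hopf_mul_sq x hz, S.secondFF_symm x hz v (v * Complex.I)]
  have h1 : fderiv ℝ (S.Nc x) (chartAt ℂ x x) v =
      -(l • fderiv ℝ (S.fc x) (chartAt ℂ x x) v) := by
    rw [dN_eq, df_eq] at hl
    exact hl
  obtain ⟨c, hc, h⟩ := S.exists_inner_fderiv_fc x hz
  have h2 : S.secondFF x (chartAt ℂ x x) (v * Complex.I) v = 0 := by
    rw [secondFF, h1, inner_neg_right, inner_smul_right, h]
    simp
    right; right; ring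
  rw [h2]
  simp

/-- q = 0 means that II is a multiple l of the metric. Then dN + l df is orthogonal to both tangent
vectors, and to f and N by differentiating the normalisations; these four vectors span ℝ⁴. -/
theorem isUmbilic_iff (x : M) : S.IsUmbilic x ↔ S.hopf x (chartAt ℂ x x) = 0 := by
  have hz := mem_chart_target ℂ x
  set z := chartAt ℂ x x with hzdef
  obtain ⟨c, hc, h⟩ := S.exists_inner_fderiv_fc x hz
  constructor
  · rintro ⟨l, hl⟩
    have h1 : ∀ v, fderiv ℝ (S.Nc x) z v = -(l • fderiv ℝ (S.fc x) z v) := by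
      intro v
      rw [dN_eq, df_eq] at hl
      exact congrArg (fun L : ℂ →L[ℝ] E4 => L v) hl
    have h2 : ∀ v w : ℂ, S.secondFF x z v w = l * (c ^ 2 * (v.re * w.re + v.im * w.im)) := by
      intro v w
      rw [secondFF, h1, inner_neg_right, inner_smul_right, h]
      simp
    rw [hopf, h2, h2, h2]
    simp
  · intro h0
    have hsymm := S.secondFF_symm x hz Complex.I 1
    have hre : S.secondFF x z 1 1 = S.secondFF x z Complex.I Complex.I := by
      have := congrArg Complex.re h0
      simp [hopf] at this
      linarith
    have him : S.secondFF x z 1 Complex.I = 0 := by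
      have := congrArg Complex.im h0
      simp [hopf] at this
      exact this
    rw [him] at hsymm
    -- the shape operator is determined on the basis `1, i`
    set l : ℝ := S.secondFF x z 1 1 / c ^ 2 with hl
    have hc2 : c ^ 2 ≠ 0 := by positivity
    have hlc : l * c ^ 2 = S.secondFF x z 1 1 := by rw [hl]; field_simp
    obtain ⟨o1, o2, o3⟩ := S.inner_fderiv_fc x hz
    have hbasis : ∀ v : ℂ, S.secondFF x z 1 v = l * c ^ 2 * v.re →
        S.secondFF x z Complex.I v = l * c ^ 2 * v.im →
        fderiv ℝ (S.Nc x) z v = -(l • fderiv ℝ (S.fc x) z v) := by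
      intro v hv1 hv2
      rw [← sub_eq_zero, sub_neg_eq_add]
      have hf : S.fc x z ≠ 0 := by
        rw [← norm_ne_zero_iff]
        have : ‖S.fc x z‖ = 1 := S.norm_f _
        rw [this]; norm_num
      have hN : S.Nc x z ≠ 0 := by
        rw [← norm_ne_zero_iff]
        have : ‖S.Nc x z‖ = 1 := S.norm_N _
        rw [this]; norm_num
      refine E4.eq_zero_of_inner_eq_zero (a := fderiv ℝ (S.fc x) z 1)
        (b := fderiv ℝ (S.fc x) z Complex.I) (c := S.fc x z) (d := S.Nc x z)
        (norm_pos_iff.mp o3) (norm_pos_iff.mp (o2 ▸ o3)) hf hN o1 ?_ ?_ ?_ ?_ ?_ ?_ ?_ ?_ ?_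
      · rw [real_inner_comm]; exact S.inner_f_df_chart x hz 1
      · rw [real_inner_comm]; exact S.inner_N_df_chart x hz 1
      · rw [real_inner_comm]; exact S.inner_f_df_chart x hz Complex.I
      · rw [real_inner_comm]; exact S.inner_N_df_chart x hz Complex.I
      · rw [real_inner_comm]; exact S.inner_N_f _
      · rw [inner_add_right, inner_smul_right, h]
        rw [secondFF] at hv1
        simp only [Complex.one_re, Complex.one_im]
        linarith
      · rw [inner_add_right, inner_smul_right, h]
        rw [secondFF] at hv2
        simp only [Complex.I_re, Complex.I_im]
        linarith
      · rw [inner_add_right, inner_smul_right, S.inner_f_dN_chart x hz, S.inner_f_df_chart x hz]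
        simp
      · rw [inner_add_right, inner_smul_right, S.inner_N_dN_chart x hz, S.inner_N_df_chart x hz]
        simp
    have hb1 := hbasis 1 (by simp [hlc]) (by simp [hsymm])
    have hbI := hbasis Complex.I (by simp [him]) (by simp [hlc, hre])
    refine ⟨l, ?_⟩
    have : fderiv ℝ (S.Nc x) z = -(l • fderiv ℝ (S.fc x) z) := by
      ext1 v
      have hv : v = v.re • (1 : ℂ) + v.im • Complex.I := by
        apply Complex.ext <;> simp
      rw [hv, map_add, map_add, map_smul, map_smul, map_smul, map_smul, hb1, hbI]
      simp
    rw [dN_eq, df_eq]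
    exact this

/-- Under a change of charts the coefficient of the Hopf differential and the secants are multiplied
by powers of the derivative of the transition map. -/
theorem exists_transition_hopf (u v x : M) (hu : x ∈ (chartAt ℂ u).source)
    (hv : x ∈ (chartAt ℂ v).source) : ∃ τ : ℂ, τ ≠ 0 ∧
      S.hopf u (chartAt ℂ u x) = S.hopf v (chartAt ℂ v x) * τ ^ 2 ∧
      ∀ F, S.secant v (chartAt ℂ v x) F = τ * S.secant u (chartAt ℂ u x) F := by
  obtain ⟨τ, hτ, h⟩ := exists_transition u v x hu hv
  have hf := h S.f S.smooth_f
  have hN := h S.N S.smooth_N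
  refine ⟨τ, hτ, ?_, fun F => ?_⟩
  · rw [S.hopf_mul_sq v ((chartAt ℂ v).map_source hv), hopf]
    have : ∀ a b, S.secondFF u (chartAt ℂ u x) a b =
        S.secondFF v (chartAt ℂ v x) (τ * a) (τ * b) := by
      intro a b
      rw [secondFF, hf, hN, secondFF]
    rw [this, this, this, mul_one]
  · have h1 : τ * 1 = τ.re • (1 : ℂ) + τ.im • Complex.I := by
      apply Complex.ext <;> simp
    have h2 : τ * Complex.I = (-τ.im) • (1 : ℂ) + τ.re • Complex.I := by
      apply Complex.ext <;> simp
    obtain ⟨o1, o2, o3⟩ := S.inner_fderiv_fc v ((chartAt ℂ v).map_source hv)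
    obtain ⟨c, hc, hcv⟩ := S.conformal_chart v ((chartAt ℂ v).map_source hv)
    have h3 : ‖fderiv ℝ (S.fc u) (chartAt ℂ u x) 1‖ ^ 2 =
        (τ.re ^ 2 + τ.im ^ 2) * ‖fderiv ℝ (S.fc v) (chartAt ℂ v x) 1‖ ^ 2 := by
      rw [hf, hcv, hcv, mul_one, norm_one, mul_pow, ← Complex.normSq_eq_norm_sq,
        Complex.normSq_apply]
      ring
    rw [secant, secant, h3]
    have e1 : fderiv ℝ (S.fc u) (chartAt ℂ u x) 1 =
        τ.re • fderiv ℝ (S.fc v) (chartAt ℂ v x) 1 +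
          τ.im • fderiv ℝ (S.fc v) (chartAt ℂ v x) Complex.I := by
      rw [← map_smul, ← map_smul, ← map_add, ← h1]
      exact hf 1
    have e2 : fderiv ℝ (S.fc u) (chartAt ℂ u x) Complex.I =
        (-τ.im) • fderiv ℝ (S.fc v) (chartAt ℂ v x) 1 +
          τ.re • fderiv ℝ (S.fc v) (chartAt ℂ v x) Complex.I := by
      rw [← map_smul, ← map_smul, ← map_add, ← h2]
      exact hf Complex.I
    rw [e1, e2, inner_add_left, inner_add_left, real_inner_smul_left, real_inner_smul_left,
      real_inner_smul_left, real_inner_smul_left]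
    set P := inner ℝ (fderiv ℝ (S.fc v) (chartAt ℂ v x) 1) F
    set Q := inner ℝ (fderiv ℝ (S.fc v) (chartAt ℂ v x) Complex.I) F
    have h4 : ((‖fderiv ℝ (S.fc v) (chartAt ℂ v x) 1‖ ^ 2 : ℝ) : ℂ) ≠ 0 := by
      exact_mod_cast (by positivity : ‖fderiv ℝ (S.fc v) (chartAt ℂ v x) 1‖ ^ 2 ≠ 0)
    have h5 : ((τ.re ^ 2 + τ.im ^ 2 : ℝ) : ℂ) ≠ 0 := by
      have : τ.re ^ 2 + τ.im ^ 2 = Complex.normSq τ := by rw [Complex.normSq_apply]; ring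
      rw [this]
      exact_mod_cast (Complex.normSq_pos.mpr hτ).ne'
    set n : ℝ := ‖fderiv ℝ (S.fc v) (chartAt ℂ v x) 1‖ ^ 2
    set m : ℝ := τ.re ^ 2 + τ.im ^ 2 with hm
    have h6 : τ * ((τ.re * P + τ.im * Q : ℝ) + (-τ.im * P + τ.re * Q : ℝ) * Complex.I) =
        m * (P + Q * Complex.I) := by
      rw [hm]
      apply Complex.ext
      · simp only [Complex.mul_re, Complex.add_re, Complex.ofReal_re, Complex.ofReal_im,
          Complex.add_im, Complex.mul_im, Complex.I_re, Complex.I_im]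
        ring
      · simp only [Complex.mul_re, Complex.add_re, Complex.ofReal_re, Complex.ofReal_im,
          Complex.add_im, Complex.mul_im, Complex.I_re, Complex.I_im]
        ring
    push_cast at h6 ⊢
    rw [mul_div_assoc', h6]
    field_simp

/-- The factor τ² of the coefficient and the factor τ⁻² of the squared secant cancel, so any chart
around x gives the same value. -/
theorem hopfSecant_eq (u x y : M) (hu : x ∈ (chartAt ℂ u).source) :
    S.hopfSecant x y =
      S.hopf u (chartAt ℂ u x) * S.secant u (chartAt ℂ u x) (S.f y - S.f x) ^ 2 := by
  obtain ⟨τ, -, h1, h2⟩ := S.exists_transition_hopf u x x hu (mem_chart_source ℂ x)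
  rw [hopfSecant, h1, h2]
  ring

theorem continuousOn_hopf (u : M) : ContinuousOn (S.hopf u) (chartAt ℂ u).target := by
  have h1 : ContinuousOn (fderiv ℝ (S.fc u)) (chartAt ℂ u).target :=
    (S.smooth_f.contDiffOn_comp_chart_symm u).continuousOn_fderiv_of_isOpen
      (chartAt ℂ u).open_target (by simp)
  have h2 : ContinuousOn (fderiv ℝ (S.Nc u)) (chartAt ℂ u).target :=
    (S.smooth_N.contDiffOn_comp_chart_symm u).continuousOn_fderiv_of_isOpen
      (chartAt ℂ u).open_target (by simp)
  have h3 : ∀ v w : ℂ, ContinuousOn (fun z => S.secondFF u z v w) (chartAt ℂ u).target := by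
    intro v w
    exact ((h1.clm_apply continuousOn_const).inner (𝕜 := ℝ) (h2.clm_apply continuousOn_const)).neg
  have h4 := h3 1 1
  have h5 := h3 Complex.I Complex.I
  have h6 := h3 1 Complex.I
  refine ContinuousOn.div_const (ContinuousOn.sub ?_ ?_) _
  · exact Complex.continuous_ofReal.comp_continuousOn (h4.sub h5)
  · exact continuousOn_const.mul (Complex.continuous_ofReal.comp_continuousOn h6)

theorem continuousOn_secant (u : M) :
    ContinuousOn (fun p : ℂ × E4 => S.secant u p.1 p.2) ((chartAt ℂ u).target ×ˢ univ) := by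
  have h1 : ContinuousOn (fun p : ℂ × E4 => fderiv ℝ (S.fc u) p.1)
      ((chartAt ℂ u).target ×ˢ univ) :=
    ((S.smooth_f.contDiffOn_comp_chart_symm u).continuousOn_fderiv_of_isOpen
      (chartAt ℂ u).open_target (by simp)).comp continuousOn_fst fun p hp => hp.1
  have h2 : ∀ v : ℂ, ContinuousOn (fun p : ℂ × E4 => fderiv ℝ (S.fc u) p.1 v)
      ((chartAt ℂ u).target ×ˢ univ) := fun v => h1.clm_apply continuousOn_const
  refine ContinuousOn.div ?_ ?_ ?_
  · refine ContinuousOn.add ?_ (ContinuousOn.mul ?_ continuousOn_const)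
    · exact Complex.continuous_ofReal.comp_continuousOn ((h2 1).inner (𝕜 := ℝ) continuousOn_snd)
    · exact Complex.continuous_ofReal.comp_continuousOn ((h2 Complex.I).inner (𝕜 := ℝ) continuousOn_snd)
  · exact Complex.continuous_ofReal.comp_continuousOn ((h2 1).norm.pow 2)
  · intro p hp
    have := (S.inner_fderiv_fc u hp.1).2.2
    exact_mod_cast (pow_pos this 2).ne'

theorem continuous_hopfSecant : Continuous fun p : M × M => S.hopfSecant p.1 p.2 := by
  rw [continuous_iff_continuousAt]
  rintro ⟨u, y⟩
  have hsrc : ∀ᶠ p : M × M in 𝓝 (u, y), p.1 ∈ (chartAt ℂ u).source :=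
    continuous_fst.continuousAt.preimage_mem_nhds (chart_source_mem_nhds ℂ u)
  have h1 : ContinuousAt (fun p : M × M => chartAt ℂ u p.1) (u, y) :=
    ContinuousAt.comp (g := chartAt ℂ u) (f := Prod.fst)
      ((chartAt ℂ u).continuousAt (mem_chart_source ℂ u)) continuous_fst.continuousAt
  have h2 : ContinuousAt (S.hopf u) (chartAt ℂ u u) :=
    (S.continuousOn_hopf u).continuousAt (chart_target_mem_nhds ℂ u)
  have h3 : ContinuousAt (fun p : ℂ × E4 => S.secant u p.1 p.2) (chartAt ℂ u u, S.f y - S.f u) :=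
    (S.continuousOn_secant u).continuousAt
      (prod_mem_nhds (chart_target_mem_nhds ℂ u) Filter.univ_mem)
  have h4 : ContinuousAt (fun p : M × M => S.f p.2 - S.f p.1) (u, y) := by
    have := S.smooth_f.continuous
    fun_prop
  have h5 : ContinuousAt (fun p : M × M => S.hopf u (chartAt ℂ u p.1)) (u, y) :=
    ContinuousAt.comp (f := fun p : M × M => chartAt ℂ u p.1) (x := (u, y)) h2 h1
  have h6 : ContinuousAt
      (fun p : M × M => S.secant u (chartAt ℂ u p.1) (S.f p.2 - S.f p.1)) (u, y) :=
    ContinuousAt.comp (f := fun p : M × M => (chartAt ℂ u p.1, S.f p.2 - S.f p.1)) (x := (u, y)) h3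
      (h1.prodMk h4)
  refine (h5.mul (h6.pow 2)).congr ?_
  filter_upwards [hsrc] with p hp
  exact (S.hopfSecant_eq u p.1 p.2 hp).symm

theorem norm_secant_le (u : M) {z : ℂ} (hz : z ∈ (chartAt ℂ u).target) (F : E4) :
    ‖S.secant u z F‖ ≤ 2 * ‖F‖ / ‖fderiv ℝ (S.fc u) z 1‖ := by
  obtain ⟨o1, o2, o3⟩ := S.inner_fderiv_fc u hz
  rw [secant, norm_div, Complex.norm_real, Real.norm_of_nonneg (by positivity),
    div_le_div_iff₀ (by positivity) o3]
  have h1 : ‖((inner ℝ (fderiv ℝ (S.fc u) z 1) F : ℝ) : ℂ)‖ ≤ ‖fderiv ℝ (S.fc u) z 1‖ * ‖F‖ := by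
    rw [Complex.norm_real]
    exact abs_real_inner_le_norm _ _
  have h2 : ‖((inner ℝ (fderiv ℝ (S.fc u) z Complex.I) F : ℝ) : ℂ) * Complex.I‖ ≤
      ‖fderiv ℝ (S.fc u) z 1‖ * ‖F‖ := by
    rw [norm_mul, Complex.norm_I, mul_one, Complex.norm_real, o2]
    exact abs_real_inner_le_norm _ _
  have h3 := (norm_add_le _ _).trans (add_le_add h1 h2)
  calc _ ≤ (‖fderiv ℝ (S.fc u) z 1‖ * ‖F‖ + ‖fderiv ℝ (S.fc u) z 1‖ * ‖F‖) *
        ‖fderiv ℝ (S.fc u) z 1‖ := by gcongr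
    _ = _ := by ring

/-- Secants are asymptotic to differences of coordinates. -/
theorem tendsto_secant_div (u : M) {z0 : ℂ} (hz0 : z0 ∈ (chartAt ℂ u).target) :
    Filter.Tendsto (fun p : ℂ × ℂ => S.secant u p.1 (S.fc u p.2 - S.fc u p.1) / (p.2 - p.1))
      (𝓝[{p | p.1 ≠ p.2}] (z0, z0)) (𝓝 1) := by
  have htgt : ∀ᶠ p : ℂ × ℂ in 𝓝 (z0, z0), p.1 ∈ (chartAt ℂ u).target :=
    continuous_fst.continuousAt.preimage_mem_nhds ((chartAt ℂ u).open_target.mem_nhds hz0)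
  have hstrict := (S.contDiffAt_fc u hz0).hasStrictFDerivAt (by simp)
  have hcont : ContinuousAt (fderiv ℝ (S.fc u)) z0 :=
    ((S.smooth_f.contDiffOn_comp_chart_symm u).continuousOn_fderiv_of_isOpen
      (chartAt ℂ u).open_target (by simp)).continuousAt ((chartAt ℂ u).open_target.mem_nhds hz0)
  set D := fderiv ℝ (S.fc u) with hD
  have o3 := (S.inner_fderiv_fc u hz0).2.2
  have hlow : ∀ᶠ p : ℂ × ℂ in 𝓝 (z0, z0), ‖D z0 1‖ / 2 < ‖D p.1 1‖ := by
    have : ContinuousAt (fun p : ℂ × ℂ => ‖D p.1 1‖) (z0, z0) := by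
      have h1 : ContinuousAt (fun p : ℂ × ℂ => D p.1) (z0, z0) :=
        ContinuousAt.comp (f := Prod.fst) (x := (z0, z0)) hcont continuous_fst.continuousAt
      exact (h1.clm_apply continuousAt_const).norm
    exact this (Ioi_mem_nhds (by linarith))
  rw [Metric.tendsto_nhds]
  intro η hη
  set K := ‖D z0 1‖ with hK
  set η' := η * K / 16 with hη'
  have hη'0 : 0 < η' := by positivity
  have e1 : ∀ᶠ p : ℂ × ℂ in 𝓝 (z0, z0),
      ‖S.fc u p.2 - S.fc u p.1 - D z0 (p.2 - p.1)‖ ≤ η' * ‖p.2 - p.1‖ := by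
    have h1 := hstrict.isLittleO.def hη'0
    have h2 : Filter.Tendsto (fun p : ℂ × ℂ => (p.2, p.1)) (𝓝 (z0, z0)) (𝓝 (z0, z0)) := by
      have : ContinuousAt (fun p : ℂ × ℂ => (p.2, p.1)) (z0, z0) := by fun_prop
      exact this
    exact h2.eventually h1
  have e2 : ∀ᶠ p : ℂ × ℂ in 𝓝 (z0, z0), ‖D p.1 - D z0‖ < η' := by
    have h1 : ContinuousAt (fun p : ℂ × ℂ => ‖D p.1 - D z0‖) (z0, z0) := by
      have h1 : ContinuousAt (fun p : ℂ × ℂ => D p.1) (z0, z0) :=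
        ContinuousAt.comp (f := Prod.fst) (x := (z0, z0)) hcont continuous_fst.continuousAt
      exact (h1.sub continuousAt_const).norm
    exact h1 (Iio_mem_nhds (by simpa using hη'0))
  filter_upwards [nhdsWithin_le_nhds e1, nhdsWithin_le_nhds e2, nhdsWithin_le_nhds hlow,
    nhdsWithin_le_nhds htgt, self_mem_nhdsWithin] with p h1 h2 h3 h4 h5
  have h5 : p.2 - p.1 ≠ 0 := sub_ne_zero.mpr (Ne.symm h5)
  have hn : 0 < ‖p.2 - p.1‖ := norm_pos_iff.mpr h5
  set F := S.fc u p.2 - S.fc u p.1 - D p.1 (p.2 - p.1) with hF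
  have h6 : S.secant u p.1 (S.fc u p.2 - S.fc u p.1) = (p.2 - p.1) + S.secant u p.1 F := by
    have : S.fc u p.2 - S.fc u p.1 = fderiv ℝ (S.fc u) p.1 (p.2 - p.1) + F := by
      simp only [hF, hD]
      abel
    rw [this, S.secant_add, S.secant_fderiv u h4]
  have h7 : ‖F‖ ≤ 2 * η' * ‖p.2 - p.1‖ := by
    have : F = (S.fc u p.2 - S.fc u p.1 - D z0 (p.2 - p.1)) - (D p.1 - D z0) (p.2 - p.1) := by
      simp only [hF, sub_apply]
      abel
    rw [this]
    have h8 := (D p.1 - D z0).le_opNorm (p.2 - p.1)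
    have h9 : ‖D p.1 - D z0‖ * ‖p.2 - p.1‖ ≤ η' * ‖p.2 - p.1‖ := by gcongr
    calc _ ≤ _ := norm_sub_le _ _
      _ ≤ η' * ‖p.2 - p.1‖ + η' * ‖p.2 - p.1‖ := add_le_add h1 (h8.trans h9)
      _ = _ := by ring
  have h8 := S.norm_secant_le u h4 F
  rw [h6, add_div, div_self h5, dist_eq_norm, add_sub_cancel_left, norm_div, div_lt_iff₀ hn]
  refine h8.trans_lt ?_
  rw [div_lt_iff₀ (by linarith)]
  calc 2 * ‖F‖ ≤ 2 * (2 * η' * ‖p.2 - p.1‖) := by gcongr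
    _ = η * ‖p.2 - p.1‖ * (K / 4) := by rw [hη']; ring
    _ < η * ‖p.2 - p.1‖ * ‖D p.1 1‖ := by
        apply mul_lt_mul_of_pos_left _ (by positivity)
        linarith

end SphereSurface

/-! ### Strict velocities of curvature lines. -/

/-- Difference quotients of a `C¹` curve converge to the derivative. -/
theorem ContDiffWithinAt.tendsto_slope {c : ℝ → ℂ} {a b t0 : ℝ} (hab : a < b)
    (ht0 : t0 ∈ Icc a b) (hc : ContDiffWithinAt ℝ 1 c (Icc a b) t0) :
    Filter.Tendsto (fun p : ℝ × ℝ => (c p.2 - c p.1) / (p.2 - p.1 : ℝ))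
      (𝓝[{p | p.1 ∈ Icc a b ∧ p.2 ∈ Icc a b ∧ p.1 < p.2}] (t0, t0))
      (𝓝 (derivWithin c (Icc a b) t0)) := by
  obtain ⟨u, hu, ht0u, hcu⟩ := hc.contDiffOn' le_rfl (by simp)
  rw [insert_eq_of_mem ht0] at hcu
  have hcont : ContinuousOn (derivWithin c (Icc a b ∩ u)) (Icc a b ∩ u) :=
    hcu.continuousOn_derivWithin ((uniqueDiffOn_Icc hab).inter hu) (by simp)
  have hval : derivWithin c (Icc a b ∩ u) t0 = derivWithin c (Icc a b) t0 :=
    derivWithin_inter (hu.mem_nhds ht0u)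
  set e := derivWithin c (Icc a b) t0 with he
  rw [Metric.tendsto_nhds]
  intro η hη
  have h1 : ∀ᶠ t in 𝓝[Icc a b ∩ u] t0, ‖derivWithin c (Icc a b ∩ u) t - e‖ < η / 2 := by
    have := (hcont t0 ⟨ht0, ht0u⟩)
    rw [ContinuousWithinAt, hval, Metric.tendsto_nhds] at this
    simpa [dist_eq_norm] using this (η / 2) (by positivity)
  rw [nhdsWithin_inter_of_mem' (nhdsWithin_le_nhds (hu.mem_nhds ht0u)),
    eventually_nhdsWithin_iff] at h1
  obtain ⟨ρ, hρ, hρu⟩ := Metric.eventually_nhds_iff_ball.mp (h1.and (hu.mem_nhds ht0u))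
  have hconv : Convex ℝ (Icc a b ∩ Metric.ball t0 ρ) := (convex_Icc a b).inter (convex_ball t0 ρ)
  -- Subtracting the linear motion with velocity e leaves a derivative below η/2, to which the mean
  -- value inequality applies.
  have hder : ∀ t ∈ Icc a b ∩ Metric.ball t0 ρ, HasDerivWithinAt (fun t => c t - t * e)
      (derivWithin c (Icc a b ∩ u) t - e) (Icc a b ∩ Metric.ball t0 ρ) t := by
    rintro t ⟨ht, htb⟩
    have h2 : HasDerivWithinAt c (derivWithin c (Icc a b ∩ u) t) (Icc a b ∩ u) t :=
      ((hcu.differentiableOn (by simp)) t ⟨ht, (hρu t htb).2⟩).hasDerivWithinAt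
    have h3 : HasDerivWithinAt (fun t : ℝ => (t : ℂ) * e) (1 * e) (Icc a b ∩ u) t :=
      (Complex.ofRealCLM.hasDerivWithinAt (x := t)).mul_const e
    rw [one_mul] at h3
    exact (h2.sub h3).mono fun s hs => ⟨hs.1, (hρu s hs.2).2⟩
  have hball : ∀ᶠ p : ℝ × ℝ in 𝓝 (t0, t0), p.1 ∈ Metric.ball t0 ρ ∧ p.2 ∈ Metric.ball t0 ρ :=
    Filter.Eventually.and (continuous_fst.tendsto (t0, t0) (Metric.ball_mem_nhds _ hρ))
      (continuous_snd.tendsto (t0, t0) (Metric.ball_mem_nhds _ hρ))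
  filter_upwards [self_mem_nhdsWithin, nhdsWithin_le_nhds hball] with p hp hpb
  obtain ⟨hp1, hp2, hlt⟩ := hp
  have h4 := hconv.norm_image_sub_le_of_norm_hasDerivWithin_le hder
    (fun t ht => ((hρu t ht.2).1 ht.1).le) ⟨hp1, hpb.1⟩ ⟨hp2, hpb.2⟩
  have h5 : 0 < p.2 - p.1 := sub_pos.mpr hlt
  have h6 : ((p.2 - p.1 : ℝ) : ℂ) ≠ 0 := by exact_mod_cast h5.ne'
  have h7 : (c p.2 - c p.1) / (p.2 - p.1 : ℝ) - e =
      ((c p.2 - p.2 * e) - (c p.1 - p.1 * e)) / (p.2 - p.1 : ℝ) := by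
    field_simp
    push_cast
    ring
  rw [dist_eq_norm, h7, norm_div, Complex.norm_real, Real.norm_of_nonneg h5.le, div_lt_iff₀ h5]
  rw [Real.norm_of_nonneg h5.le] at h4
  nlinarith

namespace SphereSurface

variable {M : Type*} [TopologicalSpace M] [ChartedSpace ℂ M] {S : SphereSurface M}

/-- A curvature line in the chart at one of its points. -/
theorem IsCurvatureLineOn.exists_velocity [IsManifold 𝓘(ℂ) ω M] {γ : ℝ → M} {a b t0 : ℝ}
    (h : S.IsCurvatureLineOn γ (Icc a b)) (hab : a < b) (ht0 : t0 ∈ Icc a b) :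
    ∃ e : ℂ, e ≠ 0 ∧ (S.hopf (γ t0) (chartAt ℂ (γ t0) (γ t0)) * e ^ 2).im = 0 ∧
      Filter.Tendsto (fun p : ℝ × ℝ =>
        (chartAt ℂ (γ t0) (γ p.2) - chartAt ℂ (γ t0) (γ p.1)) / (p.2 - p.1 : ℝ))
        (𝓝[{p | p.1 ∈ Icc a b ∧ p.2 ∈ Icc a b ∧ p.1 < p.2}] (t0, t0)) (𝓝 e) := by
  obtain ⟨h1, h2⟩ := h
  have hp := h2 t0 ht0
  have h3 : ContMDiffWithinAt 𝓘(ℝ, ℝ) 𝓘(ℝ, ℂ) 1 γ (Icc a b) t0 := h1 t0 ht0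
  have h4 : ContDiffWithinAt ℝ 1 (chartAt ℂ (γ t0) ∘ γ) (Icc a b) t0 := by
    have := (contMDiffWithinAt_iff.mp h3).2
    simpa [extChartAt, chartAt_self_eq] using this
  have h5 : (mfderivWithin 𝓘(ℝ, ℝ) 𝓘(ℝ, ℂ) γ (Icc a b) t0 (1 : ℝ) : ℂ) =
      derivWithin (chartAt ℂ (γ t0) ∘ γ) (Icc a b) t0 := by
    have h6 : MDifferentiableWithinAt 𝓘(ℝ, ℝ) 𝓘(ℝ, ℂ) γ (Icc a b) t0 :=
      h3.mdifferentiableWithinAt (by simp)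
    have key : fderivWithin ℝ (chartAt ℂ (γ t0) ∘ γ) (id ⁻¹' Icc a b ∩ range id) t0 =
      fderivWithin ℝ (chartAt ℂ (γ t0) ∘ γ) (Icc a b) t0 := by simp
    rw [← fderivWithin_derivWithin, ← key]
    exact congrArg (fun L : ℝ →L[ℝ] ℂ => L 1) h6.mfderivWithin
  refine ⟨derivWithin (chartAt ℂ (γ t0) ∘ γ) (Icc a b) t0, ?_, ?_, ?_⟩
  · rw [← h5]; exact hp.1
  · have := S.im_hopf_mul_sq_eq_zero hp
    rwa [← h5]
  · exact h4.tendsto_slope hab ht0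

end SphereSurface

/-! ### Winding numbers and the normal form of Q at a point with an index. -/

/-- The winding number along a circle of a power times an exponential. -/
theorem winding_zpow_mul_exp {r : ℝ} (hr : 0 < r) {m : ℤ} {l : ℂ → ℂ}
    (hl : ContinuousOn l (Metric.sphere 0 r)) {A : ℝ → ℝ} (hA : Continuous A)
    (h : ∀ t : ℝ, ∃ c : ℝ, 0 < c ∧
      circleMap 0 r t ^ m * Complex.exp (l (circleMap 0 r t)) = c * Complex.exp (A t * Complex.I)) (t0 : ℝ) :
    A (t0 + 2 * Real.pi) - A t0 = 2 * Real.pi * m := by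
  have hmem : ∀ t, circleMap 0 r t ∈ Metric.sphere (0 : ℂ) r :=
    fun t => circleMap_mem_sphere 0 hr.le t
  -- An explicit argument: mt from the power plus a periodic term; any other continuous argument
  -- differs from it by a constant.
  have hB : Continuous fun t : ℝ => m * t + (l (circleMap 0 r t)).im := by
    refine (by fun_prop : Continuous fun t : ℝ => (m : ℝ) * t).add ?_
    exact Complex.continuous_im.comp (hl.comp_continuous (continuous_circleMap 0 r) hmem)
  obtain ⟨n, hn⟩ := isPreconnected_univ.arg_unique (A := ℝ) hA.continuousOn hB.continuousOn (by
    intro t _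
    obtain ⟨c, hc, h1⟩ := h t
    have e1 : circleMap 0 r t ^ m * Complex.exp (l (circleMap 0 r t)) =
        (r ^ m : ℝ) * Complex.exp (m * (t * Complex.I) + l (circleMap 0 r t)) := by
      rw [circleMap_zero, mul_zpow, ← Complex.exp_int_mul, Complex.exp_add]
      push_cast
      ring
    have e2 := exp_im_mul_I_eq (by positivity) e1
    have e3 := exp_im_mul_I_eq hc h1
    rw [← e2] at e3
    have e4 : (↑m * (↑t * Complex.I) + l (circleMap 0 r t)).im =
        m * t + (l (circleMap 0 r t)).im := by simp
    have e5 : (↑(A t) * Complex.I).im = A t := by simp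
    rw [e4, e5] at e3
    exact e3)
  have h1 := hn (t0 + 2 * Real.pi) (mem_univ _)
  have h2 := hn t0 (mem_univ _)
  have h3 : circleMap 0 r (t0 + 2 * Real.pi) = circleMap 0 r t0 := periodic_circleMap 0 r t0
  rw [h1, h2, h3]
  ring

/-- Both exponents are the winding number along the circle of radius ρ/2. -/
theorem zpow_mul_exp_unique {ρ : ℝ} (hρ : 0 < ρ) {m n : ℤ} {l l' : ℂ → ℂ}
    (hl : ContinuousOn l {v | 0 < ‖v‖ ∧ ‖v‖ < ρ}) (hl' : ContinuousOn l' {v | 0 < ‖v‖ ∧ ‖v‖ < ρ})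
    (h : ∀ v, 0 < ‖v‖ → ‖v‖ < ρ → v ^ m * Complex.exp (l v) = v ^ n * Complex.exp (l' v)) :
    m = n := by
  have hr : 0 < ρ / 2 := by positivity
  have hsub : Metric.sphere (0 : ℂ) (ρ / 2) ⊆ {v | 0 < ‖v‖ ∧ ‖v‖ < ρ} := by
    intro v hv
    rw [mem_sphere_zero_iff_norm] at hv
    exact ⟨by rw [hv]; exact hr, by rw [hv]; linarith⟩
  have hmem : ∀ t, circleMap 0 (ρ / 2) t ∈ Metric.sphere (0 : ℂ) (ρ / 2) :=
    fun t => circleMap_mem_sphere 0 hr.le t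
  have hB : Continuous fun t : ℝ => n * t + (l' (circleMap 0 (ρ / 2) t)).im := by
    refine (by fun_prop : Continuous fun t : ℝ => (n : ℝ) * t).add ?_
    exact Complex.continuous_im.comp
      ((hl'.mono hsub).comp_continuous (continuous_circleMap 0 _) hmem)
  have h1 : ∀ t : ℝ, circleMap 0 (ρ / 2) t ^ n * Complex.exp (l' (circleMap 0 (ρ / 2) t)) =
      ((ρ / 2) ^ n * Real.exp (l' (circleMap 0 (ρ / 2) t)).re : ℝ) *
        Complex.exp ((n * t + (l' (circleMap 0 (ρ / 2) t)).im : ℝ) * Complex.I) := by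
    intro t
    generalize hz : l' (circleMap 0 (ρ / 2) t) = z
    have e1 : Complex.exp z = Complex.exp z.re * Complex.exp (z.im * Complex.I) := by
      rw [← Complex.exp_add, Complex.re_add_im]
    rw [e1, circleMap_zero, mul_zpow, ← Complex.exp_int_mul]
    push_cast
    rw [add_mul, Complex.exp_add, mul_assoc (n : ℂ)]
    ring
  have h2 := winding_zpow_mul_exp hr (hl.mono hsub) hB (m := m) (fun t => by
    refine ⟨(ρ / 2) ^ n * Real.exp (l' (circleMap 0 (ρ / 2) t)).re, by positivity, ?_⟩
    rw [h _ (hsub (hmem t)).1 (hsub (hmem t)).2]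
    exact h1 t) 0
  rw [zero_add] at h2
  have h3 : circleMap 0 (ρ / 2) (2 * Real.pi) = circleMap 0 (ρ / 2) 0 := by
    simpa using periodic_circleMap 0 (ρ / 2) 0
  simp only [h3] at h2
  have h4 : (2 * Real.pi) * (m : ℝ) = 2 * Real.pi * n := by linarith
  have := mul_left_cancel₀ (by positivity) h4
  exact_mod_cast this

namespace SphereSurface

variable {M : Type*} [TopologicalSpace M] [ChartedSpace ℂ M] {S : SphereSurface M}
  [IsManifold 𝓘(ℂ) ω M]

theorem isUmbilic_iff_of_mem (u : M) {x : M} (hx : x ∈ (chartAt ℂ u).source) :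
    S.IsUmbilic x ↔ S.hopf u (chartAt ℂ u x) = 0 := by
  obtain ⟨τ, hτ, h1, -⟩ := S.exists_transition_hopf u x x hx (mem_chart_source ℂ x)
  rw [S.isUmbilic_iff, h1]
  simp [hτ]

/-- Turns the winding number into a factorisation on a punctured disk: the exponent supplied by
`exists_zpow_mul_exp` is the winding number on the circle of radius ρ/2, hence the index. -/
theorem HasIndex.exists_hopf_eq {u : M} {k : ℤ} (hk : S.HasIndex u k) :
    ∃ (ρ : ℝ) (l : ℂ → ℂ), 0 < ρ ∧ ContinuousOn l {v | 0 < ‖v‖ ∧ ‖v‖ < ρ} ∧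
      ∀ v, 0 < ‖v‖ → ‖v‖ < ρ → S.hopf u (chartAt ℂ u u + v) = v ^ k * Complex.exp (l v) := by
  obtain ⟨r1, hr1, h1⟩ := mem_nhdsGT_iff_exists_Ioo_subset.mp hk
  obtain ⟨r2, hr2, h2⟩ := Metric.isOpen_iff.mp (chartAt ℂ u).open_target _ (mem_chart_target ℂ u)
  have hr1 : 0 < r1 := hr1
  set ρ := min r1 r2
  have hρ : 0 < ρ := lt_min hr1 hr2
  have hne : ∀ v : ℂ, 0 < ‖v‖ → ‖v‖ < ρ → S.hopf u (chartAt ℂ u u + v) ≠ 0 := by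
    intro v hv hv'
    obtain ⟨A, -, hA, -⟩ := h1 ⟨hv, hv'.trans_le (min_le_left _ _)⟩
    have := (hA (Complex.arg v)).1
    rwa [circleMap, Complex.norm_mul_exp_arg_mul_I] at this
  have hcont : ContinuousOn (fun v => S.hopf u (chartAt ℂ u u + v)) {v | 0 < ‖v‖ ∧ ‖v‖ < ρ} := by
    refine (S.continuousOn_hopf u).comp (by fun_prop) ?_
    rintro v ⟨-, hv⟩
    apply h2
    simpa using hv.trans_le (min_le_right _ _)
  obtain ⟨m, l, hl, hml⟩ := exists_zpow_mul_exp hρ hcont hne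
  obtain ⟨A, hA, hA1, hA2⟩ := h1 (show ρ / 2 ∈ Ioo 0 r1 from
    ⟨by positivity, by linarith [min_le_left r1 r2]⟩)
  have hmem : ∀ t, ‖circleMap 0 (ρ / 2) t‖ = ρ / 2 := by
    intro t
    rw [norm_circleMap_zero, abs_of_pos (by positivity)]
  have h3 := winding_zpow_mul_exp (m := m) (l := l) (half_pos hρ) (hl.mono (by
    intro v hv
    rw [mem_sphere_zero_iff_norm] at hv
    exact ⟨by rw [hv]; positivity, by rw [hv]; linarith⟩)) hA (fun t => by
    have e1 : circleMap (chartAt ℂ u u) (ρ / 2) t = chartAt ℂ u u + circleMap 0 (ρ / 2) t := by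
      simp [circleMap]
    have e2 := hA1 t
    rw [e1] at e2
    refine ⟨_, norm_pos_iff.mpr e2.1, ?_⟩
    rw [← hml _ (by rw [hmem]; positivity) (by rw [hmem]; linarith)]
    exact e2.2) 0
  rw [zero_add] at h3
  have h4 : 2 * Real.pi * (m : ℝ) = 2 * Real.pi * k := by linarith
  have h5 : m = k := by exact_mod_cast mul_left_cancel₀ (by positivity) h4
  subst h5
  exact ⟨ρ, l, hρ, hl, hml⟩

theorem HasIndex.eventually_not_isUmbilic {u : M} {k : ℤ} (hk : S.HasIndex u k) :
    ∀ᶠ x in 𝓝[≠] u, ¬ S.IsUmbilic x := by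
  obtain ⟨ρ, l, hρ, -, h⟩ := hk.exists_hopf_eq
  have h1 : ∀ᶠ x in 𝓝 u, chartAt ℂ u x ∈ Metric.ball (chartAt ℂ u u) ρ :=
    ((chartAt ℂ u).continuousAt (mem_chart_source ℂ u)) (Metric.ball_mem_nhds _ hρ)
  filter_upwards [nhdsWithin_le_nhds h1, nhdsWithin_le_nhds (chart_source_mem_nhds ℂ u),
    self_mem_nhdsWithin] with x hx hxs hxu
  have h2 : chartAt ℂ u x - chartAt ℂ u u ≠ 0 := by
    rw [sub_ne_zero]
    exact fun h => hxu ((chartAt ℂ u).injOn hxs (mem_chart_source ℂ u) h)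
  have h3 := h _ (norm_pos_iff.mpr h2) (mem_ball_iff_norm.mp hx)
  rw [add_sub_cancel] at h3
  rw [isUmbilic_iff_of_mem u hxs, h3]
  exact mul_ne_zero (zpow_ne_zero _ h2) (Complex.exp_ne_zero _)

/-- Near a non-umbilic point q has no zeros, so it has a logarithm on a disk and its argument
returns to its initial value. -/
theorem hasIndex_zero {u : M} (hu : ¬ S.IsUmbilic u) : S.HasIndex u 0 := by
  rw [S.isUmbilic_iff] at hu
  have hc : ContinuousAt (S.hopf u) (chartAt ℂ u u) :=
    (S.continuousOn_hopf u).continuousAt (chart_target_mem_nhds ℂ u)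
  obtain ⟨ρ, hρ, h⟩ := Metric.eventually_nhds_iff_ball.mp
    ((hc.eventually_ne hu).and (chart_target_mem_nhds ℂ u))
  obtain ⟨L, hL, hL1⟩ := ((convex_ball (chartAt ℂ u u) ρ).starConvex
    (Metric.mem_ball_self hρ)).exists_log
    ((S.continuousOn_hopf u).mono fun z hz => (h z hz).2) (fun z hz => (h z hz).1)
  filter_upwards [Ioo_mem_nhdsGT hρ] with r hr
  have hm : ∀ t, circleMap (chartAt ℂ u u) r t ∈ Metric.ball (chartAt ℂ u u) ρ := by
    intro t
    rw [mem_ball_iff_norm, circleMap_sub_center, norm_circleMap_zero, abs_of_pos hr.1]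
    exact hr.2
  refine ⟨fun t => (L (circleMap (chartAt ℂ u u) r t)).im, ?_, fun t => ⟨(h _ (hm t)).1, ?_⟩, ?_⟩
  · exact Complex.continuous_im.comp (hL.comp_continuous (continuous_circleMap _ _) hm)
  · apply eq_norm_mul_exp_of_eq (h _ (hm t)).1
    apply exp_im_mul_I_eq one_pos
    rw [hL1 _ (hm t)]
    simp
  · have : circleMap (chartAt ℂ u u) r (2 * Real.pi) = circleMap (chartAt ℂ u u) r 0 := by
      simpa using periodic_circleMap (chartAt ℂ u u) r 0
    simp [this]

theorem umbilicOrder_eq_zero {u : M} (hu : ¬ S.IsUmbilic u) : S.umbilicOrder u = 0 :=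
  (hasIndex_zero hu).umbilicOrder_eq

theorem isRegularAt_of_not_isUmbilic {u : M} (hu : ¬ S.IsUmbilic u) : S.IsRegularAt u := by
  have h0 := umbilicOrder_eq_zero hu
  rw [S.isUmbilic_iff] at hu
  have hc : ContinuousAt (S.hopf u) (chartAt ℂ u u) :=
    (S.continuousOn_hopf u).continuousAt (chart_target_mem_nhds ℂ u)
  have h1 := tendsto_div_norm hu (hc.mono_left (nhdsWithin_le_nhds (s := {chartAt ℂ u u}ᶜ)))
  refine ⟨_, h1.congr fun z => ?_⟩
  rw [h0, zpow_zero, div_one]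

end SphereSurface

theorem norm_sub_one_lt_mem_slitPlane {z : ℂ} (h : ‖z - 1‖ < 1 / 2) : z ∈ Complex.slitPlane := by
  left
  have h1 := (Complex.abs_re_le_norm (z - 1)).trans_lt h
  rw [abs_lt] at h1
  simp only [Complex.sub_re, Complex.one_re] at h1
  linarith [h1.1]

theorem convex_closedBall_inter_ball (c : ℂ) (r : ℝ) :
    Convex ℝ (Metric.closedBall (0 : ℂ) 1 ∩ Metric.ball c r) :=
  (convex_closedBall 0 1).inter (convex_ball c r)

/-- Near a point of the closed unit disk there are interior points. -/
theorem exists_ball_subset_closedBall_inter {c : ℂ} (hc : c ∈ Metric.closedBall (0 : ℂ) 1) {r : ℝ}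
    (hr : 0 < r) : ∃ (c' : ℂ) (s : ℝ), 0 < s ∧ c' ∈ Metric.ball (0 : ℂ) 1 ∩ Metric.ball c r ∧
      Metric.ball c' s ⊆ Metric.closedBall (0 : ℂ) 1 ∩ Metric.ball c r := by
  rw [mem_closedBall_zero_iff] at hc
  set s := min (r / 2) 1
  have hs : 0 < s := lt_min (by positivity) one_pos
  have hs1 : s ≤ 1 := min_le_right _ _
  have hs2 : s ≤ r / 2 := min_le_left _ _
  have h1 : ‖((1 - s : ℝ) : ℂ) * c‖ ≤ 1 - s := by
    rw [norm_mul, Complex.norm_real, Real.norm_of_nonneg (by linarith)]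
    nlinarith [norm_nonneg c]
  have h2 : ‖((1 - s : ℝ) : ℂ) * c - c‖ ≤ s := by
    have : ((1 - s : ℝ) : ℂ) * c - c = -((s : ℂ) * c) := by push_cast; ring
    rw [this, norm_neg, norm_mul, Complex.norm_real, Real.norm_of_nonneg hs.le]
    nlinarith [norm_nonneg c]
  refine ⟨((1 - s : ℝ) : ℂ) * c, s, hs, ⟨?_, ?_⟩, fun w hw => ⟨?_, ?_⟩⟩
  · rw [mem_ball_zero_iff]; linarith
  · rw [mem_ball_iff_norm]; linarith
  · rw [mem_ball_iff_norm] at hw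
    rw [mem_closedBall_zero_iff]
    have := norm_add_le (w - ((1 - s : ℝ) : ℂ) * c) (((1 - s : ℝ) : ℂ) * c)
    rw [sub_add_cancel] at this
    linarith
  · rw [mem_ball_iff_norm] at hw ⊢
    have := norm_add_le (w - ((1 - s : ℝ) : ℂ) * c) (((1 - s : ℝ) : ℂ) * c - c)
    rw [sub_add_sub_cancel] at this
    linarith

/-! ### The polygon in local coordinates and the degree of its parametrisation. -/

namespace CurvatureLinePolygon

variable {M : Type*} [TopologicalSpace M] [ChartedSpace ℂ M] {S : SphereSurface M} {p : ℕ}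
  (P : CurvatureLinePolygon S p)

/-- The coordinate at `c` of the point with parameter `w`. -/
noncomputable def coord (c w : ℂ) : ℂ := chartAt ℂ (P.Φ c) (P.Φ w)

/-- The secant of the surface between two points of the disk, compared with the difference of
their coordinates at `c`. -/
noncomputable def ratio (c x y : ℂ) : ℂ :=
  S.secant (P.Φ c) (P.coord c x) (S.f (P.Φ y) - S.f (P.Φ x)) / (P.coord c y - P.coord c x)

/-- The secant at a point of the disk in its own coordinate. -/
noncomputable def selfSecant (x y : ℂ) : ℂ :=
  S.secant (P.Φ x) (P.coord x x) (S.f (P.Φ y) - S.f (P.Φ x))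

/-- Secants from `x` turn `d` times around `0`. -/
def HasSecantDegree (x : ℂ) (d : ℤ) : Prop :=
  ∃ (ρ : ℝ) (m : ℂ → ℂ), 0 < ρ ∧ ContinuousOn m {v | 0 < ‖v‖ ∧ ‖v‖ < ρ} ∧
    ∀ v, 0 < ‖v‖ → ‖v‖ < ρ → P.selfSecant x (x + v) = v ^ d * Complex.exp (m v)

/-- On the disk of radius `r` about `c` the coordinate at `c` is defined and secants are close to
differences of coordinates. -/
structure IsLocal (c : ℂ) (r : ℝ) : Prop where
  pos : 0 < r
  mapsTo : MapsTo P.Φ (Metric.closedBall 0 1 ∩ Metric.ball c r) (chartAt ℂ (P.Φ c)).source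
  ratio : ∀ x ∈ Metric.closedBall (0 : ℂ) 1 ∩ Metric.ball c r,
    ∀ y ∈ Metric.closedBall (0 : ℂ) 1 ∩ Metric.ball c r, x ≠ y → ‖P.ratio c x y - 1‖ < 1 / 2

variable {P}

theorem HasSecantDegree.unique {x : ℂ} {d d' : ℤ} (h : P.HasSecantDegree x d)
    (h' : P.HasSecantDegree x d') : d = d' := by
  obtain ⟨ρ, m, hρ, hm, h1⟩ := h
  obtain ⟨ρ', m', hρ', hm', h1'⟩ := h'
  refine zpow_mul_exp_unique (lt_min hρ hρ') (hm.mono fun v hv => ⟨hv.1, hv.2.trans_le (min_le_left _ _)⟩)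
    (hm'.mono fun v hv => ⟨hv.1, hv.2.trans_le (min_le_right _ _)⟩) fun v hv hv' => ?_
  rw [← h1 v hv (hv'.trans_le (min_le_left _ _)), ← h1' v hv (hv'.trans_le (min_le_right _ _))]

namespace IsLocal

variable {c : ℂ} {r : ℝ}

theorem continuousOn_coord (h : P.IsLocal c r) : ContinuousOn (P.coord c) (Metric.closedBall 0 1 ∩ Metric.ball c r) :=
  (chartAt ℂ (P.Φ c)).continuousOn.comp (P.continuousOn.mono inter_subset_left) h.mapsTo

theorem injOn_coord (h : P.IsLocal c r) : InjOn (P.coord c) (Metric.closedBall 0 1 ∩ Metric.ball c r) :=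
  fun _ hx _ hy hxy => P.injOn hx.1 hy.1
    ((chartAt ℂ (P.Φ c)).injOn (h.mapsTo hx) (h.mapsTo hy) hxy)

theorem secant_eq (h : P.IsLocal c r) {x y : ℂ} (hx : x ∈ Metric.closedBall (0 : ℂ) 1 ∩ Metric.ball c r)
    (hy : y ∈ Metric.closedBall (0 : ℂ) 1 ∩ Metric.ball c r) (hxy : x ≠ y) :
    S.secant (P.Φ c) (P.coord c x) (S.f (P.Φ y) - S.f (P.Φ x)) =
      P.ratio c x y * (P.coord c y - P.coord c x) := by
  have : P.coord c y - P.coord c x ≠ 0 := sub_ne_zero.mpr fun h' => hxy (h.injOn_coord hy hx h').symm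
  rw [CurvatureLinePolygon.ratio]
  field_simp

theorem coord_mem_target (h : P.IsLocal c r) {x : ℂ} (hx : x ∈ Metric.closedBall (0 : ℂ) 1 ∩ Metric.ball c r) :
    P.coord c x ∈ (chartAt ℂ (P.Φ c)).target := (chartAt ℂ (P.Φ c)).map_source (h.mapsTo hx)

theorem ratio_ne_zero (h : P.IsLocal c r) {x y : ℂ} (hx : x ∈ Metric.closedBall (0 : ℂ) 1 ∩ Metric.ball c r)
    (hy : y ∈ Metric.closedBall (0 : ℂ) 1 ∩ Metric.ball c r) (hxy : x ≠ y) :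
    P.ratio c x y ≠ 0 := by
  have := h.ratio x hx y hy hxy
  intro h0
  rw [h0] at this
  norm_num at this

variable [IsManifold 𝓘(ℂ) ω M]

theorem continuousOn_secant (h : P.IsLocal c r) : ContinuousOn (fun q : ℂ × ℂ =>
    S.secant (P.Φ c) (P.coord c q.1) (S.f (P.Φ q.2) - S.f (P.Φ q.1)))
    ((Metric.closedBall 0 1 ∩ Metric.ball c r) ×ˢ Metric.closedBall 0 1) := by
  have h1 : ContinuousOn (fun q : ℂ × ℂ => P.coord c q.1)
      ((Metric.closedBall 0 1 ∩ Metric.ball c r) ×ˢ Metric.closedBall 0 1) :=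
    h.continuousOn_coord.comp continuousOn_fst fun q hq => hq.1
  have hf := S.smooth_f.continuous
  have h2 : ContinuousOn (fun q : ℂ × ℂ => S.f (P.Φ q.2) - S.f (P.Φ q.1))
      ((Metric.closedBall 0 1 ∩ Metric.ball c r) ×ˢ Metric.closedBall 0 1) :=
    (hf.comp_continuousOn (P.continuousOn.comp continuousOn_snd fun q hq => hq.2)).sub
      (hf.comp_continuousOn (P.continuousOn.comp continuousOn_fst fun q hq => hq.1.1))
  have h3 : MapsTo (fun q : ℂ × ℂ => (P.coord c q.1, S.f (P.Φ q.2) - S.f (P.Φ q.1)))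
      ((Metric.closedBall 0 1 ∩ Metric.ball c r) ×ˢ Metric.closedBall 0 1)
      ((chartAt ℂ (P.Φ c)).target ×ˢ univ) := fun q hq => mk_mem_prod (h.coord_mem_target hq.1) (mem_univ _)
  have h4 := ContinuousOn.comp (S.continuousOn_secant (P.Φ c)) (h1.prodMk h2) h3
  exact h4.congr fun q _ => rfl

theorem continuousOn_ratio (h : P.IsLocal c r) : ContinuousOn (fun q : ℂ × ℂ => P.ratio c q.1 q.2)
    {q | q.1 ∈ Metric.closedBall (0 : ℂ) 1 ∩ Metric.ball c r ∧
      q.2 ∈ Metric.closedBall (0 : ℂ) 1 ∩ Metric.ball c r ∧ q.1 ≠ q.2} := by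
  refine ContinuousOn.div (h.continuousOn_secant.mono fun q hq => ⟨hq.1, hq.2.1.1⟩)
    (ContinuousOn.sub (h.continuousOn_coord.comp continuousOn_snd fun q hq => hq.2.1)
      (h.continuousOn_coord.comp continuousOn_fst fun q hq => hq.1)) ?_
  intro q hq
  exact sub_ne_zero.mpr fun h' => hq.2.2 (h.injOn_coord hq.2.1 hq.1 h').symm

/-- τ comes from the change between the chart at Φ c and the chart at Φ x and does not depend on y,
so secants from x turn as the coordinate differences at c do. -/
theorem exists_selfSecant_eq (h : P.IsLocal c r) {x : ℂ} (hx : x ∈ Metric.closedBall (0 : ℂ) 1 ∩ Metric.ball c r) :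
    ∃ τ : ℂ, τ ≠ 0 ∧ ∀ y ∈ Metric.closedBall (0 : ℂ) 1 ∩ Metric.ball c r, x ≠ y →
      P.selfSecant x y = τ * (P.ratio c x y * (P.coord c y - P.coord c x)) := by
  obtain ⟨τ, hτ, -, h2⟩ := S.exists_transition_hopf (P.Φ c) (P.Φ x) (P.Φ x) (h.mapsTo hx)
    (mem_chart_source ℂ _)
  refine ⟨τ, hτ, fun y hy hxy => ?_⟩
  rw [← h.secant_eq hx hy hxy]
  exact h2 _

/-- The constant τ and the ratio, which stays within 1/2 of 1, have continuous logarithms; only the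
coordinate difference contributes turning. This expresses the degree at x without reference to c. -/
theorem hasSecantDegree (h : P.IsLocal c r) {d : ℤ} {μ : ℂ × ℂ → ℂ}
    (hμ : IsSecantLog (Metric.closedBall 0 1 ∩ Metric.ball c r) (P.coord c) d μ) {x : ℂ}
    (hx : x ∈ Metric.ball (0 : ℂ) 1 ∩ Metric.ball c r) : P.HasSecantDegree x d := by
  obtain ⟨ρ, hρ, hρx⟩ := Metric.isOpen_iff.mp (Metric.isOpen_ball.inter Metric.isOpen_ball) x hx
  have hx' : x ∈ Metric.closedBall (0 : ℂ) 1 ∩ Metric.ball c r :=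
    ⟨Metric.ball_subset_closedBall hx.1, hx.2⟩
  have hmem : ∀ v : ℂ, ‖v‖ < ρ → x + v ∈ Metric.closedBall (0 : ℂ) 1 ∩ Metric.ball c r := by
    intro v hv
    have := hρx (show x + v ∈ Metric.ball x ρ by simpa using hv)
    exact ⟨Metric.ball_subset_closedBall this.1, this.2⟩
  have hne : ∀ v : ℂ, 0 < ‖v‖ → x ≠ x + v := by
    intro v hv h0
    simp only [left_eq_add] at h0
    simp [h0] at hv
  obtain ⟨τ, hτ, h1⟩ := h.exists_selfSecant_eq hx'
  refine ⟨ρ, fun v => Complex.log τ + Complex.log (P.ratio c x (x + v)) + μ (x, x + v), hρ, ?_, ?_⟩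
  · refine (continuousOn_const.add ?_).add (hμ.continuousOn.comp (by fun_prop) ?_)
    · refine ContinuousOn.clog ?_ fun v hv =>
        norm_sub_one_lt_mem_slitPlane (h.ratio x hx' _ (hmem v hv.2) (hne v hv.1))
      exact h.continuousOn_ratio.comp (f := fun v => (x, x + v)) (by fun_prop)
        fun v hv => ⟨hx', hmem v hv.2, hne v hv.1⟩
    · exact fun v hv => ⟨hx', hmem v hv.2, hne v hv.1⟩
  · intro v hv hv'
    rw [h1 _ (hmem v hv') (hne v hv), hμ.eq x hx' _ (hmem v hv') (hne v hv), Complex.exp_add,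
      Complex.exp_add, Complex.exp_log hτ,
      Complex.exp_log (h.ratio_ne_zero hx' (hmem v hv') (hne v hv)), add_sub_cancel_left]
    ring

end IsLocal

variable (P)

theorem tendsto_coord {c : ℂ} (hc : c ∈ Metric.closedBall (0 : ℂ) 1) :
    Filter.Tendsto (P.coord c) (𝓝[Metric.closedBall 0 1] c) (𝓝 (P.coord c c)) :=
  ((chartAt ℂ (P.Φ c)).continuousAt (mem_chart_source ℂ _)).tendsto.comp (P.continuousOn c hc)

variable [IsManifold 𝓘(ℂ) ω M]

theorem tendsto_ratio {c : ℂ} (hc : c ∈ Metric.closedBall (0 : ℂ) 1) :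
    Filter.Tendsto (fun q : ℂ × ℂ => P.ratio c q.1 q.2)
      (𝓝[{q | q.1 ∈ Metric.closedBall (0 : ℂ) 1 ∧ q.2 ∈ Metric.closedBall (0 : ℂ) 1 ∧ q.1 ≠ q.2}]
        (c, c)) (𝓝 1) := by
  set T := {q : ℂ × ℂ |
    q.1 ∈ Metric.closedBall (0 : ℂ) 1 ∧ q.2 ∈ Metric.closedBall (0 : ℂ) 1 ∧ q.1 ≠ q.2}
  have hfst : Filter.Tendsto Prod.fst (𝓝[T] (c, c)) (𝓝[Metric.closedBall (0 : ℂ) 1] c) :=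
    tendsto_nhdsWithin_iff.mpr ⟨(continuous_fst.tendsto (c, c)).mono_left nhdsWithin_le_nhds,
      by filter_upwards [self_mem_nhdsWithin] with q hq using hq.1⟩
  have hsnd : Filter.Tendsto Prod.snd (𝓝[T] (c, c)) (𝓝[Metric.closedBall (0 : ℂ) 1] c) :=
    tendsto_nhdsWithin_iff.mpr ⟨(continuous_snd.tendsto (c, c)).mono_left nhdsWithin_le_nhds,
      by filter_upwards [self_mem_nhdsWithin] with q hq using hq.2.1⟩
  have hsrc : ∀ᶠ w in 𝓝[Metric.closedBall (0 : ℂ) 1] c, P.Φ w ∈ (chartAt ℂ (P.Φ c)).source :=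
    (P.continuousOn c hc) (chart_source_mem_nhds ℂ (P.Φ c))
  have h1 : Filter.Tendsto (fun q : ℂ × ℂ => (P.coord c q.1, P.coord c q.2)) (𝓝[T] (c, c))
      (𝓝[{q | q.1 ≠ q.2}] (P.coord c c, P.coord c c)) := by
    refine tendsto_nhdsWithin_iff.mpr ⟨?_, ?_⟩
    · exact ((P.tendsto_coord hc).comp hfst).prodMk_nhds ((P.tendsto_coord hc).comp hsnd)
    · filter_upwards [self_mem_nhdsWithin, hfst.eventually hsrc, hsnd.eventually hsrc]
        with q hq h1 h2 h3
      exact hq.2.2 (P.injOn hq.1 hq.2.1 ((chartAt ℂ (P.Φ c)).injOn h1 h2 h3))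
  refine ((S.tendsto_secant_div (P.Φ c) (mem_chart_target ℂ _)).comp h1).congr' ?_
  filter_upwards [hfst.eventually hsrc, hsnd.eventually hsrc] with q h1 h2
  have e1 : S.fc (P.Φ c) (P.coord c q.1) = S.f (P.Φ q.1) :=
    congrArg S.f ((chartAt ℂ (P.Φ c)).left_inv h1)
  have e2 : S.fc (P.Φ c) (P.coord c q.2) = S.f (P.Φ q.2) :=
    congrArg S.f ((chartAt ℂ (P.Φ c)).left_inv h2)
  simp only [Function.comp, ratio, e1, e2]

theorem exists_isLocal {c : ℂ} (hc : c ∈ Metric.closedBall (0 : ℂ) 1) : ∃ r, P.IsLocal c r := by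
  have h1 := (Metric.tendsto_nhds.mp (P.tendsto_ratio hc)) (1 / 2) (by norm_num)
  rw [eventually_nhdsWithin_iff, Metric.eventually_nhds_iff_ball] at h1
  obtain ⟨r1, hr1, h1⟩ := h1
  have h2 : ∀ᶠ w in 𝓝[Metric.closedBall (0 : ℂ) 1] c, P.Φ w ∈ (chartAt ℂ (P.Φ c)).source :=
    (P.continuousOn c hc) (chart_source_mem_nhds ℂ (P.Φ c))
  rw [eventually_nhdsWithin_iff, Metric.eventually_nhds_iff_ball] at h2
  obtain ⟨r2, hr2, h2⟩ := h2
  refine ⟨min r1 r2, lt_min hr1 hr2, fun w hw => h2 w ?_ hw.1, fun x hx y hy hxy => ?_⟩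
  · exact Metric.ball_subset_ball (min_le_right _ _) hw.2
  · rw [← dist_eq_norm]
    refine h1 (x, y) ?_ ⟨hx.1, hy.1, hxy⟩
    rw [← ball_prod_same]
    exact ⟨Metric.ball_subset_ball (min_le_left _ _) hx.2,
      Metric.ball_subset_ball (min_le_left _ _) hy.2⟩

/-- The orientation of the parametrisation: the degree of the coordinates at all points. -/
theorem exists_degree : ∃ d : ℤ, (∀ x ∈ Metric.ball (0 : ℂ) 1, P.HasSecantDegree x d) ∧
    ∀ c ∈ Metric.closedBall (0 : ℂ) 1, ∃ (r : ℝ) (μ : ℂ × ℂ → ℂ), P.IsLocal c r ∧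
      IsSecantLog (Metric.closedBall 0 1 ∩ Metric.ball c r) (P.coord c) d μ := by
  have key : ∀ c ∈ Metric.closedBall (0 : ℂ) 1, ∃ (r : ℝ) (d : ℤ) (μ : ℂ × ℂ → ℂ), P.IsLocal c r ∧
      IsSecantLog (Metric.closedBall 0 1 ∩ Metric.ball c r) (P.coord c) d μ := by
    intro c hc
    obtain ⟨r, hr⟩ := P.exists_isLocal hc
    obtain ⟨c', s, hs, -, hsub⟩ := exists_ball_subset_closedBall_inter hc hr.pos
    obtain ⟨d, μ, hμ⟩ := (convex_closedBall_inter_ball c r).exists_isSecantLog hs hsub (C := 1)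
      (fun x hx => by simpa using hx.1) hr.continuousOn_coord hr.injOn_coord
    exact ⟨r, d, μ, hr, hμ⟩
  choose! r D μ hr hμ using key
  have hD : ∀ c ∈ Metric.closedBall (0 : ℂ) 1, ∀ x ∈ Metric.ball (0 : ℂ) 1 ∩ Metric.ball c (r c),
      P.HasSecantDegree x (D c) := fun c hc x hx => (hr c hc).hasSecantDegree (hμ c hc) hx
  have hself : ∀ x ∈ Metric.ball (0 : ℂ) 1, P.HasSecantDegree x (D x) := fun x hx =>
    hD x (Metric.ball_subset_closedBall hx) x
      ⟨hx, Metric.mem_ball_self (hr x (Metric.ball_subset_closedBall hx)).pos⟩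
  -- The degree at y is intrinsic, so local disks with different centres that contain y assign it
  -- the same integer, and `D` is locally constant.
  have hcont : ContinuousOn D (Metric.ball 0 1) := by
    intro x hx
    have hx' := Metric.ball_subset_closedBall hx
    refine (continuousWithinAt_const (b := D x)).congr_of_eventuallyEq ?_ rfl
    filter_upwards [self_mem_nhdsWithin,
      nhdsWithin_le_nhds (Metric.ball_mem_nhds x (hr x hx').pos)] with y hy hyx
    exact (hself y hy).unique (hD x hx' y ⟨hy, hyx⟩)
  have hconst : ∀ x ∈ Metric.ball (0 : ℂ) 1, D x = D 0 := fun x hx =>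
    (convex_ball (0 : ℂ) 1).isPreconnected.constant hcont hx (Metric.mem_ball_self one_pos)
  refine ⟨D 0, fun x hx => hconst x hx ▸ hself x hx, fun c hc => ⟨r c, μ c, hr c hc, ?_⟩⟩
  obtain ⟨c', s, hs, hc', -⟩ := exists_ball_subset_closedBall_inter hc (hr c hc).pos
  -- A boundary point inherits the degree from interior points of its local disk.
  have : D c = D 0 := by
    rw [← hconst c' hc'.1]
    exact (hD c hc c' hc').unique (hself c' hc'.1)
  rw [← this]
  exact hμ c hc

/-- δ is a Lebesgue number of the cover by local disks: a pair closer than δ lies in one of them,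
where chords and coordinate differences vanish together. -/
theorem exists_selfSecant_ne_zero : ∃ δ : ℝ, 0 < δ ∧ ∀ x ∈ Metric.closedBall (0 : ℂ) 1,
    ∀ y ∈ Metric.closedBall (0 : ℂ) 1, x ≠ y → ‖y - x‖ < δ → P.selfSecant x y ≠ 0 := by
  have key := fun c : Metric.closedBall (0 : ℂ) 1 => P.exists_isLocal c.2
  choose r hr using key
  obtain ⟨δ, hδ, h⟩ := lebesgue_number_lemma_of_metric (isCompact_closedBall (0 : ℂ) 1)
    (c := fun c : Metric.closedBall (0 : ℂ) 1 => Metric.ball (c : ℂ) (r c))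
    (fun c => Metric.isOpen_ball)
    (fun c hc => mem_iUnion.mpr ⟨⟨c, hc⟩, Metric.mem_ball_self (hr _).pos⟩)
  refine ⟨δ, hδ, fun x hx y hy hxy hyx => ?_⟩
  obtain ⟨c, hc⟩ := h x hx
  have hx' : x ∈ Metric.closedBall (0 : ℂ) 1 ∩ Metric.ball (c : ℂ) (r c) :=
    ⟨hx, hc (Metric.mem_ball_self hδ)⟩
  have hy' : y ∈ Metric.closedBall (0 : ℂ) 1 ∩ Metric.ball (c : ℂ) (r c) :=
    ⟨hy, hc (mem_ball_iff_norm.mpr hyx)⟩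
  obtain ⟨τ, hτ, h1⟩ := (hr c).exists_selfSecant_eq hx'
  rw [h1 y hy' hxy]
  exact mul_ne_zero hτ (mul_ne_zero ((hr c).ratio_ne_zero hx' hy' hxy)
    (sub_ne_zero.mpr fun h' => hxy ((hr c).injOn_coord hy' hx' h').symm))

/-- Puts umbilics and ordinary points on the same footing: at an ordinary point the order and the
index are 0. -/
theorem hasIndex {w : ℂ} (hw : w ∈ Metric.closedBall (0 : ℂ) 1) :
    S.HasIndex (P.Φ w) (S.umbilicOrder (P.Φ w)) := by
  by_cases h : S.IsUmbilic (P.Φ w)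
  · obtain ⟨-, -, k, -, hk⟩ := P.star w hw h
    rwa [hk.umbilicOrder_eq]
  · rw [SphereSurface.umbilicOrder_eq_zero h]
    exact SphereSurface.hasIndex_zero h

theorem isRegularAt {w : ℂ} (hw : w ∈ Metric.sphere (0 : ℂ) 1) : S.IsRegularAt (P.Φ w) := by
  by_cases h : S.IsUmbilic (P.Φ w)
  · exact P.regular w hw h
  · exact SphereSurface.isRegularAt_of_not_isUmbilic h

/-- Every point of the polygon has an index, hence a punctured neighbourhood without umbilics, while
infinitely many umbilic parameters would accumulate in the compact disk. -/
theorem finite_isUmbilic : {w ∈ Metric.closedBall (0 : ℂ) 1 | S.IsUmbilic (P.Φ w)}.Finite := by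
  by_contra hinf
  obtain ⟨c, hc, hacc⟩ := Set.Infinite.exists_accPt_of_subset_isCompact hinf
    (isCompact_closedBall (0 : ℂ) 1) (fun w hw => hw.1)
  rw [accPt_iff_frequently_nhdsNE] at hacc
  apply hacc
  have h1 : Filter.Tendsto P.Φ (𝓝[Metric.closedBall (0 : ℂ) 1 \ {c}] c) (𝓝[≠] (P.Φ c)) := by
    refine tendsto_nhdsWithin_iff.mpr ⟨(P.continuousOn c hc).mono_left
      (nhdsWithin_mono _ sdiff_subset), ?_⟩
    filter_upwards [self_mem_nhdsWithin] with w hw h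
    exact hw.2 (P.injOn hw.1 hc h)
  have h2 := h1.eventually (P.hasIndex hc).eventually_not_isUmbilic
  rw [eventually_nhdsWithin_iff] at h2 ⊢
  filter_upwards [h2] with w hw hwc hwu
  exact hw ⟨hwu.1, hwc⟩ hwu.2

end CurvatureLinePolygon

theorem zpow_finsetSum {ι : Type*} {x : ℂ} (hx : x ≠ 0) (A : Finset ι) (f : ι → ℤ) :
    x ^ (∑ a ∈ A, f a) = ∏ a ∈ A, x ^ f a := by
  classical
  induction A using Finset.induction_on with
  | empty => simp
  | insert a A haA ih => rw [Finset.sum_insert haA, Finset.prod_insert haA, zpow_add₀ hx, ih]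

/-! ### Winding of the secant form along an interior circle. -/

namespace CurvatureLinePolygon

variable {M : Type*} [TopologicalSpace M] [ChartedSpace ℂ M] {S : SphereSurface M} {p : ℕ}
  (P : CurvatureLinePolygon S p)

/-- The Hopf differential on secants, in terms of the parameters. -/
noncomputable def secantForm (x y : ℂ) : ℂ := S.hopfSecant (P.Φ x) (P.Φ y)

theorem secantForm_eq (x y : ℂ) :
    P.secantForm x y = S.hopf (P.Φ x) (P.coord x x) * P.selfSecant x y ^ 2 := rfl

variable [IsManifold 𝓘(ℂ) ω M]

theorem continuousOn_secantForm : ContinuousOn (fun q : ℂ × ℂ => P.secantForm q.1 q.2)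
    (Metric.closedBall 0 1 ×ˢ Metric.closedBall 0 1) := by
  have h1 : ContinuousOn (fun q : ℂ × ℂ => (P.Φ q.1, P.Φ q.2))
      (Metric.closedBall 0 1 ×ˢ Metric.closedBall 0 1) :=
    (P.continuousOn.comp continuousOn_fst fun q hq => hq.1).prodMk
      (P.continuousOn.comp continuousOn_snd fun q hq => hq.2)
  have h2 := S.continuous_hopfSecant.comp_continuousOn h1
  exact h2.congr fun q _ => rfl

theorem secantForm_ne_zero {x y : ℂ} (hx : ¬ S.IsUmbilic (P.Φ x)) (h : P.selfSecant x y ≠ 0) :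
    P.secantForm x y ≠ 0 := by
  rw [S.isUmbilic_iff] at hx
  exact mul_ne_zero hx (pow_ne_zero 2 h)

variable {P}

/-- Extends the factorisation to every punctured disk in which the secant does not vanish; the
exponent cannot change because it is determined near x. -/
theorem HasSecantDegree.exists_selfSecant_eq {x : ℂ} {d : ℤ} (h : P.HasSecantDegree x d) {ρ : ℝ}
    (hρ : 0 < ρ) (hρ1 : ‖x‖ + ρ ≤ 1)
    (h0 : ∀ v, 0 < ‖v‖ → ‖v‖ < ρ → P.selfSecant x (x + v) ≠ 0) :
    ∃ m : ℂ → ℂ, ContinuousOn m {v | 0 < ‖v‖ ∧ ‖v‖ < ρ} ∧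
      ∀ v, 0 < ‖v‖ → ‖v‖ < ρ → P.selfSecant x (x + v) = v ^ d * Complex.exp (m v) := by
  have hc : ContinuousOn (fun v => P.selfSecant x (x + v)) {v | 0 < ‖v‖ ∧ ‖v‖ < ρ} := by
    have h1 : ContinuousOn (fun v => P.Φ (x + v)) {v | 0 < ‖v‖ ∧ ‖v‖ < ρ} := by
      refine P.continuousOn.comp (by fun_prop) ?_
      intro v hv
      rw [mem_closedBall_zero_iff]
      linarith [norm_add_le x v, hv.2]
    have h2 : ContinuousOn (fun v => (P.coord x x, S.f (P.Φ (x + v)) - S.f (P.Φ x)))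
        {v | 0 < ‖v‖ ∧ ‖v‖ < ρ} :=
      continuousOn_const.prodMk ((S.smooth_f.continuous.comp_continuousOn h1).sub continuousOn_const)
    have h3 : MapsTo (fun v => (P.coord x x, S.f (P.Φ (x + v)) - S.f (P.Φ x)))
        {v | 0 < ‖v‖ ∧ ‖v‖ < ρ} ((chartAt ℂ (P.Φ x)).target ×ˢ univ) :=
      fun v _ => mk_mem_prod (mem_chart_target ℂ _) (mem_univ _)
    have h4 := ContinuousOn.comp (S.continuousOn_secant (P.Φ x)) h2 h3
    exact h4.congr fun q _ => rfl
  obtain ⟨m, l, hl, hml⟩ := exists_zpow_mul_exp hρ hc h0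
  have : m = d := HasSecantDegree.unique ⟨ρ, l, hρ, hl, hml⟩ h
  subst this
  exact ⟨l, hl, hml⟩

/-- The form of `secantForm` near an interior point, for secants with fixed parameter shift. -/
theorem exists_secantForm_eq {a v : ℂ} {r : ℝ} {d : ℤ} {μ : ℂ × ℂ → ℂ}
    (ha : a ∈ Metric.ball (0 : ℂ) 1) (hav : a + v ∈ Metric.ball (0 : ℂ) 1) (hr : P.IsLocal a r)
    (hμ : IsSecantLog (Metric.closedBall 0 1 ∩ Metric.ball a r) (P.coord a) d μ)
    (h0 : P.selfSecant a (a + v) ≠ 0) :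
    ∃ (ρ : ℝ) (g : ℂ → ℂ), 0 < ρ ∧ ContinuousOn g {h | 0 < ‖h‖ ∧ ‖h‖ < ρ} ∧
      ∀ h, 0 < ‖h‖ → ‖h‖ < ρ → P.secantForm (a + h) (a + h + v) =
        h ^ (d * S.umbilicOrder (P.Φ a)) * Complex.exp (g h) := by
  have ha' := Metric.ball_subset_closedBall ha
  have haN : a ∈ Metric.closedBall (0 : ℂ) 1 ∩ Metric.ball a r := ⟨ha', Metric.mem_ball_self hr.pos⟩
  obtain ⟨ρ', l, hρ', hl, hhopf⟩ := (P.hasIndex ha').exists_hopf_eq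
  set k := S.umbilicOrder (P.Φ a)
  set s : ℂ → ℂ := fun h =>
    S.secant (P.Φ a) (P.coord a (a + h)) (S.f (P.Φ (a + h + v)) - S.f (P.Φ (a + h))) with hs
  have hs0 : s 0 = P.selfSecant a (a + v) := by simp [hs, selfSecant]
  have hT : ∀ᶠ h : ℂ in 𝓝 0, a + h ∈ Metric.ball (0 : ℂ) 1 ∩ Metric.ball a r ∧
      a + h + v ∈ Metric.ball (0 : ℂ) 1 := by
    have h1 : Filter.Tendsto (fun h : ℂ => a + h) (𝓝 0) (𝓝 a) := by
      have : ContinuousAt (fun h : ℂ => a + h) 0 := by fun_prop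
      simpa [ContinuousAt] using this
    have h2 : Filter.Tendsto (fun h : ℂ => a + h + v) (𝓝 0) (𝓝 (a + v)) := h1.add_const v
    exact (h1.eventually ((Metric.isOpen_ball.inter Metric.isOpen_ball).mem_nhds
      ⟨ha, Metric.mem_ball_self hr.pos⟩)).and (h2.eventually (Metric.isOpen_ball.mem_nhds hav))
  obtain ⟨ρ1, hρ1, hT⟩ := Metric.eventually_nhds_iff_ball.mp hT
  have hN : ∀ h ∈ Metric.ball (0 : ℂ) ρ1, a + h ∈ Metric.closedBall (0 : ℂ) 1 ∩ Metric.ball a r :=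
    fun h hh => ⟨Metric.ball_subset_closedBall (hT h hh).1.1, (hT h hh).1.2⟩
  have hscont : ContinuousOn s (Metric.ball 0 ρ1) := by
    have h1 : ContinuousOn (fun h : ℂ => (a + h, a + h + v)) (Metric.ball 0 ρ1) := by fun_prop
    have h2 : MapsTo (fun h : ℂ => (a + h, a + h + v)) (Metric.ball 0 ρ1)
        ((Metric.closedBall 0 1 ∩ Metric.ball a r) ×ˢ Metric.closedBall 0 1) :=
      fun h hh => ⟨hN h hh, Metric.ball_subset_closedBall (hT h hh).2⟩
    have h3 := ContinuousOn.comp hr.continuousOn_secant h1 h2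
    exact h3.congr fun q _ => rfl
  have hccont : ContinuousOn (fun h => P.coord a (a + h)) (Metric.ball 0 ρ1) :=
    hr.continuousOn_coord.comp (by fun_prop) hN
  have hev : ∀ᶠ h in 𝓝 (0 : ℂ), ‖P.coord a (a + h) - P.coord a a‖ < ρ' ∧ ‖s h / s 0 - 1‖ < 1 / 2 := by
    have h00 := Metric.ball_mem_nhds (0 : ℂ) hρ1
    have h1 : ContinuousAt (fun h => ‖P.coord a (a + h) - P.coord a a‖) 0 :=
      ((hccont.continuousAt h00).sub continuousAt_const).norm
    have h2 : ContinuousAt (fun h => ‖s h / s 0 - 1‖) 0 :=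
      (((hscont.continuousAt h00).div_const _).sub continuousAt_const).norm
    refine Filter.Eventually.and (h1 (Iio_mem_nhds ?_)) (h2 (Iio_mem_nhds ?_))
    · simpa using hρ'
    · have : s 0 ≠ 0 := by rwa [hs0]
      simp [div_self this]
  obtain ⟨ρ2, hρ2, hev⟩ := Metric.eventually_nhds_iff_ball.mp hev
  have hb : ∀ h : ℂ, ‖h‖ < min ρ1 ρ2 → h ∈ Metric.ball 0 ρ1 ∧ h ∈ Metric.ball 0 ρ2 := by
    intro h hh
    rw [mem_ball_zero_iff, mem_ball_zero_iff]
    exact ⟨hh.trans_le (min_le_left _ _), hh.trans_le (min_le_right _ _)⟩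
  have hne : ∀ h : ℂ, 0 < ‖h‖ → a ≠ a + h := by
    intro h hh h0
    simp only [left_eq_add] at h0
    simp [h0] at hh
  have hdiff : ∀ h : ℂ, 0 < ‖h‖ → ‖h‖ < min ρ1 ρ2 →
      0 < ‖P.coord a (a + h) - P.coord a a‖ := by
    intro h hh hh'
    rw [norm_pos_iff, sub_ne_zero]
    exact fun h' => hne h hh (hr.injOn_coord (hN h (hb h hh').1) haN h').symm
  refine ⟨min ρ1 ρ2, fun h => k * μ (a, a + h) + l (P.coord a (a + h) - P.coord a a) +
    2 * (Complex.log (s 0) + Complex.log (s h / s 0)), lt_min hρ1 hρ2, ?_, ?_⟩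
  · have hsub : {h : ℂ | 0 < ‖h‖ ∧ ‖h‖ < min ρ1 ρ2} ⊆ Metric.ball 0 ρ1 :=
      fun h hh => (hb h hh.2).1
    refine ((continuousOn_const.mul (hμ.continuousOn.comp (by fun_prop) ?_)).add
      (hl.comp ((hccont.mono hsub).sub continuousOn_const) ?_)).add
      (continuousOn_const.mul (continuousOn_const.add
        (((hscont.mono hsub).div_const _).clog ?_)))
    · exact fun h hh => ⟨haN, hN h (hb h hh.2).1, hne h hh.1⟩
    · exact fun h hh => ⟨hdiff h hh.1 hh.2, (hev h (hb h hh.2).2).1⟩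
    · exact fun h hh => norm_sub_one_lt_mem_slitPlane (hev h (hb h hh.2).2).2
  · intro h hh hh'
    have hN1 := hN h (hb h hh').1
    have hev1 := hev h (hb h hh').2
    -- In the chart at `a`, q is z^k times an exponential and z is h^d times an exponential, which
    -- explains the exponent dk; the secant stays near its nonzero value at h = 0 and adds no
    -- winding.
    have e1 : P.secantForm (a + h) (a + h + v) = S.hopf (P.Φ a) (P.coord a (a + h)) * s h ^ 2 :=
      S.hopfSecant_eq (P.Φ a) _ _ (hr.mapsTo hN1)
    have e2 := hhopf _ (hdiff h hh hh') hev1.1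
    have e3 : chartAt ℂ (P.Φ a) (P.Φ a) + (P.coord a (a + h) - P.coord a a) = P.coord a (a + h) :=
      add_sub_cancel _ _
    have e4 := hμ.eq a haN _ hN1 (hne h hh)
    rw [e3] at e2
    have e5 : s 0 ≠ 0 := by rwa [hs0]
    have e6 : s h / s 0 ≠ 0 := by
      intro h'
      have := hev1.2
      rw [h'] at this
      norm_num at this
    have e7 : Complex.exp (2 * (Complex.log (s 0) + Complex.log (s h / s 0))) = s h ^ 2 := by
      rw [two_mul, Complex.exp_add, Complex.exp_add, Complex.exp_log e5, Complex.exp_log e6]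
      field_simp
    rw [e1, e2, Complex.exp_add, Complex.exp_add, e7, Complex.exp_int_mul]
    nth_rw 1 [e4]
    rw [add_sub_cancel_left, mul_zpow, zpow_mul]
    ring

variable (P)

/-- The argument of `secantForm` along a circle enclosing all interior umbilics. -/
theorem winding_secantForm {d : ℤ} (hd : ∀ x ∈ Metric.ball (0 : ℂ) 1, P.HasSecantDegree x d)
    (hloc : ∀ c ∈ Metric.closedBall (0 : ℂ) 1, ∃ (r : ℝ) (μ : ℂ × ℂ → ℂ), P.IsLocal c r ∧
      IsSecantLog (Metric.closedBall 0 1 ∩ Metric.ball c r) (P.coord c) d μ)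
    {A : Finset ℂ} {R : ℝ} (hR : 0 < R) (hR1 : R < 1)
    (hA : ∀ a ∈ Metric.ball (0 : ℂ) 1, S.IsUmbilic (P.Φ a) → a ∈ A) (hAR : ∀ a ∈ A, ‖a‖ < R)
    {δ : ℝ} (hδ : 0 < δ) (hδs : ∀ x ∈ Metric.closedBall (0 : ℂ) 1,
      ∀ y ∈ Metric.closedBall (0 : ℂ) 1, x ≠ y → ‖y - x‖ < δ → P.selfSecant x y ≠ 0)
    {v : ℂ} (hv : v ≠ 0) (hvδ : ‖v‖ < δ) (hvR : R + ‖v‖ < 1)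
    {L : ℝ → ℝ} (hL : Continuous L)
    (h : ∀ t : ℝ, ∃ c : ℝ, 0 < c ∧
      P.secantForm (circleMap 0 R t) (circleMap 0 R t + v * Complex.exp (t * Complex.I)) =
        c * Complex.exp (L t * Complex.I)) (t0 : ℝ) :
    L (t0 + 2 * Real.pi) - L t0 =
      2 * Real.pi * ((d * (∑ a ∈ A, S.umbilicOrder (P.Φ a) + 2) : ℤ) : ℝ) := by
  have hη : 0 < ‖v‖ := norm_pos_iff.mpr hv
  have hcirc : ∀ t, ‖circleMap 0 R t‖ = R := fun t => by
    rw [norm_circleMap_zero, abs_of_pos hR]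
  have hcircv : ∀ t, ‖circleMap 0 ‖v‖ t‖ = ‖v‖ := fun t => by
    rw [norm_circleMap_zero, abs_of_pos hη]
  -- shifts of norm `‖v‖` of points of norm at most `R` give nonzero secants
  have hsec : ∀ x u : ℂ, ‖x‖ ≤ R → u ≠ 0 → ‖u‖ < δ → R + ‖u‖ < 1 →
      x ∈ Metric.closedBall (0 : ℂ) 1 ∧ x + u ∈ Metric.closedBall (0 : ℂ) 1 ∧
      P.selfSecant x (x + u) ≠ 0 := by
    intro x u hx hu huδ huR
    have h1 : x ∈ Metric.closedBall (0 : ℂ) 1 := by rw [mem_closedBall_zero_iff]; linarith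
    have h2 : x + u ∈ Metric.closedBall (0 : ℂ) 1 := by
      rw [mem_closedBall_zero_iff]; linarith [norm_add_le x u]
    exact ⟨h1, h2, hδs x h1 _ h2 (by simpa using hu) (by simpa using huδ)⟩
  have humb : ∀ t, ¬ S.IsUmbilic (P.Φ (circleMap 0 R t)) := by
    intro t hu
    have := hAR _ (hA _ (by rw [mem_ball_zero_iff, hcirc]; exact hR1) hu)
    rw [hcirc] at this
    exact lt_irrefl _ this
  have hv0 : ∀ θ, circleMap 0 ‖v‖ θ ≠ 0 := fun θ => by
    rw [← norm_pos_iff, hcircv]; exact hη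
  -- The direction of the shift and the base point are made independent variables. The given curve
  -- is the diagonal θ = t + arg v; its gain is that of a path turning only the shift plus that of a
  -- path moving only the base point.
  obtain ⟨Λ, hΛ, hΛ1⟩ := (starConvex_univ (0 : ℝ × ℝ)).exists_log
    (g := fun q : ℝ × ℝ =>
      P.secantForm (circleMap 0 R q.2) (circleMap 0 R q.2 + circleMap 0 ‖v‖ q.1)) (by
      have h1 : Continuous fun q : ℝ × ℝ =>
          (circleMap 0 R q.2, circleMap 0 R q.2 + circleMap 0 ‖v‖ q.1) := by
        have e1 := continuous_circleMap 0 R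
        have e2 := continuous_circleMap 0 ‖v‖
        fun_prop
      have h2 : MapsTo (fun q : ℝ × ℝ =>
          (circleMap 0 R q.2, circleMap 0 R q.2 + circleMap 0 ‖v‖ q.1)) univ
          (Metric.closedBall 0 1 ×ˢ Metric.closedBall 0 1) := by
        intro q _
        obtain ⟨h3, h4, -⟩ := hsec (circleMap 0 R q.2) (circleMap 0 ‖v‖ q.1) (hcirc _).le (hv0 _)
          (by rwa [hcircv]) (by rwa [hcircv])
        exact ⟨h3, h4⟩
      exact (P.continuousOn_secantForm.comp h1.continuousOn h2).congr fun q _ => rfl) (by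
      intro q _
      exact P.secantForm_ne_zero (humb _) (hsec _ _ (hcirc _).le (hv0 _)
        (by rwa [hcircv]) (by rwa [hcircv])).2.2)
  rw [← continuousOn_univ] at hL
  have hΛc : Continuous Λ := continuousOn_univ.mp hΛ
  set φ := Complex.arg v with hφ
  have hvφ : ∀ t : ℝ, circleMap 0 ‖v‖ (t + φ) = v * Complex.exp (t * Complex.I) := by
    intro t
    rw [circleMap_zero]
    push_cast
    rw [add_mul, Complex.exp_add]
    have := Complex.norm_mul_exp_arg_mul_I v
    linear_combination Complex.exp (t * Complex.I) * this
  have hexpΛ : ∀ q : ℝ × ℝ, ∃ c : ℝ, 0 < c ∧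
      P.secantForm (circleMap 0 R q.2) (circleMap 0 R q.2 + circleMap 0 ‖v‖ q.1) =
        c * Complex.exp ((Λ q).im * Complex.I) := by
    intro q
    refine ⟨Real.exp (Λ q).re, Real.exp_pos _, ?_⟩
    rw [← hΛ1 q (mem_univ _), Complex.ofReal_exp, ← Complex.exp_add, Complex.re_add_im]
  obtain ⟨n, hn⟩ := isPreconnected_univ.arg_unique hL
    (K := fun t => (Λ (t + φ, t)).im) (by fun_prop) (by
    intro t _
    obtain ⟨c, hc, h1⟩ := h t
    obtain ⟨c', hc', h2⟩ := hexpΛ (t + φ, t)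
    simp only [hvφ] at h2
    have e1 := exp_im_mul_I_eq hc h1
    have e2 := exp_im_mul_I_eq hc' h2
    rw [← e2] at e1
    simpa using e1)
  rw [hn _ (mem_univ _), hn t0 (mem_univ _)]
  -- variation of the direction of the secant
  have hρ : 0 < min δ (1 - R) := lt_min hδ (by linarith)
  have hx0 : circleMap 0 R (t0 + 2 * Real.pi) ∈ Metric.ball (0 : ℂ) 1 := by
    rw [mem_ball_zero_iff, hcirc]; exact hR1
  obtain ⟨m, hm, hm1⟩ := (hd _ hx0).exists_selfSecant_eq hρ
    (by rw [hcirc]; linarith [min_le_right δ (1 - R)]) (fun u hu hu' =>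
      (hsec _ u (hcirc _).le (norm_pos_iff.mp hu) (hu'.trans_le (min_le_left _ _))
        (by linarith [min_le_right δ (1 - R)])).2.2)
  have hvρ : ‖v‖ < min δ (1 - R) := lt_min hvδ (by linarith)
  -- The exponent is doubled because the secant enters squared.
  have w1 := winding_zpow_mul_exp hη (m := d * 2)
    (l := fun u => Complex.log (S.hopf (P.Φ (circleMap 0 R (t0 + 2 * Real.pi)))
      (P.coord (circleMap 0 R (t0 + 2 * Real.pi)) (circleMap 0 R (t0 + 2 * Real.pi)))) + 2 * m u)
    (A := fun θ => (Λ (θ, t0 + 2 * Real.pi)).im)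
    (continuousOn_const.add (continuousOn_const.mul (hm.mono fun u hu => by
      rw [mem_sphere_zero_iff_norm] at hu
      exact ⟨by rw [hu]; exact hη, by rw [hu]; exact hvρ⟩))) (by fun_prop) (by
    intro θ
    obtain ⟨c, hc, h1⟩ := hexpΛ (θ, t0 + 2 * Real.pi)
    refine ⟨c, hc, ?_⟩
    rw [← h1, secantForm_eq, hm1 _ (by rw [hcircv]; exact hη) (by rw [hcircv]; exact hvρ),
      Complex.exp_add, Complex.exp_log, two_mul (m _), Complex.exp_add, zpow_mul]
    · norm_cast
      ring
    · have := humb (t0 + 2 * Real.pi)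
      rwa [S.isUmbilic_iff] at this) (t0 + φ)
  -- variation of the base point
  have hvδ' : ‖v * Complex.exp (t0 * Complex.I)‖ = ‖v‖ := by
    rw [norm_mul, Complex.norm_exp_ofReal_mul_I, mul_one]
  set v' := v * Complex.exp (t0 * Complex.I) with hv'
  have hv'0 : v' ≠ 0 := mul_ne_zero hv (Complex.exp_ne_zero _)
  obtain ⟨K, hK, hK1⟩ := exists_prod_zpow_mul_exp hR A (fun a => d * S.umbilicOrder (P.Φ a)) hAR
    (fun w => P.secantForm w (w + v')) (by
      have h1 : ContinuousOn (fun w : ℂ => (w, w + v')) (Metric.closedBall 0 R) := by fun_prop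
      have h2 : MapsTo (fun w : ℂ => (w, w + v')) (Metric.closedBall 0 R)
          (Metric.closedBall 0 1 ×ˢ Metric.closedBall 0 1) := by
        intro w hw
        rw [mem_closedBall_zero_iff] at hw
        obtain ⟨h3, h4, -⟩ := hsec w v' hw hv'0 (by rwa [hvδ']) (by rwa [hvδ'])
        exact ⟨h3, h4⟩
      exact (P.continuousOn_secantForm.comp h1 h2).congr fun q _ => rfl) (by
      intro w hw hwA
      rw [mem_closedBall_zero_iff] at hw
      refine P.secantForm_ne_zero (fun hu => hwA (hA w ?_ hu))
        (hsec w v' hw hv'0 (by rwa [hvδ']) (by rwa [hvδ'])).2.2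
      rw [mem_ball_zero_iff]; linarith) (by
      intro a ha
      have haR := hAR a ha
      have ha1 : a ∈ Metric.ball (0 : ℂ) 1 := by rw [mem_ball_zero_iff]; linarith
      obtain ⟨r, μ, hr, hμ⟩ := hloc a (Metric.ball_subset_closedBall ha1)
      refine exists_secantForm_eq ha1 ?_ hr hμ
        (hsec a v' haR.le hv'0 (by rwa [hvδ']) (by rwa [hvδ'])).2.2
      rw [mem_ball_zero_iff]
      linarith [norm_add_le a v'])
  -- On the circle w - a = w(1 - a/w), and the second factor has a logarithm because |a| < |w|; so
  -- each zero contributes its full exponent in w.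
  have hsl : ∀ a ∈ A, ∀ w ∈ Metric.sphere (0 : ℂ) R, 1 - a / w ∈ Complex.slitPlane := by
    intro a ha w hw
    rw [mem_sphere_zero_iff_norm] at hw
    have h1 : ‖a / w‖ < 1 := by
      rw [norm_div, hw, div_lt_one hR]; exact hAR a ha
    left
    have := (Complex.re_le_norm (a / w)).trans_lt h1
    simp only [Complex.sub_re, Complex.one_re]
    linarith
  have w2 := winding_zpow_mul_exp hR (m := ∑ a ∈ A, d * S.umbilicOrder (P.Φ a))
    (l := fun w => (∑ a ∈ A, (d * S.umbilicOrder (P.Φ a) : ℤ) * Complex.log (1 - a / w)) + K w)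
    (A := fun t => (Λ (t0 + φ, t)).im) (by
      refine ContinuousOn.add (continuousOn_finsetSum _ fun a ha => continuousOn_const.mul
        (ContinuousOn.clog ?_ (hsl a ha))) hK
      refine continuousOn_const.sub (continuousOn_const.div continuousOn_id fun w hw => ?_)
      rw [mem_sphere_zero_iff_norm] at hw
      exact norm_pos_iff.mp (by change 0 < ‖w‖; rw [hw]; exact hR)) (by fun_prop) (by
    intro t
    obtain ⟨c, hc, h1⟩ := hexpΛ (t0 + φ, t)
    refine ⟨c, hc, ?_⟩
    have hw : circleMap 0 R t ∈ Metric.sphere (0 : ℂ) R := circleMap_mem_sphere 0 hR.le t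
    have hw0 : circleMap 0 R t ≠ 0 := by rw [← norm_pos_iff, hcirc]; exact hR
    have h2 := hK1 _ hw
    simp only [hvφ] at h1
    rw [← h1, h2, Complex.exp_add, Complex.exp_sum, ← mul_assoc]
    congr 1
    have e0 : circleMap 0 R t ^ (∑ a ∈ A, d * S.umbilicOrder (P.Φ a)) =
        ∏ a ∈ A, circleMap 0 R t ^ (d * S.umbilicOrder (P.Φ a)) := by
      exact zpow_finsetSum hw0 A _
    rw [e0, ← Finset.prod_mul_distrib]
    refine Finset.prod_congr rfl fun a ha => ?_
    rw [Complex.exp_int_mul, Complex.exp_log (Complex.slitPlane_ne_zero (hsl a ha _ hw)),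
      ← mul_zpow]
    congr 1
    field_simp) t0
  have e3 : t0 + 2 * Real.pi + φ = t0 + φ + 2 * Real.pi := by ring
  rw [e3]
  push_cast at w1 w2 ⊢
  rw [← Finset.mul_sum] at w2
  linear_combination w1 + w2

end CurvatureLinePolygon

/-! ### Half disk coordinates and corner data at boundary points. -/

/-- The exponential coordinate on the closed unit disk near the boundary point with argument `θ`. -/
noncomputable def diskExp (θ : ℝ) (w : ℂ) : ℂ := Complex.exp ((θ + w) * Complex.I)

theorem diskExp_ofReal (θ t : ℝ) : diskExp θ t = circleMap 0 1 (θ + t) := by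
  rw [diskExp, circleMap]
  push_cast
  ring

theorem diskExp_zero (θ : ℝ) : diskExp θ 0 = circleMap 0 1 θ := by
  rw [diskExp, circleMap]
  push_cast
  ring_nf

theorem norm_diskExp (θ : ℝ) (w : ℂ) : ‖diskExp θ w‖ = Real.exp (-w.im) := by
  rw [diskExp, Complex.norm_exp]
  simp

theorem continuous_diskExp (θ : ℝ) : Continuous (diskExp θ) := by
  unfold diskExp
  fun_prop

theorem diskExp_mem_closedBall (θ : ℝ) {w : ℂ} (hw : 0 ≤ w.im) :
    diskExp θ w ∈ Metric.closedBall (0 : ℂ) 1 := by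
  rw [mem_closedBall_zero_iff, norm_diskExp, Real.exp_le_one_iff]
  linarith

theorem halfDisk_mono {r r' : ℝ} (h : r ≤ r') : halfDisk r ⊆ halfDisk r' :=
  fun _ hw => ⟨hw.1, hw.2.trans_le h⟩

/-- The quotient of the differences is i e^{i(θ+x)} times (exp ζ - 1)/ζ with ζ = i(y - x), which has
a logarithm for small ζ. Hence the change to a half disk preserves the degree. -/
theorem exists_diskExp_sub (θ : ℝ) : ∃ (r : ℝ) (χ : ℂ × ℂ → ℂ), 0 < r ∧
    ContinuousOn χ (halfDisk r ×ˢ halfDisk r) ∧ ∀ x ∈ halfDisk r, ∀ y ∈ halfDisk r,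
      diskExp θ y - diskExp θ x = (y - x) * Complex.exp (χ (x, y)) := by
  have h1 : ∀ᶠ z : ℂ in 𝓝 0, dslope Complex.exp 0 z ∈ Complex.slitPlane := by
    have h2 : dslope Complex.exp 0 0 = 1 := by rw [dslope_same]; simp
    refine continuous_dslope_exp.continuousAt.eventually
      (Complex.isOpen_slitPlane.mem_nhds ?_)
    rw [h2]
    exact Complex.one_mem_slitPlane
  obtain ⟨ρ, hρ, h⟩ := Metric.eventually_nhds_iff_ball.mp h1
  have hmem : ∀ x ∈ halfDisk (ρ / 2), ∀ y ∈ halfDisk (ρ / 2),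
      dslope Complex.exp 0 ((y - x) * Complex.I) ∈ Complex.slitPlane := by
    intro x hx y hy
    apply h
    rw [mem_ball_zero_iff, norm_mul, Complex.norm_I, mul_one]
    linarith [norm_sub_le y x, hx.2, hy.2]
  refine ⟨ρ / 2, fun q => (θ + q.1) * Complex.I + Complex.log Complex.I +
    Complex.log (dslope Complex.exp 0 ((q.2 - q.1) * Complex.I)), by positivity, ?_, ?_⟩
  · refine ContinuousOn.add (by fun_prop) (ContinuousOn.clog ?_ fun q hq => hmem _ hq.1 _ hq.2)
    exact continuous_dslope_exp.comp_continuousOn (by fun_prop)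
  · intro x hx y hy
    rw [Complex.exp_add, Complex.exp_add, Complex.exp_log Complex.I_ne_zero,
      Complex.exp_log (Complex.slitPlane_ne_zero (hmem x hx y hy))]
    have h3 := exp_sub_one_eq ((y - x) * Complex.I)
    have h4 : (θ + y) * Complex.I = (θ + x) * Complex.I + (y - x) * Complex.I := by ring
    rw [diskExp, diskExp, h4, Complex.exp_add]
    linear_combination Complex.exp ((θ + x) * Complex.I) * h3

theorem exists_injOn_diskExp (θ : ℝ) {s : ℝ} (hs : 0 < s) : ∃ r : ℝ, 0 < r ∧
    InjOn (diskExp θ) (halfDisk r) ∧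
    MapsTo (diskExp θ) (halfDisk r) (Metric.closedBall 0 1 ∩ Metric.ball (circleMap 0 1 θ) s) ∧
    ∀ (Z : ℂ → ℂ) (d : ℤ) (μ : ℂ × ℂ → ℂ),
      IsSecantLog (Metric.closedBall 0 1 ∩ Metric.ball (circleMap 0 1 θ) s) Z d μ →
      ∃ μ', IsSecantLog (halfDisk r) (fun w => Z (diskExp θ w) - Z (circleMap 0 1 θ)) d μ' := by
  obtain ⟨r1, χ, hr1, hχ, hχ1⟩ := exists_diskExp_sub θ
  obtain ⟨r2, hr2, h2⟩ := Metric.isOpen_iff.mp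
    ((Metric.isOpen_ball (x := circleMap 0 1 θ) (ε := s)).preimage (continuous_diskExp θ)) 0
    (by rw [mem_preimage, diskExp_zero]; exact Metric.mem_ball_self hs)
  have hsub := halfDisk_mono (min_le_left r1 r2)
  have hinj : InjOn (diskExp θ) (halfDisk (min r1 r2)) := by
    intro x hx y hy hxy
    have := hχ1 x (hsub hx) y (hsub hy)
    rw [hxy, sub_self, eq_comm, mul_eq_zero] at this
    rcases this with h | h
    · exact (sub_eq_zero.mp h).symm
    · exact absurd h (Complex.exp_ne_zero _)
  have hmaps : MapsTo (diskExp θ) (halfDisk (min r1 r2))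
      (Metric.closedBall 0 1 ∩ Metric.ball (circleMap 0 1 θ) s) := fun w hw =>
    ⟨diskExp_mem_closedBall θ hw.1,
      h2 (by rw [mem_ball_zero_iff]; exact hw.2.trans_le (min_le_right _ _))⟩
  refine ⟨min r1 r2, lt_min hr1 hr2, hinj, hmaps, fun Z d μ hμ => ?_⟩
  have hne : ∀ x ∈ halfDisk (min r1 r2), ∀ y ∈ halfDisk (min r1 r2), x ≠ y →
      diskExp θ x ≠ diskExp θ y := fun x hx y hy hxy h => hxy (hinj hx hy h)
  have hc := continuous_diskExp θ
  refine ⟨fun q => μ (diskExp θ q.1, diskExp θ q.2) + d * χ q, ?_, ?_⟩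
  · refine (hμ.continuousOn.comp (by fun_prop) ?_).add (continuousOn_const.mul (hχ.mono ?_))
    · exact fun q hq => ⟨hmaps hq.1, hmaps hq.2.1, hne _ hq.1 _ hq.2.1 hq.2.2⟩
    · exact fun q hq => ⟨hsub hq.1, hsub hq.2.1⟩
  · intro x hx y hy hxy
    rw [sub_sub_sub_cancel_right, hμ.eq _ (hmaps hx) _ (hmaps hy) (hne x hx y hy hxy),
      hχ1 x (hsub hx) y (hsub hy), mul_zpow, Complex.exp_add, Complex.exp_int_mul]
    ring

theorem eventually_circleMap_notMem (V : Finset ℂ) (θ : ℝ) :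
    ∀ᶠ τ in 𝓝[≠] θ, circleMap 0 1 τ ∉ V := by
  have key : ∀ v ∈ V, ∀ᶠ τ in 𝓝[≠] θ, circleMap 0 1 τ ≠ v := by
    intro v _
    by_cases hv : circleMap 0 1 θ = v
    · obtain ⟨r, hr, hinj, -⟩ := exists_injOn_diskExp θ one_pos
      filter_upwards [self_mem_nhdsWithin, nhdsWithin_le_nhds (Metric.ball_mem_nhds θ hr)]
        with τ hτ hτr h
      apply hτ
      have h1 : ((τ - θ : ℝ) : ℂ) ∈ halfDisk r := ofReal_mem_halfDisk hτr
      have h2 : ((0 : ℝ) : ℂ) ∈ halfDisk r := ofReal_mem_halfDisk (by simpa using hr)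
      have h3 := hinj h1 h2 (by
        rw [diskExp_ofReal, diskExp_ofReal, add_sub_cancel, add_zero, h, hv])
      have h4 : τ - θ = 0 := by exact_mod_cast h3
      exact sub_eq_zero.mp h4
    · exact nhdsWithin_le_nhds ((continuous_circleMap 0 1).continuousAt.eventually_ne hv)
  filter_upwards [(Filter.eventually_all_finset V).mpr key] with τ hτ h
  exact hτ _ h rfl

namespace CurvatureLinePolygon

variable {M : Type*} [TopologicalSpace M] [ChartedSpace ℂ M] {S : SphereSurface M} {p : ℕ}
  (P : CurvatureLinePolygon S p)

/-- The coordinate at the boundary point with argument `θ`, centred at this point. -/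
noncomputable def cornerCoord (θ : ℝ) (w : ℂ) : ℂ :=
  P.coord (circleMap 0 1 θ) (diskExp θ w) - P.coord (circleMap 0 1 θ) (circleMap 0 1 θ)

/-- The local data at the boundary point with argument `θ`. -/
structure IsBoundaryCorner (θ : ℝ) (d : ℤ) (s r : ℝ) (e e' : ℂ) (μ : ℂ × ℂ → ℂ) : Prop where
  isLocal : P.IsLocal (circleMap 0 1 θ) s
  mapsTo : MapsTo (diskExp θ) (halfDisk r)
    (Metric.closedBall 0 1 ∩ Metric.ball (circleMap 0 1 θ) s)
  injOn : InjOn (diskExp θ) (halfDisk r)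
  corner : IsPlaneCorner (P.cornerCoord θ) r e e'
  secantLog : IsSecantLog (halfDisk r) (P.cornerCoord θ) d μ
  smooth : circleMap 0 1 θ ∉ P.V → e = e' ∧
    (S.hopf (P.Φ (circleMap 0 1 θ)) (P.coord (circleMap 0 1 θ) (circleMap 0 1 θ)) * e ^ 2).im = 0 ∧
    Filter.Tendsto
      (fun p : ℝ × ℝ => (P.cornerCoord θ p.2 - P.cornerCoord θ p.1) / (p.2 - p.1 : ℝ))
      (𝓝[{p | p.1 < p.2}] 0) (𝓝 e)

variable [IsManifold 𝓘(ℂ) ω M]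

/-- The limit uses only pairs inside one closed vertex-free arc, so that it also gives one-sided
velocities at a vertex. -/
theorem exists_velocity {θ a b : ℝ} (hab : a < b) (hθ : θ ∈ Icc a b)
    (h : ∀ τ ∈ Ioo a b, circleMap 0 1 τ ∉ P.V) :
    ∃ e : ℂ, e ≠ 0 ∧ (S.hopf (P.Φ (circleMap 0 1 θ))
        (P.coord (circleMap 0 1 θ) (circleMap 0 1 θ)) * e ^ 2).im = 0 ∧
      Filter.Tendsto
        (fun p : ℝ × ℝ => (P.cornerCoord θ p.2 - P.cornerCoord θ p.1) / (p.2 - p.1 : ℝ))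
        (𝓝[{p | θ + p.1 ∈ Icc a b ∧ θ + p.2 ∈ Icc a b ∧ p.1 < p.2}] 0) (𝓝 e) := by
  obtain ⟨e, he, hq, hlim⟩ := (P.edge a b hab h).exists_velocity hab hθ
  refine ⟨e, he, hq, ?_⟩
  have h1 : Filter.Tendsto (fun p : ℝ × ℝ => (θ + p.1, θ + p.2))
      (𝓝[{p | θ + p.1 ∈ Icc a b ∧ θ + p.2 ∈ Icc a b ∧ p.1 < p.2}] 0)
      (𝓝[{p | p.1 ∈ Icc a b ∧ p.2 ∈ Icc a b ∧ p.1 < p.2}] (θ, θ)) := by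
    refine tendsto_nhdsWithin_iff.mpr ⟨?_, ?_⟩
    · have : ContinuousAt (fun p : ℝ × ℝ => (θ + p.1, θ + p.2)) 0 := by fun_prop
      have h2 := this.tendsto
      simp only [Prod.fst_zero, Prod.snd_zero, add_zero] at h2
      exact h2.mono_left nhdsWithin_le_nhds
    · filter_upwards [self_mem_nhdsWithin] with p hp
      exact ⟨hp.1, hp.2.1, by simpa using hp.2.2⟩
  refine (hlim.comp h1).congr fun p => ?_
  simp only [Function.comp, cornerCoord, coord, diskExp_ofReal, add_sub_add_left_eq_sub,
    sub_sub_sub_cancel_right]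

theorem exists_isBoundaryCorner {d : ℤ}
    (hloc : ∀ c ∈ Metric.closedBall (0 : ℂ) 1, ∃ (r : ℝ) (μ : ℂ × ℂ → ℂ), P.IsLocal c r ∧
      IsSecantLog (Metric.closedBall 0 1 ∩ Metric.ball c r) (P.coord c) d μ) (θ : ℝ) :
    ∃ (s r : ℝ) (e e' : ℂ) (μ : ℂ × ℂ → ℂ), P.IsBoundaryCorner θ d s r e e' μ := by
  have hc : circleMap 0 1 θ ∈ Metric.closedBall (0 : ℂ) 1 := circleMap_mem_closedBall 0 zero_le_one θ
  obtain ⟨s, μ0, hs, hμ0⟩ := hloc _ hc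
  obtain ⟨r, hr, hinj, hmaps, hlog⟩ := exists_injOn_diskExp θ hs.pos
  obtain ⟨μ, hμ⟩ := hlog _ _ _ hμ0
  have hV := eventually_circleMap_notMem P.V θ
  rw [eventually_nhdsWithin_iff, Metric.eventually_nhds_iff_ball] at hV
  obtain ⟨κ, hκ, hV⟩ := hV
  have hV : ∀ τ, |τ - θ| < κ → τ ≠ θ → circleMap 0 1 τ ∉ P.V := fun τ h1 h2 => hV τ h1 h2
  have hsmall : ∀ᶠ p : ℝ × ℝ in 𝓝 0, |p.1| < κ / 2 ∧ |p.2| < κ / 2 := by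
    have h1 : ContinuousAt (fun p : ℝ × ℝ => |p.1|) 0 := by fun_prop
    have h2 : ContinuousAt (fun p : ℝ × ℝ => |p.2|) 0 := by fun_prop
    exact Filter.Eventually.and (h1 (Iio_mem_nhds (by simpa using hκ)))
      (h2 (Iio_mem_nhds (by simpa using hκ)))
  have base : ∀ e e' : ℂ, e ≠ 0 → e' ≠ 0 →
      Filter.Tendsto (fun p : ℝ × ℝ => (P.cornerCoord θ p.2 - P.cornerCoord θ p.1) / (p.2 - p.1 : ℝ))
        (𝓝[{p | 0 ≤ p.1 ∧ p.1 < p.2}] 0) (𝓝 e) →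
      Filter.Tendsto (fun p : ℝ × ℝ => (P.cornerCoord θ p.2 - P.cornerCoord θ p.1) / (p.2 - p.1 : ℝ))
        (𝓝[{p | p.1 < p.2 ∧ p.2 ≤ 0}] 0) (𝓝 e') → IsPlaneCorner (P.cornerCoord θ) r e e' := by
    intro e e' he he' h1 h2
    refine ⟨hr, ?_, ?_, ?_, he, he', h1, h2⟩
    · rw [cornerCoord, diskExp_zero, sub_self]
    · exact (hs.continuousOn_coord.comp (continuous_diskExp θ).continuousOn hmaps).sub
        continuousOn_const
    · intro x hx y hy hxy
      exact hinj hx hy (hs.injOn_coord (hmaps hx) (hmaps hy) (sub_left_injective hxy))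
  -- At a vertex the two adjacent arcs give two one-sided velocities; elsewhere a single curvature
  -- line passes through the point and gives one two-sided velocity.
  by_cases hcV : circleMap 0 1 θ ∈ P.V
  · obtain ⟨e, he, -, h1⟩ := P.exists_velocity (θ := θ) (a := θ) (b := θ + κ / 2) (by linarith)
      ⟨le_rfl, by linarith⟩ (fun τ hτ => hV τ (by rw [abs_of_pos] <;> linarith [hτ.1, hτ.2])
        hτ.1.ne')
    obtain ⟨e', he', -, h2⟩ := P.exists_velocity (θ := θ) (a := θ - κ / 2) (b := θ) (by linarith)
      ⟨by linarith, le_rfl⟩ (fun τ hτ => hV τ (by rw [abs_of_neg] <;> linarith [hτ.1, hτ.2])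
        hτ.2.ne)
    refine ⟨s, r, e, e', μ, hs, hmaps, hinj, base e e' he he' ?_ ?_, hμ, fun h => absurd hcV h⟩
    · refine h1.mono_left (nhdsWithin_le_of_mem ?_)
      filter_upwards [self_mem_nhdsWithin, nhdsWithin_le_nhds hsmall] with p hp hpκ
      have := abs_lt.mp hpκ.1
      have := abs_lt.mp hpκ.2
      have h3 : 0 ≤ p.1 := hp.1
      have h4 : p.1 < p.2 := hp.2
      exact ⟨⟨by linarith, by linarith⟩, ⟨by linarith, by linarith⟩, h4⟩
    · refine h2.mono_left (nhdsWithin_le_of_mem ?_)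
      filter_upwards [self_mem_nhdsWithin, nhdsWithin_le_nhds hsmall] with p hp hpκ
      have := abs_lt.mp hpκ.1
      have := abs_lt.mp hpκ.2
      have h3 : p.2 ≤ 0 := hp.2
      have h4 : p.1 < p.2 := hp.1
      exact ⟨⟨by linarith, by linarith⟩, ⟨by linarith, by linarith⟩, h4⟩
  · obtain ⟨e, he, hq, h1⟩ := P.exists_velocity (θ := θ) (a := θ - κ / 2) (b := θ + κ / 2)
      (by linarith) ⟨by linarith, by linarith⟩ (fun τ hτ => by
        rcases eq_or_ne τ θ with rfl | hne
        · exact hcV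
        · exact hV τ (by rw [abs_lt]; constructor <;> linarith [hτ.1, hτ.2]) hne)
    have h2 : Filter.Tendsto
        (fun p : ℝ × ℝ => (P.cornerCoord θ p.2 - P.cornerCoord θ p.1) / (p.2 - p.1 : ℝ))
        (𝓝[{p | p.1 < p.2}] 0) (𝓝 e) := by
      refine h1.mono_left (nhdsWithin_le_of_mem ?_)
      filter_upwards [self_mem_nhdsWithin, nhdsWithin_le_nhds hsmall] with p hp hpκ
      have := abs_lt.mp hpκ.1
      have := abs_lt.mp hpκ.2
      exact ⟨⟨by linarith, by linarith⟩, ⟨by linarith, by linarith⟩, hp⟩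
    exact ⟨s, r, e, e, μ, hs, hmaps, hinj, base e e he he
      (h2.mono_left (nhdsWithin_mono _ fun p hp => hp.2))
      (h2.mono_left (nhdsWithin_mono _ fun p hp => hp.1)), hμ, fun _ => ⟨rfl, hq, h2⟩⟩

end CurvatureLinePolygon

theorem mul_div_norm (a b : ℂ) : a * b / ‖a * b‖ = (a / ‖a‖) * (b / ‖b‖) := by
  rw [norm_mul, Complex.ofReal_mul, mul_div_mul_comm]

theorem pow_div_norm (a : ℂ) (n : ℕ) : a ^ n / ‖a ^ n‖ = (a / ‖a‖) ^ n := by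
  rw [norm_pow, Complex.ofReal_pow, div_pow]

/-- The normalised quotient has modulus 1 near the point, so its limit has modulus 1 as well. -/
theorem SphereSurface.IsRegularAt.exists_norm_eq_one {M : Type*} [TopologicalSpace M]
    [ChartedSpace ℂ M] {S : SphereSurface M} [IsManifold 𝓘(ℂ) ω M] {u : M} (h : S.IsRegularAt u)
    {k : ℤ} (hk : S.HasIndex u k) : ∃ c : ℂ, ‖c‖ = 1 ∧ Filter.Tendsto
      (fun z : ℂ => (S.hopf u z / ‖S.hopf u z‖) /
        ((z - chartAt ℂ u u) / ‖z - chartAt ℂ u u‖) ^ k) (𝓝[≠] (chartAt ℂ u u)) (𝓝 c) := by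
  obtain ⟨c, hc⟩ := h
  rw [hk.umbilicOrder_eq] at hc
  refine ⟨c, ?_, hc⟩
  obtain ⟨ρ, l, hρ, -, hl⟩ := hk.exists_hopf_eq
  refine tendsto_nhds_unique (hc.norm) (tendsto_const_nhds.congr' ?_)
  filter_upwards [self_mem_nhdsWithin, nhdsWithin_le_nhds (Metric.ball_mem_nhds _ hρ)] with z hz hzρ
  have hz0 : z - chartAt ℂ u u ≠ 0 := sub_ne_zero.mpr hz
  have h1 := hl _ (norm_pos_iff.mpr hz0) (mem_ball_iff_norm.mp hzρ)
  rw [add_sub_cancel] at h1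
  have h2 : S.hopf u z ≠ 0 := by
    rw [h1]; exact mul_ne_zero (zpow_ne_zero _ hz0) (Complex.exp_ne_zero _)
  rw [norm_div, norm_zpow, norm_div_norm_eq_one h2, norm_div_norm_eq_one hz0]
  simp

/-! ### The phase of the secant form at a boundary point. -/

namespace CurvatureLinePolygon

variable {M : Type*} [TopologicalSpace M] [ChartedSpace ℂ M] {S : SphereSurface M} {p : ℕ}
  {P : CurvatureLinePolygon S p}

open Classical in
/-- The interior angle at a boundary point. -/
noncomputable def interiorAngle (P : CurvatureLinePolygon S p) (c : ℂ) : ℝ :=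
  if c ∈ P.V then Real.pi / P.n c else Real.pi

namespace IsBoundaryCorner

variable {θ : ℝ} {d : ℤ} {s r : ℝ} {e e' : ℂ} {μ : ℂ × ℂ → ℂ}

theorem exp_secantArg (h : P.IsBoundaryCorner θ d s r e e' μ) {w : ℂ} (hw : w ∈ halfDisk r)
    (hw0 : w ≠ 0) : Complex.exp (secantArg d μ 0 w * Complex.I) =
      P.cornerCoord θ w / ‖P.cornerCoord θ w‖ := by
  have := h.secantLog.exp_secantArg (x := 0) (by simpa using h.corner.pos) hw hw0
  rwa [Complex.ofReal_zero, h.corner.zero, sub_zero] at this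

theorem cornerCoord_ne_zero (h : P.IsBoundaryCorner θ d s r e e' μ) {w : ℂ} (hw : w ∈ halfDisk r)
    (hw0 : w ≠ 0) : P.cornerCoord θ w ≠ 0 := fun h0 =>
  hw0 (h.corner.injOn hw ⟨by simp, by simpa using h.corner.pos⟩ (h0.trans h.corner.zero.symm))

theorem continuousOn_secantArg (h : P.IsBoundaryCorner θ d s r e e' μ) :
    ContinuousOn (secantArg d μ 0) {w | w ∈ halfDisk r ∧ w ≠ 0} := by
  have := h.secantLog.continuousOn_secantArg (x := 0) (by simpa using h.corner.pos)
  rwa [Complex.ofReal_zero] at this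

/-- The angle between the limits of the argument at the two edges is the interior angle. -/
theorem exists_angles (h : P.IsBoundaryCorner θ d s r e e' μ) : ∃ α β : ℝ,
      Filter.Tendsto (fun p : ℝ × ℝ => (μ (p.1, p.2)).im)
        (𝓝[{p | 0 ≤ p.1 ∧ p.1 < p.2}] 0) (𝓝 α) ∧
      Filter.Tendsto (fun p : ℝ × ℝ => (μ (p.1, p.2)).im)
        (𝓝[{p | p.1 < p.2 ∧ p.2 ≤ 0}] 0) (𝓝 (β - d * Real.pi)) ∧
      Filter.Tendsto (fun t : ℝ => secantArg d μ 0 t) (𝓝[>] 0) (𝓝 α) ∧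
      Filter.Tendsto (fun t : ℝ => secantArg d μ 0 t) (𝓝[<] 0) (𝓝 β) ∧
      (d = 1 ∨ d = -1) ∧ β - α = d * P.interiorAngle (circleMap 0 1 θ) := by
  obtain ⟨α, β, h1, h2, h3, h4, h5, h6, hd, h7, h8⟩ := h.corner.exists_angles h.secantLog
  refine ⟨α, β, h3, h4, h5, h6, hd, ?_⟩
  have hpi := Real.pi_pos
  have hd2 : (d : ℝ) * d = 1 := by rcases hd with rfl | rfl <;> norm_num
  by_cases hcV : circleMap 0 1 θ ∈ P.V
  · rw [interiorAngle, if_pos hcV]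
    obtain ⟨rA, A, α', β', hrA, -, hA, hA1, hα', hβ', hφ⟩ := P.angle _ hcV
    set c := circleMap 0 1 θ with hc
    obtain ⟨r', hr', hsub⟩ := Metric.isOpen_iff.mp
      ((Metric.isOpen_ball (x := c) (ε := rA)).preimage (continuous_diskExp θ)) 0
      (by rw [mem_preimage, diskExp_zero]; exact Metric.mem_ball_self hrA)
    set ρ := min r r' with hρ
    have hρ0 : 0 < ρ := lt_min h.corner.pos hr'
    have hset : {w : ℂ | w ∈ Metric.ball (0 : ℂ) ρ ∧ 0 ≤ w.im ∧ w ≠ (0 : ℝ)} ⊆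
        {w | w ∈ halfDisk r ∧ w ≠ 0} := by
      rintro w ⟨hw1, hw2, hw3⟩
      rw [mem_ball_zero_iff] at hw1
      exact ⟨⟨hw2, hw1.trans_le (min_le_left _ _)⟩, by simpa using hw3⟩
    have hmaps : MapsTo (diskExp θ) {w : ℂ | w ∈ Metric.ball (0 : ℂ) ρ ∧ 0 ≤ w.im ∧ w ≠ (0 : ℝ)}
        ((Metric.closedBall 0 1 ∩ Metric.ball c rA) \ {c}) := by
      intro w hw
      refine ⟨⟨diskExp_mem_closedBall θ hw.2.1,
        hsub (Metric.ball_subset_ball (min_le_right _ _) hw.1)⟩, fun hwc => (hset hw).2 ?_⟩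
      have hwc : diskExp θ w = c := hwc
      rw [hc, ← diskExp_zero] at hwc
      exact h.injOn (hset hw).1 ⟨by simp, by simpa using h.corner.pos⟩ hwc
    have hconn : IsPreconnected {w : ℂ | w ∈ Metric.ball (0 : ℂ) ρ ∧ 0 ≤ w.im ∧ w ≠ (0 : ℝ)} :=
      isPreconnected_inter_im_nonneg (convex_ball 0 ρ) (c := (ρ / 2 : ℝ) * Complex.I) (by
        rw [mem_ball_zero_iff, norm_mul, Complex.norm_I, mul_one, Complex.norm_real,
          Real.norm_of_nonneg (by positivity)]
        linarith) (by simpa using hρ0)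
    -- `secantArg` and the branch from `HasInteriorAngle` are arguments of the same function on a
    -- connected punctured half disk, so they differ by a constant.
    obtain ⟨n, hn⟩ := hconn.arg_unique (h.continuousOn_secantArg.mono hset)
      (hA.comp (continuous_diskExp θ).continuousOn hmaps) (by
      intro w hw
      rw [h.exp_secantArg (hset hw).1 (hset hw).2, Function.comp]
      have e1 := hA1 _ (hmaps hw)
      have e2 := h.cornerCoord_ne_zero (hset hw).1 (hset hw).2
      have e3 : (‖P.cornerCoord θ w‖ : ℂ) ≠ 0 := by exact_mod_cast norm_ne_zero_iff.mpr e2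
      rw [div_eq_iff e3, mul_comm]
      exact e1)
    -- The angle at the vertex is parametrised from c.arg, the corner from θ; they agree modulo 2π.
    have hper : ∀ t : ℝ, circleMap 0 1 (c.arg + t) = circleMap 0 1 (θ + t) := by
      intro t
      have e1 : Complex.exp (c.arg * Complex.I) = Complex.exp (θ * Complex.I) := by
        have := Complex.norm_mul_exp_arg_mul_I c
        have e2 : ‖c‖ = 1 := by rw [hc, norm_circleMap_zero, abs_one]
        rw [e2, Complex.ofReal_one, one_mul] at this
        rw [this, hc, circleMap]
        simp
      rw [circleMap, circleMap]
      push_cast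
      rw [add_mul, add_mul, Complex.exp_add, Complex.exp_add, e1]
    have hball : ∀ᶠ t : ℝ in 𝓝 0, (t : ℂ) ∈ Metric.ball (0 : ℂ) ρ := by
      filter_upwards [Metric.ball_mem_nhds (0 : ℝ) hρ0] with t ht
      rw [mem_ball_zero_iff] at ht ⊢
      rwa [Complex.norm_real]
    have hval : ∀ᶠ t : ℝ in 𝓝[≠] 0,
        secantArg d μ 0 t = A (circleMap 0 1 (c.arg + t)) + n * (2 * Real.pi) := by
      filter_upwards [self_mem_nhdsWithin, nhdsWithin_le_nhds hball] with t ht htρ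
      have := hn t ⟨htρ, by simp, by exact_mod_cast ht⟩
      rwa [Function.comp, diskExp_ofReal, ← hper] at this
    have ht1 : Filter.Tendsto (fun t : ℝ => c.arg + t) (𝓝 0) (𝓝 c.arg) := by
      have : ContinuousAt (fun t : ℝ => c.arg + t) 0 := by fun_prop
      simpa [ContinuousAt] using this
    have hα : α = α' + n * (2 * Real.pi) := by
      have e1 : Filter.Tendsto (fun t : ℝ => c.arg + t) (𝓝[>] 0) (𝓝[>] c.arg) :=
        tendsto_nhdsWithin_iff.mpr ⟨ht1.mono_left nhdsWithin_le_nhds, by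
          filter_upwards [self_mem_nhdsWithin] with t ht
          simpa using ht⟩
      refine tendsto_nhds_unique h5 (((hα'.comp e1).add_const _).congr' ?_)
      filter_upwards [nhdsWithin_mono 0 (fun t ht => ne_of_gt ht) hval] with t ht
      exact ht.symm
    have hβ : β = β' + n * (2 * Real.pi) := by
      have e1 : Filter.Tendsto (fun t : ℝ => c.arg + t) (𝓝[<] 0) (𝓝[<] c.arg) :=
        tendsto_nhdsWithin_iff.mpr ⟨ht1.mono_left nhdsWithin_le_nhds, by
          filter_upwards [self_mem_nhdsWithin] with t ht
          simpa using ht⟩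
      refine tendsto_nhds_unique h6 (((hβ'.comp e1).add_const _).congr' ?_)
      filter_upwards [nhdsWithin_mono 0 (fun t ht => ne_of_lt ht) hval] with t ht
      exact ht.symm
    rw [← hφ, hα, hβ, add_sub_add_right_eq_sub]
    rw [hα, hβ, add_sub_add_right_eq_sub] at h7
    rcases hd with rfl | rfl
    · norm_num at h7 ⊢
      rw [abs_of_nonneg (by linarith)]
    · norm_num at h7 ⊢
      rw [abs_of_nonpos (by linarith)]
      ring
  · rw [interiorAngle, if_neg hcV]
    obtain ⟨hee, -, -⟩ := h.smooth hcV
    rw [← hee, ← h1] at h2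
    obtain ⟨n, hn⟩ := Complex.exp_eq_exp_iff_exists_int.mp h2
    have hn := congrArg Complex.im hn
    simp at hn
    -- Equal velocities on both sides give β - α = dπ modulo 2π, and the bounds 0 and 2π from the
    -- corner exclude every other multiple.
    have e1 : d * (β - α) = Real.pi + d * n * (2 * Real.pi) := by
      have : β - α = d * Real.pi + n * (2 * Real.pi) := by linarith
      rw [this]
      linear_combination Real.pi * hd2
    rw [e1] at h7 h8
    have e2 : -1 < d * n := by
      have : (-1 : ℝ) < d * n := by nlinarith
      exact_mod_cast this
    have e3 : d * n < 1 := by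
      have : (d * n : ℝ) < 1 := by nlinarith
      exact_mod_cast this
    have e4 : (d : ℝ) * n = 0 := by
      have : d * n = 0 := by omega
      exact_mod_cast this
    rw [e4] at e1
    linear_combination d * e1 - (β - α) * hd2

variable [IsManifold 𝓘(ℂ) ω M]

theorem secantForm_eq (h : P.IsBoundaryCorner θ d s r e e' μ) {w w' : ℂ} (hw : w ∈ halfDisk r)
    (hw' : w' ∈ halfDisk r) (hww : w ≠ w') :
    P.secantForm (diskExp θ w) (diskExp θ w') =
      S.hopf (P.Φ (circleMap 0 1 θ)) (P.coord (circleMap 0 1 θ) (diskExp θ w)) *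
        (P.ratio (circleMap 0 1 θ) (diskExp θ w) (diskExp θ w') *
          (P.cornerCoord θ w' - P.cornerCoord θ w)) ^ 2 := by
  have h1 := h.isLocal.secant_eq (h.mapsTo hw) (h.mapsTo hw') (fun h' => hww (h.injOn hw hw' h'))
  rw [cornerCoord, cornerCoord, sub_sub_sub_cancel_right, ← h1]
  exact S.hopfSecant_eq _ _ _ (h.isLocal.mapsTo (h.mapsTo hw))

theorem tendsto_ratio (h : P.IsBoundaryCorner θ d s r e e' μ) {X : Type*} {F : Filter X}
    {f g : X → ℂ} (hf : Filter.Tendsto f F (𝓝 0)) (hg : Filter.Tendsto g F (𝓝 0))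
    (hfg : ∀ᶠ x in F, 0 ≤ (f x).im ∧ 0 ≤ (g x).im ∧ f x ≠ g x) :
    Filter.Tendsto (fun x => P.ratio (circleMap 0 1 θ) (diskExp θ (f x)) (diskExp θ (g x))) F
      (𝓝 1) := by
  have hr := h.corner.pos
  have h0 : Filter.Tendsto (diskExp θ) (𝓝 0) (𝓝 (circleMap 0 1 θ)) := by
    rw [← diskExp_zero]
    exact (continuous_diskExp θ).tendsto 0
  have h1 := P.tendsto_ratio (circleMap_mem_closedBall 0 zero_le_one θ)
  have h2 : Filter.Tendsto (fun x => (diskExp θ (f x), diskExp θ (g x))) F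
      (𝓝[{q | q.1 ∈ Metric.closedBall (0 : ℂ) 1 ∧ q.2 ∈ Metric.closedBall (0 : ℂ) 1 ∧ q.1 ≠ q.2}]
        (circleMap 0 1 θ, circleMap 0 1 θ)) := by
    refine tendsto_nhdsWithin_iff.mpr ⟨(h0.comp hf).prodMk_nhds (h0.comp hg), ?_⟩
    filter_upwards [hfg, hf (Metric.ball_mem_nhds _ hr), hg (Metric.ball_mem_nhds _ hr)]
      with x hx hfx hgx
    exact ⟨diskExp_mem_closedBall θ hx.1, diskExp_mem_closedBall θ hx.2.1,
      fun h' => hx.2.2 (h.injOn ⟨hx.1, mem_ball_zero_iff.mp hfx⟩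
        ⟨hx.2.1, mem_ball_zero_iff.mp hgx⟩ h')⟩
  have h3 := Filter.Tendsto.comp h1 h2
  exact h3.congr fun _ => rfl

/-- The argument of `secantForm` near a boundary point. -/
theorem tendsto_phase (h : P.IsBoundaryCorner θ d s r e e' μ) : ∃ κ : ℂ, ‖κ‖ = 1 ∧
    Filter.Tendsto (fun q : ℂ × ℝ =>
      P.secantForm (diskExp θ q.1) (diskExp θ (q.1 + q.2)) /
        ‖P.secantForm (diskExp θ q.1) (diskExp θ (q.1 + q.2))‖ /
        Complex.exp ((S.umbilicOrder (P.Φ (circleMap 0 1 θ)) * secantArg d μ 0 q.1 +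
          2 * (μ (q.1, q.1 + q.2)).im : ℝ) * Complex.I))
      (𝓝[{q | 0 ≤ q.1.im ∧ q.1 ≠ 0 ∧ 0 < q.2}] 0) (𝓝 κ) := by
  set c := circleMap 0 1 θ with hc
  have hcs : c ∈ Metric.sphere (0 : ℂ) 1 := circleMap_mem_sphere 0 zero_le_one θ
  have hcb := Metric.sphere_subset_closedBall hcs
  obtain ⟨κ, hκ, hlim⟩ := (P.isRegularAt hcs).exists_norm_eq_one (P.hasIndex hcb)
  refine ⟨κ, hκ, ?_⟩
  set k := S.umbilicOrder (P.Φ c)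
  set T := {q : ℂ × ℝ | 0 ≤ q.1.im ∧ q.1 ≠ 0 ∧ 0 < q.2}
  have hr := h.corner.pos
  have hf : Filter.Tendsto (fun q : ℂ × ℝ => q.1) (𝓝[T] 0) (𝓝 0) :=
    (continuous_fst.tendsto (0 : ℂ × ℝ)).mono_left nhdsWithin_le_nhds
  have hg : Filter.Tendsto (fun q : ℂ × ℝ => q.1 + q.2) (𝓝[T] 0) (𝓝 0) := by
    have : ContinuousAt (fun q : ℂ × ℝ => q.1 + (q.2 : ℂ)) 0 := by fun_prop
    have h1 := this.tendsto
    simp only [Prod.fst_zero, Prod.snd_zero, Complex.ofReal_zero, add_zero] at h1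
    exact h1.mono_left nhdsWithin_le_nhds
  have hne : ∀ q ∈ T, q.1 ≠ q.1 + (q.2 : ℂ) := by
    intro q hq h'
    simp only [left_eq_add, Complex.ofReal_eq_zero] at h'
    exact hq.2.2.ne' h'
  have hratio : Filter.Tendsto
      (fun q : ℂ × ℝ => P.ratio c (diskExp θ q.1) (diskExp θ (q.1 + q.2))) (𝓝[T] 0) (𝓝 1) :=
    h.tendsto_ratio hf hg (by
      filter_upwards [self_mem_nhdsWithin] with q hq
      exact ⟨hq.1, by simpa using hq.1, hne q hq⟩)
  have hmemf : ∀ᶠ q in 𝓝[T] (0 : ℂ × ℝ), q.1 ∈ halfDisk r := by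
    filter_upwards [self_mem_nhdsWithin, hf (Metric.ball_mem_nhds _ hr)] with q hq hqr
    exact ⟨hq.1, mem_ball_zero_iff.mp hqr⟩
  have hmemg : ∀ᶠ q in 𝓝[T] (0 : ℂ × ℝ), q.1 + (q.2 : ℂ) ∈ halfDisk r := by
    filter_upwards [self_mem_nhdsWithin, hg (Metric.ball_mem_nhds _ hr)] with q hq hqr
    exact ⟨by simpa using hq.1, mem_ball_zero_iff.mp hqr⟩
  have hz : Filter.Tendsto (fun q : ℂ × ℝ => P.coord c (diskExp θ q.1)) (𝓝[T] 0)
      (𝓝[≠] (chartAt ℂ (P.Φ c) (P.Φ c))) := by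
    refine tendsto_nhdsWithin_iff.mpr ⟨?_, ?_⟩
    · refine (P.tendsto_coord hcb).comp (tendsto_nhdsWithin_iff.mpr ⟨?_, ?_⟩)
      · have h0 : Filter.Tendsto (diskExp θ) (𝓝 0) (𝓝 c) := by
          rw [hc, ← diskExp_zero]
          exact (continuous_diskExp θ).tendsto 0
        exact h0.comp hf
      · filter_upwards [self_mem_nhdsWithin] with q hq using diskExp_mem_closedBall θ hq.1
    · filter_upwards [self_mem_nhdsWithin, hmemf] with q hq hqr
      exact sub_ne_zero.mp (h.cornerCoord_ne_zero hqr hq.2.1)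
  have h1 := (hlim.comp hz).mul ((tendsto_div_norm one_ne_zero hratio).pow 2)
  simp only [norm_one, Complex.ofReal_one, div_one, one_pow, mul_one] at h1
  refine h1.congr' ?_
  filter_upwards [self_mem_nhdsWithin, hmemf, hmemg] with q hq hq1 hq2
  have e1 := h.exp_secantArg hq1 hq.2.1
  have e2 := h.secantLog.eq _ hq1 _ hq2 (hne q hq)
  rw [add_sub_cancel_left] at e2
  have hq3 : 0 < q.2 := hq.2.2
  have e3 := exp_im_mul_I_eq (z := P.cornerCoord θ (q.1 + q.2) - P.cornerCoord θ q.1)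
    (c := q.2 ^ d) (by positivity) (by rw [e2]; push_cast; ring)
  -- The predicted phase is (z/|z|)^k times the squared direction of the coordinate chord. After
  -- division there remain the quotient from regularity and the squared direction of the ratio,
  -- which tends to 1.
  have e4 : Complex.exp ((k * secantArg d μ 0 q.1 + 2 * (μ (q.1, q.1 + q.2)).im : ℝ) * Complex.I) =
      (P.cornerCoord θ q.1 / ‖P.cornerCoord θ q.1‖) ^ k *
      ((P.cornerCoord θ (q.1 + q.2) - P.cornerCoord θ q.1) /
        ‖P.cornerCoord θ (q.1 + q.2) - P.cornerCoord θ q.1‖) ^ 2 := by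
    rw [← e1, ← e3, ← Complex.exp_int_mul, ← Complex.exp_nat_mul, ← Complex.exp_add]
    congr 1
    push_cast
    ring
  have e5 : (P.cornerCoord θ (q.1 + q.2) - P.cornerCoord θ q.1) /
        ‖P.cornerCoord θ (q.1 + q.2) - P.cornerCoord θ q.1‖ ≠ 0 := by
    rw [← e3]; exact Complex.exp_ne_zero _
  rw [e4, h.secantForm_eq hq1 hq2 (hne q hq), mul_div_norm, pow_div_norm, mul_div_norm]
  simp only [Function.comp]
  rw [mul_pow, ← mul_assoc, mul_div_mul_right _ _ (pow_ne_zero 2 e5), mul_div_right_comm]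
  rfl

/-- A continuous argument of `secantForm` jumps at a boundary point by an amount determined by the
umbilic order and the interior angle. -/
theorem exists_jump (h : P.IsBoundaryCorner θ d s r e e' μ) {ρ : ℝ} (hρ : 0 < ρ) {L : ℂ × ℝ → ℝ}
    (hL : ContinuousOn L {q | q.1 ∈ halfDisk ρ ∧ q.1 ≠ 0 ∧ 0 < q.2 ∧ q.2 < ρ})
    (hL1 : ∀ q ∈ {q : ℂ × ℝ | q.1 ∈ halfDisk ρ ∧ q.1 ≠ 0 ∧ 0 < q.2 ∧ q.2 < ρ},
      Complex.exp (L q * Complex.I) = P.secantForm (diskExp θ q.1) (diskExp θ (q.1 + q.2)) /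
        ‖P.secantForm (diskExp θ q.1) (diskExp θ (q.1 + q.2))‖) :
    ∃ m : ℝ, ∀ η > 0, ∃ ρ' > 0,
      (∀ t ε : ℝ, 0 < t → t < ρ' → 0 < ε → ε < ρ' → |L (t, ε) - (m + d * (2 * Real.pi -
        (S.umbilicOrder (P.Φ (circleMap 0 1 θ)) + 2) * P.interiorAngle (circleMap 0 1 θ)))| < η) ∧
      (∀ t ε : ℝ, -ρ' < t → 0 < ε → t + ε ≤ 0 → |L (t, ε) - m| < η) := by
  obtain ⟨α, β, hα, hβ, hα', hβ', -, hφ⟩ := h.exists_angles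
  obtain ⟨κ, hκ, hlim⟩ := h.tendsto_phase
  set k := S.umbilicOrder (P.Φ (circleMap 0 1 θ))
  have hr := h.corner.pos
  set r0 := min ρ (r / 2) with hr0
  have hr00 : 0 < r0 := lt_min hρ (by positivity)
  have hr0ρ : r0 ≤ ρ := min_le_left _ _
  have hr0r : r0 ≤ r / 2 := min_le_right _ _
  set D := {q : ℂ × ℝ | q.1 ∈ halfDisk r0 ∧ q.1 ≠ 0 ∧ 0 < q.2 ∧ q.2 < r0} with hD
  have hDsub : D ⊆ {q | q.1 ∈ halfDisk ρ ∧ q.1 ≠ 0 ∧ 0 < q.2 ∧ q.2 < ρ} :=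
    fun q hq => ⟨halfDisk_mono hr0ρ hq.1, hq.2.1, hq.2.2.1, hq.2.2.2.trans_le hr0ρ⟩
  have hD1 : ∀ q ∈ D, q.1 ∈ halfDisk r ∧ q.1 + (q.2 : ℂ) ∈ halfDisk r ∧ q.1 ≠ q.1 + (q.2 : ℂ) := by
    intro q hq
    have h1 := hq.1.2
    have h2 : ‖(q.2 : ℂ)‖ < r0 := by
      rw [Complex.norm_real, Real.norm_of_nonneg hq.2.2.1.le]; exact hq.2.2.2
    refine ⟨⟨hq.1.1, by linarith⟩, ⟨by simpa using hq.1.1, ?_⟩, fun h' => ?_⟩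
    · linarith [norm_add_le q.1 (q.2 : ℂ)]
    · simp only [left_eq_add, Complex.ofReal_eq_zero] at h'
      exact hq.2.2.1.ne' h'
  set F : ℂ × ℝ → ℝ := fun q => k * secantArg d μ 0 q.1 + 2 * (μ (q.1, q.1 + q.2)).im with hF
  have hFc : ContinuousOn F D := by
    refine (continuousOn_const.mul (h.continuousOn_secantArg.comp continuousOn_fst
      fun q hq => ⟨(hD1 q hq).1, hq.2.1⟩)).add (continuousOn_const.mul
      (Complex.continuous_im.comp_continuousOn (h.secantLog.continuousOn.comp (by fun_prop) ?_)))
    exact fun q hq => hD1 q hq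
  -- The domain is connected near the corner because the base point may pass through the interior of
  -- the disk; hence one constant `a` serves both edges.
  obtain ⟨a, -, ha⟩ := exists_tendsto_of_tendsto_exp (S := D) (x := (0 : ℂ × ℝ))
    (P := fun q => L q - F q) (by
      intro σ hσ
      have hset : Metric.ball (0 : ℂ × ℝ) σ ∩ D =
          {w : ℂ | w ∈ Metric.ball (0 : ℂ) (min σ r0) ∧ 0 ≤ w.im ∧ w ≠ (0 : ℝ)} ×ˢ
            Ioo 0 (min σ r0) := by
        ext q
        obtain ⟨w, ε⟩ := q
        simp only [hD, mem_inter_iff, mem_ball_zero_iff, Prod.norm_def, max_lt_iff, mem_ofPred_eq,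
          halfDisk, mem_prod, mem_Ioo, lt_min_iff, Complex.ofReal_zero]
        constructor
        · rintro ⟨⟨h1, h2⟩, ⟨h3, h4⟩, h5, h6, h7⟩
          rw [Real.norm_of_nonneg h6.le] at h2
          exact ⟨⟨⟨h1, h4⟩, h3, h5⟩, h6, h2, h7⟩
        · rintro ⟨⟨⟨h1, h4⟩, h3, h5⟩, h6, h2, h7⟩
          refine ⟨⟨h1, ?_⟩, ⟨h3, h4⟩, h5, h6, h7⟩
          rwa [Real.norm_of_nonneg h6.le]
      rw [hset]
      have hm : 0 < min σ r0 := lt_min hσ hr00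
      refine (isPreconnected_inter_im_nonneg (convex_ball 0 _)
        (c := ((min σ r0) / 2 : ℝ) * Complex.I) ?_ (by simpa using hm)).prod
        (convex_Ioo _ _).isPreconnected
      rw [mem_ball_zero_iff, norm_mul, Complex.norm_I, mul_one, Complex.norm_real,
        Real.norm_of_nonneg (by positivity)]
      linarith)
    ((hL.mono hDsub).sub hFc) hκ (by
      refine (hlim.mono_left (nhdsWithin_mono _ fun q hq => ⟨hq.1.1, hq.2.1, hq.2.2.1⟩)).congr' ?_
      filter_upwards [self_mem_nhdsWithin] with q hq
      rw [← hL1 q (hDsub hq), ← Complex.exp_sub]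
      congr 1
      simp only [hF]
      push_cast
      ring)
  -- The limit along the back edge, where the argument of z tends to β and that of the chord to β -
  -- dπ.
  refine ⟨k * β + 2 * (β - d * Real.pi) + a, fun η hη => ?_⟩
  -- The three errors enter with weights 1, |k| and 2.
  set ζ := η / (|(k : ℝ)| + 4) with hζ
  have hK : 0 < |(k : ℝ)| + 4 := by positivity
  have hζ0 : 0 < ζ := by positivity
  have hζη : ζ * (|(k : ℝ)| + 4) = η := by rw [hζ]; field_simp
  have key : ∀ l A m A0 m0 : ℝ, |l - (k * A + 2 * m) - a| < ζ → |A - A0| < ζ → |m - m0| < ζ →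
      |l - (k * A0 + 2 * m0 + a)| < η := by
    intro l A m A0 m0 h1 h2 h3
    have e1 : l - (k * A0 + 2 * m0 + a) =
        (l - (k * A + 2 * m) - a) + k * (A - A0) + 2 * (m - m0) := by ring
    have e2 : |(k : ℝ) * (A - A0)| ≤ |(k : ℝ)| * ζ := by
      rw [abs_mul]; gcongr
    have e3 : |2 * (m - m0)| < 2 * ζ := by
      rw [abs_mul, abs_two]; linarith
    rw [e1]
    have := abs_add_three (l - (k * A + 2 * m) - a) (k * (A - A0)) (2 * (m - m0))
    linarith
  obtain ⟨ρ1, hρ1, H1⟩ : ∃ ρ1 > 0, ∀ q ∈ D, ‖q‖ < ρ1 → |L q - F q - a| < ζ := by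
    have := Metric.tendsto_nhds.mp ha ζ hζ0
    rw [eventually_nhdsWithin_iff, Metric.eventually_nhds_iff_ball] at this
    obtain ⟨ρ1, hρ1, H⟩ := this
    exact ⟨ρ1, hρ1, fun q hq hq1 => H q (mem_ball_zero_iff.mpr hq1) hq⟩
  obtain ⟨ρ2, hρ2, H2⟩ : ∃ ρ2 > 0, ∀ t ε : ℝ, 0 ≤ t → 0 < ε → t < ρ2 → t + ε < ρ2 →
      |(μ (t, t + ε)).im - α| < ζ := by
    have := Metric.tendsto_nhds.mp hα ζ hζ0
    rw [eventually_nhdsWithin_iff, Metric.eventually_nhds_iff_ball] at this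
    obtain ⟨ρ1, hρ1, H⟩ := this
    refine ⟨ρ1, hρ1, fun t ε h1 h2 h3 h4 => ?_⟩
    have := H (t, t + ε) (by
      rw [mem_ball_zero_iff, Prod.norm_def, max_lt_iff, Real.norm_of_nonneg h1,
        Real.norm_of_nonneg (by positivity)]
      exact ⟨h3, h4⟩) ⟨h1, by simpa using h2⟩
    simpa only [Complex.ofReal_add, Real.dist_eq] using this
  obtain ⟨ρ3, hρ3, H3⟩ : ∃ ρ3 > 0, ∀ t ε : ℝ, -ρ3 < t → 0 < ε → t + ε ≤ 0 →
      |(μ (t, t + ε)).im - (β - d * Real.pi)| < ζ := by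
    have := Metric.tendsto_nhds.mp hβ ζ hζ0
    rw [eventually_nhdsWithin_iff, Metric.eventually_nhds_iff_ball] at this
    obtain ⟨ρ1, hρ1, H⟩ := this
    refine ⟨ρ1, hρ1, fun t ε h1 h2 h3 => ?_⟩
    have := H (t, t + ε) (by
      rw [mem_ball_zero_iff, Prod.norm_def, max_lt_iff, Real.norm_eq_abs, Real.norm_eq_abs,
        abs_lt, abs_lt]
      constructor <;> constructor <;> linarith) ⟨by simpa using h2, h3⟩
    simpa only [Complex.ofReal_add, Real.dist_eq] using this
  obtain ⟨ρ4, hρ4, H4⟩ : ∃ ρ4 > 0, ∀ t : ℝ, 0 < t → t < ρ4 → |secantArg d μ 0 t - α| < ζ := by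
    have := Metric.tendsto_nhds.mp hα' ζ hζ0
    rw [eventually_nhdsWithin_iff, Metric.eventually_nhds_iff_ball] at this
    obtain ⟨ρ1, hρ1, H⟩ := this
    exact ⟨ρ1, hρ1, fun t h1 h2 => H t (by
      rw [mem_ball_zero_iff, Real.norm_of_nonneg h1.le]; exact h2) h1⟩
  obtain ⟨ρ5, hρ5, H5⟩ : ∃ ρ5 > 0, ∀ t : ℝ, t < 0 → -ρ5 < t → |secantArg d μ 0 t - β| < ζ := by
    have := Metric.tendsto_nhds.mp hβ' ζ hζ0
    rw [eventually_nhdsWithin_iff, Metric.eventually_nhds_iff_ball] at this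
    obtain ⟨ρ1, hρ1, H⟩ := this
    exact ⟨ρ1, hρ1, fun t h1 h2 => H t (by
      rw [mem_ball_zero_iff, Real.norm_eq_abs, abs_of_neg h1]; linarith) h1⟩
  obtain ⟨ρ', hρ', b1, b2, b3, b4, b5, b6⟩ : ∃ ρ' > 0, ρ' ≤ ρ1 ∧ ρ' ≤ ρ2 / 2 ∧ ρ' ≤ ρ3 ∧ ρ' ≤ ρ4 ∧
      ρ' ≤ ρ5 ∧ ρ' ≤ r0 := by
    refine ⟨min (min ρ1 (ρ2 / 2)) (min (min ρ3 ρ4) (min ρ5 r0)), by positivity, ?_, ?_, ?_, ?_, ?_,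
      ?_⟩ <;> simp
  have hq : ∀ t ε : ℝ, t ≠ 0 → |t| < ρ' → 0 < ε → ε < ρ' →
      |L (t, ε) - (k * secantArg d μ 0 t + 2 * (μ (t, t + ε)).im) - a| < ζ := by
    intro t ε ht0 ht hε hε'
    refine H1 ((t : ℂ), ε) ⟨ofReal_mem_halfDisk (by linarith), Complex.ofReal_ne_zero.mpr ht0, hε,
      by linarith⟩ ?_
    rw [Prod.norm_def, max_lt_iff, Complex.norm_real, Real.norm_eq_abs, Real.norm_of_nonneg hε.le]
    exact ⟨by linarith, by linarith⟩
  refine ⟨ρ', hρ', fun t ε ht ht' hε hε' => ?_, fun t ε ht hε hε' => ?_⟩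
  · have e1 := key _ _ _ _ _ (hq t ε ht.ne' (by rw [abs_of_pos ht]; exact ht') hε hε')
      (H4 t ht (by linarith)) (H2 t ε ht.le hε (by linarith) (by linarith))
    -- The front limit has α in both places; the jump (k + 2)(α - β) + 2dπ takes the stated form
    -- because β - α is d times the interior angle.
    have e2 : k * β + 2 * (β - d * Real.pi) + a +
        d * (2 * Real.pi - (k + 2) * P.interiorAngle (circleMap 0 1 θ)) = k * α + 2 * α + a := by
      linear_combination (k + 2 : ℝ) * hφ
    rw [e2]
    exact e1
  -- The condition t + ε ≤ 0 keeps both ends of the chord on the back edge.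
  · have ht0 : t < 0 := by linarith
    exact key _ _ _ _ _ (hq t ε ht0.ne (by rw [abs_of_neg ht0]; linarith) hε (by linarith))
      (H5 t ht0 (by linarith)) (H3 t ε (by linarith) hε hε')

/-- Along a curvature line without umbilics the limits of the arguments of `secantForm` are
multiples of `π`. -/
theorem exists_tendsto_of_smooth (h : P.IsBoundaryCorner θ d s r e e' μ)
    (hV : circleMap 0 1 θ ∉ P.V) (hu : ¬ S.IsUmbilic (P.Φ (circleMap 0 1 θ))) {ρ : ℝ} (hρ : 0 < ρ)
    {L : ℝ × ℝ → ℝ} (hL : ContinuousOn L (Ioo (-ρ) ρ ×ˢ Ioo 0 ρ))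
    (hL1 : ∀ q ∈ Ioo (-ρ) ρ ×ˢ Ioo 0 ρ,
      Complex.exp (L q * Complex.I) = P.secantForm (diskExp θ q.1) (diskExp θ (q.1 + q.2)) /
        ‖P.secantForm (diskExp θ q.1) (diskExp θ (q.1 + q.2))‖) :
    ∃ m : ℝ, (∃ n : ℤ, m = n * Real.pi) ∧ Filter.Tendsto L (𝓝[{q | 0 < q.2}] 0) (𝓝 m) := by
  obtain ⟨-, him, hlim⟩ := h.smooth hV
  set c := circleMap 0 1 θ with hc
  have hcs : c ∈ Metric.sphere (0 : ℂ) 1 := circleMap_mem_sphere 0 zero_le_one θ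
  have hcb := Metric.sphere_subset_closedBall hcs
  rw [S.isUmbilic_iff] at hu
  set q0 := S.hopf (P.Φ c) (P.coord c c) with hq0
  have hr := h.corner.pos
  have hne0 : q0 * e ^ 2 ≠ 0 := mul_ne_zero hu (pow_ne_zero 2 h.corner.ne)
  have hf : Filter.Tendsto (fun q : ℝ × ℝ => (q.1 : ℂ)) (𝓝[{q | 0 < q.2}] 0) (𝓝 0) := by
    have : ContinuousAt (fun q : ℝ × ℝ => (q.1 : ℂ)) 0 := by fun_prop
    have h1 := this.tendsto
    simp only [Prod.fst_zero, Complex.ofReal_zero] at h1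
    exact h1.mono_left nhdsWithin_le_nhds
  have hg : Filter.Tendsto (fun q : ℝ × ℝ => (q.1 : ℂ) + q.2) (𝓝[{q | 0 < q.2}] 0) (𝓝 0) := by
    have : ContinuousAt (fun q : ℝ × ℝ => (q.1 : ℂ) + (q.2 : ℂ)) 0 := by fun_prop
    have h1 := this.tendsto
    simp only [Prod.fst_zero, Prod.snd_zero, Complex.ofReal_zero, add_zero] at h1
    exact h1.mono_left nhdsWithin_le_nhds
  have hne : ∀ q ∈ {q : ℝ × ℝ | 0 < q.2}, (q.1 : ℂ) ≠ q.1 + (q.2 : ℂ) := by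
    intro q hq h'
    simp only [left_eq_add, Complex.ofReal_eq_zero] at h'
    exact (ne_of_gt hq) h'
  have hratio : Filter.Tendsto (fun q : ℝ × ℝ => P.ratio c (diskExp θ q.1) (diskExp θ (q.1 + q.2)))
      (𝓝[{q | 0 < q.2}] 0) (𝓝 1) :=
    h.tendsto_ratio hf hg (by
      filter_upwards [self_mem_nhdsWithin] with q hq
      exact ⟨by simp, by simp, hne q hq⟩)
  have hmemf : ∀ᶠ q in 𝓝[{q | 0 < q.2}] (0 : ℝ × ℝ), (q.1 : ℂ) ∈ halfDisk r := by
    filter_upwards [hf (Metric.ball_mem_nhds _ hr)] with q hqr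
    exact ⟨by simp, mem_ball_zero_iff.mp hqr⟩
  have hmemg : ∀ᶠ q in 𝓝[{q | 0 < q.2}] (0 : ℝ × ℝ), (q.1 : ℂ) + (q.2 : ℂ) ∈ halfDisk r := by
    filter_upwards [hg (Metric.ball_mem_nhds _ hr)] with q hqr
    exact ⟨by simp, mem_ball_zero_iff.mp hqr⟩
  have hz : Filter.Tendsto (fun q : ℝ × ℝ => S.hopf (P.Φ c) (P.coord c (diskExp θ q.1)))
      (𝓝[{q | 0 < q.2}] 0) (𝓝 q0) := by
    have e1 : ContinuousAt (S.hopf (P.Φ c)) (P.coord c c) :=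
      (S.continuousOn_hopf _).continuousAt (chart_target_mem_nhds ℂ _)
    refine e1.tendsto.comp ((P.tendsto_coord hcb).comp (tendsto_nhdsWithin_iff.mpr ⟨?_, ?_⟩))
    · have h0 : Filter.Tendsto (diskExp θ) (𝓝 0) (𝓝 c) := by
        rw [hc, ← diskExp_zero]
        exact (continuous_diskExp θ).tendsto 0
      exact h0.comp hf
    · exact Filter.Eventually.of_forall fun q => diskExp_mem_closedBall θ (by simp)
  have hquot : Filter.Tendsto (fun q : ℝ × ℝ =>
      (P.cornerCoord θ (q.1 + q.2) - P.cornerCoord θ q.1) / (q.2 : ℂ)) (𝓝[{q | 0 < q.2}] 0)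
      (𝓝 e) := by
    have e1 : Filter.Tendsto (fun q : ℝ × ℝ => (q.1, q.1 + q.2)) (𝓝[{q | 0 < q.2}] 0)
        (𝓝[{p | p.1 < p.2}] 0) := by
      refine tendsto_nhdsWithin_iff.mpr ⟨?_, ?_⟩
      · have : ContinuousAt (fun q : ℝ × ℝ => (q.1, q.1 + q.2)) 0 := by fun_prop
        have h1 := this.tendsto
        simp only [Prod.fst_zero, Prod.snd_zero, add_zero] at h1
        exact h1.mono_left nhdsWithin_le_nhds
      · filter_upwards [self_mem_nhdsWithin] with q hq
        simpa using hq
    refine (hlim.comp e1).congr fun q => ?_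
    simp
  -- Division by the positive number ε² does not change the argument and produces the nonzero limit
  -- q₀e².
  have hmain := tendsto_div_norm hne0 (hz.mul ((hratio.mul hquot).pow 2) |>.congr' (f₂ := fun q =>
      P.secantForm (diskExp θ q.1) (diskExp θ (q.1 + q.2)) / ((q.2 ^ 2 : ℝ) : ℂ)) (by
    filter_upwards [self_mem_nhdsWithin, hmemf, hmemg] with q hq hq1 hq2
    rw [h.secantForm_eq hq1 hq2 (hne q hq)]
    push_cast
    ring) |> fun H => by simpa only [one_mul] using H)
  set D := Ioo (-ρ) ρ ×ˢ Ioo 0 ρ with hD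
  have hDn : 𝓝[{q : ℝ × ℝ | 0 < q.2}] (0 : ℝ × ℝ) = 𝓝[D] 0 := by
    have e1 : D = {q : ℝ × ℝ | 0 < q.2} ∩ (Ioo (-ρ) ρ ×ˢ Ioo (-ρ) ρ) := by
      ext q
      simp only [hD, mem_prod, mem_Ioo, mem_inter_iff, mem_ofPred_eq]
      constructor
      · rintro ⟨h1, h2, h3⟩
        exact ⟨h2, h1, by linarith, h3⟩
      · rintro ⟨h1, h2, h3, h4⟩
        exact ⟨h2, h1, h4⟩
    rw [e1]
    exact (nhdsWithin_inter_of_mem' (nhdsWithin_le_nhds (prod_mem_nhds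
      (Ioo_mem_nhds (by simpa using hρ) hρ) (Ioo_mem_nhds (by simpa using hρ) hρ)))).symm
  rw [hDn] at hmain ⊢
  obtain ⟨m, hm, hm1⟩ := ((convex_Ioo (-ρ) ρ).prod (convex_Ioo 0 ρ)).exists_tendsto_of_tendsto_exp
    (x := (0 : ℝ × ℝ)) hL (norm_div_norm_eq_one hne0) (hmain.congr' (by
      filter_upwards [self_mem_nhdsWithin] with q hq
      have hq2 : 0 < q.2 := hq.2.1
      rw [hL1 q hq, norm_div, Complex.norm_real, Real.norm_of_nonneg (by positivity)]
      have : ((q.2 ^ 2 : ℝ) : ℂ) ≠ 0 := by exact_mod_cast (by positivity : q.2 ^ 2 ≠ 0)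
      rw [Complex.ofReal_div, div_div_div_cancel_right₀ this]))
  refine ⟨m, ?_, hm1⟩
  -- q₀e² is real because e is principal, so sin m = 0.
  have e1 := congrArg Complex.im hm
  rw [Complex.exp_ofReal_mul_I_im, Complex.div_ofReal_im, him, zero_div] at e1
  obtain ⟨n, hn⟩ := Real.sin_eq_zero_iff.mp e1
  exact ⟨n, hn.symm⟩

end IsBoundaryCorner

end CurvatureLinePolygon

/-! ### A global argument of the secant form over a strip. -/

theorem diskExp_eq (θ : ℝ) (w : ℂ) : diskExp θ w = diskExp 0 (θ + w) := by
  simp [diskExp]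

theorem diskExp_zero_add_two_pi (w : ℂ) : diskExp 0 (w + 2 * Real.pi) = diskExp 0 w := by
  rw [diskExp, diskExp, ← Complex.exp_periodic ((((0 : ℝ) : ℂ) + w) * Complex.I)]
  congr 1
  ring

theorem StarConvex.isPreconnected' {E : Type*} [NormedAddCommGroup E] [NormedSpace ℝ E] {s : Set E}
    {x : E} (hs : StarConvex ℝ x s) (hx : x ∈ s) : IsPreconnected s :=
  (hs.isPathConnected hx).isConnected.isPreconnected

namespace CurvatureLinePolygon

variable {M : Type*} [TopologicalSpace M] [ChartedSpace ℂ M] {S : SphereSurface M} {p : ℕ}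
  (P : CurvatureLinePolygon S p)

/-- Pairs of a point of a strip above the real axis, not a real point in `B` modulo `2π`, and a
small shift. -/
def stripDomain (B : Finset ℂ) (h ε : ℝ) : Set (ℂ × ℝ) :=
  {q | 0 ≤ q.1.im ∧ q.1.im ≤ h ∧ (q.1.im = 0 → diskExp 0 q.1 ∉ B) ∧ 0 < q.2 ∧ q.2 < ε}

/-- A segment from a point with positive height meets the real axis at most at its other end, so the
removed boundary points do not obstruct it. This gives a global logarithm although the real axis is
broken up. -/
theorem starConvex_stripDomain (B : Finset ℂ) {h ε : ℝ} (hh : 0 < h) (hε : 0 < ε) :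
    StarConvex ℝ ((h * Complex.I, ε / 2) : ℂ × ℝ) (stripDomain B h ε) := by
  rintro ⟨w, t⟩ ⟨h1, h2, h3, h4, h5⟩ a b ha hb hab
  simp only at h1 h2 h3 h4 h5
  have him : (a • (h * Complex.I) + b • w : ℂ).im = a * h + b * w.im := by simp
  refine ⟨?_, ?_, ?_, ?_, ?_⟩
  · change 0 ≤ (a • (h * Complex.I) + b • w : ℂ).im
    rw [him]; positivity
  · change (a • (h * Complex.I) + b • w : ℂ).im ≤ h
    rw [him]
    have : h = a * h + b * h := by rw [← add_mul, hab, one_mul]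
    nlinarith
  · change (a • (h * Complex.I) + b • w : ℂ).im = 0 → diskExp 0 (a • (h * Complex.I) + b • w) ∉ B
    rw [him]
    intro h0
    have ha0 : a = 0 := by
      by_contra hne
      have := mul_pos (lt_of_le_of_ne ha (Ne.symm hne)) hh
      have := mul_nonneg hb h1
      linarith
    have hb1 : b = 1 := by linarith
    subst ha0 hb1
    simp only [zero_mul, one_mul, zero_add] at h0
    simpa using h3 h0
  · change 0 < a * (ε / 2) + b * t
    rcases ha.eq_or_lt with rfl | ha'
    · have : b = 1 := by linarith
      subst this; simpa using h4
    · have := mul_pos ha' (half_pos hε)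
      have := mul_nonneg hb h4.le
      linarith
  · change a * (ε / 2) + b * t < ε
    have : ε = a * ε + b * ε := by rw [← add_mul, hab, one_mul]
    rcases hb.eq_or_lt with rfl | hb'
    · have : a = 1 := by linarith
      subst this; linarith
    · have := mul_lt_mul_of_pos_left h5 hb'
      have := mul_le_mul_of_nonneg_left (show ε / 2 ≤ ε by linarith) ha
      linarith

variable [IsManifold 𝓘(ℂ) ω M]

/-- A continuous argument of `secantForm` along the boundary, and its period. -/
theorem exists_arg_secantForm {d : ℤ} (hd : ∀ x ∈ Metric.ball (0 : ℂ) 1, P.HasSecantDegree x d)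
    (hloc : ∀ c ∈ Metric.closedBall (0 : ℂ) 1, ∃ (r : ℝ) (μ : ℂ × ℂ → ℂ), P.IsLocal c r ∧
      IsSecantLog (Metric.closedBall 0 1 ∩ Metric.ball c r) (P.coord c) d μ)
    {A B : Finset ℂ} (hA : ∀ a ∈ Metric.ball (0 : ℂ) 1, S.IsUmbilic (P.Φ a) → a ∈ A)
    (hA1 : ∀ a ∈ A, ‖a‖ < 1) (hB : ∀ b ∈ Metric.sphere (0 : ℂ) 1, S.IsUmbilic (P.Φ b) → b ∈ B) :
    ∃ (h ε : ℝ) (L : ℂ × ℝ → ℝ), 0 < h ∧ 0 < ε ∧ ContinuousOn L (stripDomain B h ε) ∧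
      (∀ q ∈ stripDomain B h ε, Complex.exp (L q * Complex.I) =
        P.secantForm (diskExp 0 q.1) (diskExp 0 (q.1 + q.2)) /
          ‖P.secantForm (diskExp 0 q.1) (diskExp 0 (q.1 + q.2))‖) ∧
      ∀ q ∈ stripDomain B h ε, L (q.1 + 2 * Real.pi, q.2) = L q +
        2 * Real.pi * ((d * (∑ a ∈ A, S.umbilicOrder (P.Φ a) + 2) : ℤ) : ℝ) := by
  obtain ⟨δ, hδ, hδs⟩ := P.exists_selfSecant_ne_zero
  obtain ⟨R, hRA, hR, hR1⟩ : ∃ R : ℝ, (∀ a ∈ A, ‖a‖ < R) ∧ 0 < R ∧ R < 1 := by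
    have h1 : ∀ᶠ R in 𝓝[<] (1 : ℝ), ∀ a ∈ A, ‖a‖ < R :=
      (Filter.eventually_all_finset A).mpr fun a ha =>
        nhdsWithin_le_nhds (Ioi_mem_nhds (hA1 a ha))
    have h2 : ∀ᶠ R in 𝓝[<] (1 : ℝ), 0 < R := nhdsWithin_le_nhds (Ioi_mem_nhds one_pos)
    exact (h1.and (h2.and self_mem_nhdsWithin)).exists
  -- The line Im w = h is mapped to the circle of radius R.
  set h := -Real.log R with hh
  have hh0 : 0 < h := by rw [hh, neg_pos]; exact Real.log_neg hR hR1
  -- A parameter shift by ε moves a point of the disk by at most ε: the bound δ keeps secants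
  -- nonzero, and 1 - R keeps the shifted circle inside the disk.
  set ε0 := min δ (1 - R) with hε0
  have hε00 : 0 < ε0 := lt_min hδ (by linarith)
  have hε1 : ε0 ≤ 1 - R := min_le_right _ _
  have hε2 : ε0 ≤ δ := min_le_left _ _
  set E := stripDomain B h ε0 with hE
  have hstar := starConvex_stripDomain B hh0 hε00
  have hcE : ((h * Complex.I, ε0 / 2) : ℂ × ℝ) ∈ E := by
    refine ⟨?_, ?_, ?_, ?_, ?_⟩ <;> simp [hh0.le, hh0.ne'] <;> linarith
  have hshift : ∀ (w : ℂ) (ε : ℝ), diskExp 0 (w + ε) - diskExp 0 w =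
      diskExp 0 w * (Complex.exp (Complex.I * ε) - 1) := by
    intro w ε
    have : (((0 : ℝ) : ℂ) + (w + ε)) * Complex.I =
        (((0 : ℝ) : ℂ) + w) * Complex.I + Complex.I * ε := by ring
    rw [diskExp, diskExp, this, Complex.exp_add]
    ring
  have hexp : ∀ ε : ℝ, 0 < ε → ε < 1 → Complex.exp (Complex.I * ε) - 1 ≠ 0 := by
    intro ε h1 h2 h3
    rw [sub_eq_zero] at h3
    have h4 := congrArg Complex.im h3
    rw [mul_comm, Complex.exp_ofReal_mul_I_im, Complex.one_im] at h4
    exact (Real.sin_pos_of_pos_of_lt_pi h1 (by linarith [Real.pi_gt_three])).ne' h4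
  have hmem : ∀ q ∈ E, diskExp 0 q.1 ∈ Metric.closedBall (0 : ℂ) 1 ∧
      diskExp 0 (q.1 + q.2) ∈ Metric.closedBall (0 : ℂ) 1 := fun q hq =>
    ⟨diskExp_mem_closedBall 0 hq.1, diskExp_mem_closedBall 0 (by simpa using hq.1)⟩
  have hne : ∀ q ∈ E, P.secantForm (diskExp 0 q.1) (diskExp 0 (q.1 + q.2)) ≠ 0 := by
    intro q hq
    obtain ⟨h1, h2, h3, h4, h5⟩ := hq
    have hsub := hshift q.1 q.2
    refine P.secantForm_ne_zero (fun hu => ?_) (hδs _ (hmem q ⟨h1, h2, h3, h4, h5⟩).1 _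
      (hmem q ⟨h1, h2, h3, h4, h5⟩).2 (fun h' => ?_) ?_)
    · have hn := norm_diskExp 0 q.1
      rcases h1.eq_or_lt with h0 | h0
      · refine h3 h0.symm (hB _ ?_ hu)
        rw [mem_sphere_zero_iff_norm, hn, ← h0]; simp
      · have h6 : diskExp 0 q.1 ∈ Metric.ball (0 : ℂ) 1 := by
          rw [mem_ball_zero_iff, hn, Real.exp_lt_one_iff]; linarith
        have h7 := hRA _ (hA _ h6 hu)
        rw [hn] at h7
        have h8 : R ≤ Real.exp (-q.1.im) := by
          rw [← Real.exp_log hR, Real.exp_le_exp]; linarith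
        linarith
    · rw [h', sub_self, eq_comm, mul_eq_zero] at hsub
      rcases hsub with h6 | h6
      · exact Complex.exp_ne_zero _ h6
      · exact hexp _ h4 (by linarith) h6
    · rw [hsub, norm_mul]
      have h6 := mem_closedBall_zero_iff.mp (hmem q ⟨h1, h2, h3, h4, h5⟩).1
      have h7 : ‖Complex.exp (Complex.I * q.2) - 1‖ ≤ ‖q.2‖ := Real.norm_exp_I_mul_ofReal_sub_one_le
      rw [Real.norm_of_nonneg h4.le] at h7
      calc _ ≤ 1 * q.2 := mul_le_mul h6 h7 (norm_nonneg _) zero_le_one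
        _ < δ := by linarith
  have hcd := continuous_diskExp 0
  have hcont : ContinuousOn
      (fun q : ℂ × ℝ => P.secantForm (diskExp 0 q.1) (diskExp 0 (q.1 + q.2))) E := by
    have h1 : Continuous fun q : ℂ × ℝ => (diskExp 0 q.1, diskExp 0 (q.1 + (q.2 : ℂ))) := by
      fun_prop
    exact (P.continuousOn_secantForm.comp h1.continuousOn fun q hq => mk_mem_prod (hmem q hq).1
      (hmem q hq).2).congr fun q _ => rfl
  obtain ⟨Λ, hΛ, hΛ1⟩ := hstar.exists_log hcont hne
  have hLc : ContinuousOn (fun q => (Λ q).im) E := Complex.continuous_im.comp_continuousOn hΛ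
  have hL1 : ∀ q ∈ E, Complex.exp ((Λ q).im * Complex.I) =
        P.secantForm (diskExp 0 q.1) (diskExp 0 (q.1 + q.2)) /
          ‖P.secantForm (diskExp 0 q.1) (diskExp 0 (q.1 + q.2))‖ := by
    intro q hq
    exact exp_im_mul_I_eq one_pos (by rw [hΛ1 q hq]; simp)
  refine ⟨h, ε0, fun q => (Λ q).im, hh0, hε00, hLc, hL1, ?_⟩
  have hmaps : MapsTo (fun q : ℂ × ℝ => (q.1 + 2 * (Real.pi : ℂ), q.2)) E E := by
    rintro q ⟨h1, h2, h3, h4, h5⟩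
    have him : (q.1 + 2 * (Real.pi : ℂ)).im = q.1.im := by simp
    refine ⟨?_, ?_, ?_, h4, h5⟩
    · simpa using h1
    · simpa using h2
    · change (q.1 + 2 * (Real.pi : ℂ)).im = 0 → diskExp 0 (q.1 + 2 * (Real.pi : ℂ)) ∉ B
      rw [him, diskExp_zero_add_two_pi]
      exact h3
  -- Translation by 2π changes the argument by a constant, which can then be computed on the line Im
  -- w = h.
  obtain ⟨n, hn⟩ := (hstar.isPreconnected' hcE).arg_unique
    (hLc.comp (by fun_prop) hmaps) hLc (by
    intro q hq
    have h1 := hL1 _ (hmaps hq)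
    have h2 : q.1 + 2 * (Real.pi : ℂ) + q.2 = q.1 + q.2 + 2 * (Real.pi : ℂ) := by ring
    simp only at h1
    rw [h2, diskExp_zero_add_two_pi, diskExp_zero_add_two_pi] at h1
    rw [hL1 q hq]
    exact h1)
  set ε := ε0 / 2 with hε
  have hε' : 0 < ε := by positivity
  -- Rotation by ε moves Re^{it} by ve^{it}, so the shift turns with t as `winding_secantForm`
  -- requires.
  set v := (R : ℂ) * (Complex.exp (Complex.I * ε) - 1) with hv
  have hvn : ‖v‖ < ε0 := by
    rw [hv, norm_mul, Complex.norm_real, Real.norm_of_nonneg hR.le]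
    have h7 : ‖Complex.exp (Complex.I * ε) - 1‖ ≤ ‖ε‖ := Real.norm_exp_I_mul_ofReal_sub_one_le
    rw [Real.norm_of_nonneg hε'.le] at h7
    nlinarith [norm_nonneg (Complex.exp (Complex.I * ε) - 1)]
  have hcirc : ∀ t : ℝ, diskExp 0 (t + h * Complex.I) = circleMap 0 R t := by
    intro t
    have h1 : (((0 : ℝ) : ℂ) + (t + h * Complex.I)) * Complex.I = -h + t * Complex.I := by
      have := Complex.I_mul_I
      push_cast
      linear_combination (h : ℂ) * this
    rw [diskExp, h1, Complex.exp_add, circleMap_zero, hh]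
    push_cast
    rw [neg_neg, ← Complex.ofReal_exp, Real.exp_log hR]
  have htE : ∀ t : ℝ, ((t + h * Complex.I, ε) : ℂ × ℝ) ∈ E := by
    intro t
    refine ⟨?_, ?_, ?_, ?_, ?_⟩ <;> simp [hh0.le, hh0.ne'] <;> linarith
  have hw := P.winding_secantForm hd hloc hR hR1 hA hRA hδ hδs
    (mul_ne_zero (by exact_mod_cast hR.ne') (hexp ε hε' (by linarith)))
    (hvn.trans_le hε2) (by linarith)
    (L := fun t => (Λ (t + h * Complex.I, ε)).im)
    (hLc.comp_continuous (f := fun t : ℝ => ((t + h * Complex.I, ε) : ℂ × ℝ)) (by fun_prop) htE) (by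
      intro t
      have h1 := eq_norm_mul_exp_of_eq (hne _ (htE t)) (hL1 _ (htE t))
      have h2 : diskExp 0 (t + h * Complex.I + ε) =
          circleMap 0 R t + v * Complex.exp (t * Complex.I) := by
        have := hshift (t + h * Complex.I) ε
        rw [hcirc] at this
        rw [← sub_eq_iff_eq_add', this, circleMap_zero, hv]
        ring
      simp only [hcirc, h2] at h1
      refine ⟨_, norm_pos_iff.mpr ?_, h1⟩
      have h3 := hne _ (htE t)
      simp only [hcirc, h2] at h3
      exact h3) 0
  have h1 := hn _ (htE 0)
  simp only [Function.comp] at h1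
  have h2 : ((0 : ℝ) : ℂ) + h * Complex.I + 2 * Real.pi =
      ((0 + 2 * Real.pi : ℝ) : ℂ) + h * Complex.I := by push_cast; ring
  rw [h2] at h1
  rw [h1, add_sub_cancel_left] at hw
  intro q hq
  have h3 := hn q hq
  simp only [Function.comp] at h3
  rw [← hw]
  exact h3

end CurvatureLinePolygon

/-! ### Summing the jumps along the boundary. -/

/-- The points of a period at which the boundary parametrisation takes values in `B`. -/
theorem exists_finset_circleMap {B : Finset ℂ} (hB : ∀ b ∈ B, ‖b‖ = 1) {a : ℝ}
    (ha : circleMap 0 1 a ∉ B) : ∃ T : Finset ℝ, (∀ θ ∈ T, a < θ ∧ θ < a + 2 * Real.pi) ∧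
      (∀ t ∈ Icc a (a + 2 * Real.pi), t ∉ T → circleMap 0 1 t ∉ B) ∧
      (∀ θ ∈ T, circleMap 0 1 θ ∈ B) ∧
      ∀ g : ℂ → ℝ, ∑ θ ∈ T, g (circleMap 0 1 θ) = ∑ b ∈ B, g b := by
  classical
  have hpi := Real.two_pi_pos
  -- The representative of the argument in (a, a + 2π]; the right end is not attained because the
  -- point at `a` is not in `B`.
  set τ : ℂ → ℝ := fun b => toIocMod hpi a b.arg with hτ
  have hτ1 : ∀ b, τ b ∈ Ioc a (a + 2 * Real.pi) := fun b => toIocMod_mem_Ioc hpi a b.arg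
  have hper : circleMap 0 1 (a + 2 * Real.pi) = circleMap 0 1 a := periodic_circleMap 0 1 a
  have hτ2 : ∀ b ∈ B, circleMap 0 1 (τ b) = b := by
    intro b hb
    have h1 : τ b = b.arg - toIocDiv hpi a b.arg • (2 * Real.pi) := rfl
    rw [h1, (periodic_circleMap 0 1).sub_zsmul_eq, circleMap]
    have := Complex.norm_mul_exp_arg_mul_I b
    rw [hB b hb] at this
    rw [zero_add]
    exact this
  have hinj : InjOn τ (B : Set ℂ) := fun b hb b' hb' h => by
    rw [← hτ2 b hb, ← hτ2 b' hb', h]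
  refine ⟨B.image τ, ?_, ?_, ?_, ?_⟩
  · intro θ hθ
    obtain ⟨b, hb, rfl⟩ := Finset.mem_image.mp hθ
    refine ⟨(hτ1 b).1, lt_of_le_of_ne (hτ1 b).2 fun h => ha ?_⟩
    rw [← hper, ← h, hτ2 b hb]
    exact hb
  · intro t ht htT htB
    apply htT
    refine Finset.mem_image.mpr ⟨_, htB, ?_⟩
    have hta : t ∈ Ioc a (a + 2 * Real.pi) :=
      ⟨lt_of_le_of_ne ht.1 fun h => ha (h ▸ htB), ht.2⟩
    have h1 : Complex.exp ((circleMap 0 1 t).arg * Complex.I) = Complex.exp (t * Complex.I) := by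
      have := Complex.norm_mul_exp_arg_mul_I (circleMap 0 1 t)
      rw [hB _ htB, Complex.ofReal_one, one_mul] at this
      rw [this, circleMap]
      simp
    obtain ⟨n, hn⟩ := Complex.exp_eq_exp_iff_exists_int.mp h1
    have h2 : (circleMap 0 1 t).arg = t + n • (2 * Real.pi) := by
      have := congrArg Complex.im hn
      simpa using this
    rw [hτ]
    simp only
    rw [h2, toIocMod_add_zsmul, (toIocMod_eq_self hpi).mpr hta]
  · intro θ hθ
    obtain ⟨b, hb, rfl⟩ := Finset.mem_image.mp hθ
    rw [hτ2 b hb]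
    exact hb
  · intro g
    rw [Finset.sum_image hinj]
    exact Finset.sum_congr rfl fun b hb => by rw [hτ2 b hb]

namespace CurvatureLinePolygon

variable {M : Type*} [TopologicalSpace M] [ChartedSpace ℂ M] {S : SphereSurface M} {p : ℕ}
  (P : CurvatureLinePolygon S p) [IsManifold 𝓘(ℂ) ω M]

/-- The total order of the interior umbilics in terms of the orders and interior angles on the
boundary. -/
theorem sum_umbilicOrder {A B : Finset ℂ}
    (hA : ∀ a ∈ Metric.ball (0 : ℂ) 1, S.IsUmbilic (P.Φ a) → a ∈ A)
    (hA1 : ∀ a ∈ A, ‖a‖ < 1) (hB : ∀ b ∈ Metric.sphere (0 : ℂ) 1, S.IsUmbilic (P.Φ b) → b ∈ B)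
    (hVB : P.V ⊆ B) (hB1 : ∀ b ∈ B, ‖b‖ = 1) :
    2 * Real.pi * ((∑ a ∈ A, S.umbilicOrder (P.Φ a) : ℤ) + 2 : ℝ) =
      ∑ b ∈ B, (2 * Real.pi - (S.umbilicOrder (P.Φ b) + 2) * P.interiorAngle b) := by
  obtain ⟨d, hd, hloc⟩ := P.exists_degree
  obtain ⟨h, ε0, L, hh, hε0, hL, hL1, hper⟩ := P.exists_arg_secantForm hd hloc hA hA1 hB
  set W : ℝ := 2 * Real.pi * ((d * (∑ a ∈ A, S.umbilicOrder (P.Φ a) + 2) : ℤ) : ℝ) with hW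
  set c : ℂ → ℝ := fun b => d * (2 * Real.pi - (S.umbilicOrder (P.Φ b) + 2) * P.interiorAngle b)
    with hc
  -- the parameters near a boundary point
  have hBnear : ∀ θ : ℝ, ∃ κ > 0, ∀ t : ℝ, |t| < κ → t ≠ 0 → circleMap 0 1 (θ + t) ∉ B := by
    intro θ
    have := eventually_circleMap_notMem B θ
    rw [eventually_nhdsWithin_iff, Metric.eventually_nhds_iff_ball] at this
    obtain ⟨κ, hκ, H⟩ := this
    refine ⟨κ, hκ, fun t ht ht0 => H (θ + t) (by simpa using ht) (by simpa using ht0)⟩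
  have hdom : ∀ (θ t ε : ℝ), circleMap 0 1 (θ + t) ∉ B → 0 < ε → ε < ε0 →
      (((θ + t : ℂ), ε) : ℂ × ℝ) ∈ stripDomain B h ε0 := by
    intro θ t ε h1 h2 h3
    refine ⟨by simp, by simpa using hh.le, fun _ => ?_, h2, h3⟩
    simp only
    rw [← diskExp_eq, diskExp_ofReal]
    exact h1
  have hform : ∀ (θ : ℝ) (w : ℂ) (ε : ℝ), (((θ + w : ℂ), ε) : ℂ × ℝ) ∈ stripDomain B h ε0 →
      Complex.exp (L (θ + w, ε) * Complex.I) = P.secantForm (diskExp θ w) (diskExp θ (w + ε)) /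
          ‖P.secantForm (diskExp θ w) (diskExp θ (w + ε))‖ := by
    intro θ w ε hq
    have := hL1 _ hq
    simp only at this
    rw [add_assoc, ← diskExp_eq, ← diskExp_eq] at this
    exact this
  -- Off `B`, m is the limit of L as ε tends to 0. At a point of `B`, where the strip has no point,
  -- it is the limit from the back edge, so that m will be left continuous.
  have key : ∀ θ : ℝ, ∃ m : ℝ,
      (circleMap 0 1 θ ∉ B → (∃ n : ℤ, m = n * Real.pi) ∧
        Filter.Tendsto (fun q : ℝ × ℝ => L (θ + q.1, q.2)) (𝓝[{q | 0 < q.2}] 0) (𝓝 m)) ∧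
      (circleMap 0 1 θ ∈ B → ∀ η > 0, ∃ ρ' > 0,
        (∀ t ε : ℝ, 0 < t → t < ρ' → 0 < ε → ε < ρ' →
          |L (θ + t, ε) - (m + c (circleMap 0 1 θ))| < η) ∧
        (∀ t ε : ℝ, -ρ' < t → 0 < ε → t + ε ≤ 0 → |L (θ + t, ε) - m| < η)) := by
    intro θ
    obtain ⟨s, r, e, e', μ, hcor⟩ := P.exists_isBoundaryCorner hloc θ
    obtain ⟨κ, hκ, hκB⟩ := hBnear θ
    by_cases hθ : circleMap 0 1 θ ∈ B
    · set ρ := min κ (min ε0 h)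
      have hρ : 0 < ρ := by positivity
      have hρ1 : ρ ≤ κ := min_le_left _ _
      have hρ2 : ρ ≤ ε0 := (min_le_right _ _).trans (min_le_left _ _)
      have hρ3 : ρ ≤ h := (min_le_right _ _).trans (min_le_right _ _)
      have hmaps : MapsTo (fun q : ℂ × ℝ => ((θ + q.1, q.2) : ℂ × ℝ))
          {q | q.1 ∈ halfDisk ρ ∧ q.1 ≠ 0 ∧ 0 < q.2 ∧ q.2 < ρ} (stripDomain B h ε0) := by
        rintro q ⟨⟨h1, h2⟩, h3, h4, h5⟩
        have him : (θ + q.1 : ℂ).im = q.1.im := by simp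
        refine ⟨?_, ?_, ?_, h4, h5.trans_le hρ2⟩
        · change 0 ≤ (θ + q.1 : ℂ).im
          rwa [him]
        · change (θ + q.1 : ℂ).im ≤ h
          rw [him]
          linarith [Complex.abs_im_le_norm q.1, le_abs_self q.1.im]
        · change (θ + q.1 : ℂ).im = 0 → diskExp 0 (θ + q.1) ∉ B
          rw [him, ← diskExp_eq]
          intro h6
          have h7 : q.1 = (q.1.re : ℂ) := Complex.ext rfl (by simpa using h6)
          rw [h7, diskExp_ofReal]
          refine hκB _ ?_ ?_
          · linarith [Complex.abs_re_le_norm q.1]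
          · intro h8
            rw [h8] at h7
            exact h3 (by simpa using h7)
      obtain ⟨m, hm⟩ := hcor.exists_jump hρ (L := fun q => L (θ + q.1, q.2))
        (hL.comp (by fun_prop) hmaps) (fun q hq => hform θ q.1 q.2 (hmaps hq))
      exact ⟨m, fun h' => absurd hθ h', fun _ => hm⟩
    · set ρ := min κ ε0
      have hρ : 0 < ρ := by positivity
      have hmaps : MapsTo (fun q : ℝ × ℝ => ((θ + q.1, q.2) : ℂ × ℝ))
          (Ioo (-ρ) ρ ×ˢ Ioo 0 ρ) (stripDomain B h ε0) := by
        rintro q ⟨h1, h2⟩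
        refine hdom θ q.1 q.2 ?_ h2.1 (h2.2.trans_le (min_le_right _ _))
        rcases eq_or_ne q.1 0 with h0 | h0
        · rwa [h0, add_zero]
        · exact hκB _ ((abs_lt.mpr h1).trans_le (min_le_left _ _)) h0
      obtain ⟨m, hm⟩ := hcor.exists_tendsto_of_smooth (fun hV => hθ (hVB hV))
        (fun hu => hθ (hB _ (circleMap_mem_sphere 0 zero_le_one θ) hu)) hρ
        (L := fun q => L (θ + q.1, q.2)) (hL.comp (by fun_prop) hmaps)
        (fun q hq => hform θ q.1 q.2 (hmaps hq))
      exact ⟨m, fun _ => hm, fun h' => absurd h' hθ⟩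
  choose m hm1 hm2 using key
  have hlim : ∀ θ : ℝ, circleMap 0 1 θ ∉ B →
      Filter.Tendsto (fun ε : ℝ => L (θ, ε)) (𝓝[>] 0) (𝓝 (m θ)) := by
    intro θ hθ
    have h1 : Filter.Tendsto (fun ε : ℝ => ((0 : ℝ), ε)) (𝓝[>] 0) (𝓝[{q : ℝ × ℝ | 0 < q.2}] 0) := by
      refine tendsto_nhdsWithin_iff.mpr ⟨?_, ?_⟩
      · have : ContinuousAt (fun ε : ℝ => ((0 : ℝ), ε)) 0 := by fun_prop
        exact this.tendsto.mono_left nhdsWithin_le_nhds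
      · filter_upwards [self_mem_nhdsWithin] with ε hε using hε
    refine ((hm1 θ hθ).2.comp h1).congr fun ε => ?_
    simp
  -- Lets ε tend to 0 in an estimate for L, at the price of a weak inequality.
  have hle : ∀ (θ t m0 η κ : ℝ), circleMap 0 1 (θ + t) ∉ B → 0 < κ →
      (∀ ε : ℝ, 0 < ε → ε < κ → |L (θ + t, ε) - m0| < η) → |m (θ + t) - m0| ≤ η := by
    intro θ t m0 η κ h1 hκ h2
    have h3 := ((hlim _ h1).sub_const m0).abs
    refine le_of_tendsto h3 ?_
    filter_upwards [Ioo_mem_nhdsGT hκ] with ε hε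
    push_cast
    exact (h2 ε hε.1 hε.2).le
  have hconst : ∀ θ : ℝ, circleMap 0 1 θ ∉ B → ∀ᶠ θ' in 𝓝 θ, m θ' = m θ := by
    intro θ hθ
    obtain ⟨κ, hκ, hκB⟩ := hBnear θ
    obtain ⟨⟨n, hn⟩, hlim⟩ := hm1 θ hθ
    have h1 := Metric.tendsto_nhds.mp hlim 1 one_pos
    rw [eventually_nhdsWithin_iff, Metric.eventually_nhds_iff_ball] at h1
    obtain ⟨ρ, hρ, h1⟩ := h1
    filter_upwards [Metric.ball_mem_nhds θ (lt_min hκ hρ)] with θ' hθ'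
    have hθ' : |θ' - θ| < min κ ρ := hθ'
    have h2 : θ' = θ + (θ' - θ) := by ring
    have h3 : circleMap 0 1 (θ + (θ' - θ)) ∉ B := by
      rcases eq_or_ne (θ' - θ) 0 with h0 | h0
      · rwa [h0, add_zero]
      · exact hκB _ (hθ'.trans_le (min_le_left _ _)) h0
    have h4 := hle θ (θ' - θ) (m θ) 1 ρ h3 hρ (fun ε hε hε' => by
      have := h1 (θ' - θ, ε) (by
        rw [mem_ball_zero_iff, Prod.norm_def, max_lt_iff, Real.norm_eq_abs,
          Real.norm_of_nonneg hε.le]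
        exact ⟨hθ'.trans_le (min_le_right _ _), hε'⟩) hε
      simpa [Real.dist_eq] using this)
    obtain ⟨⟨n', hn'⟩, -⟩ := hm1 _ h3
    rw [← h2] at h4 hn'
    -- Two multiples of π at distance at most 1 coincide.
    rw [hn, hn', ← sub_mul, abs_mul, abs_of_pos Real.pi_pos] at h4
    have h5 : |(n' - n : ℤ)| < 1 := by
      have : |((n' - n : ℤ) : ℝ)| < 1 := by
        push_cast
        nlinarith [Real.pi_gt_three, abs_nonneg ((n' : ℝ) - n)]
      exact_mod_cast this
    have h6 : n' = n := by
      have := Int.abs_lt_one_iff.mp h5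
      omega
    rw [hn, hn', h6]
  obtain ⟨a, ha⟩ : ∃ a : ℝ, circleMap 0 1 a ∉ B := (eventually_circleMap_notMem B 0).exists
  obtain ⟨T, hT1, hT2, hT3, hT4⟩ := exists_finset_circleMap hB1 ha
  have hjump := sub_eq_sum_jumps (a := a) (b := a + 2 * Real.pi) (S := T) (M := m)
    (c := fun θ => c (circleMap 0 1 θ)) (by linarith [Real.two_pi_pos]) hT1
    (fun t ht htT => hconst t (hT2 t ht htT)) (by
      intro θ hθ
      rw [Metric.tendsto_nhds]
      intro η hη
      obtain ⟨ρ', hρ', -, h2⟩ := hm2 θ (hT3 θ hθ) (η / 2) (half_pos hη)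
      obtain ⟨κ, hκ, hκB⟩ := hBnear θ
      filter_upwards [self_mem_nhdsWithin,
        nhdsWithin_le_nhds (Metric.ball_mem_nhds θ (lt_min hκ hρ'))] with θ' hlt hθ'
      have hθ' : |θ' - θ| < min κ ρ' := hθ'
      have hlt : θ' - θ < 0 := sub_neg.mpr hlt
      -- Chords with ε below the distance to θ end before the corner.
      have h3 := hle θ (θ' - θ) (m θ) (η / 2) (-(θ' - θ))
        (hκB _ (hθ'.trans_le (min_le_left _ _)) hlt.ne) (by linarith) (fun ε hε hε' => by
          have := h2 (θ' - θ) ε (by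
            have := abs_lt.mp (hθ'.trans_le (min_le_right _ _)); linarith [this.1]) hε (by linarith)
          exact this)
      rw [add_sub_cancel] at h3
      rw [Real.dist_eq]
      linarith) (by
      intro θ hθ
      rw [Metric.tendsto_nhds]
      intro η hη
      obtain ⟨ρ', hρ', h2, -⟩ := hm2 θ (hT3 θ hθ) (η / 2) (half_pos hη)
      obtain ⟨κ, hκ, hκB⟩ := hBnear θ
      filter_upwards [self_mem_nhdsWithin,
        nhdsWithin_le_nhds (Metric.ball_mem_nhds θ (lt_min hκ hρ'))] with θ' hlt hθ'
      have hθ' : |θ' - θ| < min κ ρ' := hθ'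
      have hlt : 0 < θ' - θ := sub_pos.mpr hlt
      have h3 := hle θ (θ' - θ) (m θ + c (circleMap 0 1 θ)) (η / 2) ρ'
        (hκB _ (hθ'.trans_le (min_le_left _ _)) hlt.ne') hρ' (fun ε hε hε' => by
          have := h2 (θ' - θ) ε hlt (by
            have := abs_lt.mp (hθ'.trans_le (min_le_right _ _)); linarith [this.2]) hε hε'
          exact this)
      rw [add_sub_cancel] at h3
      rw [Real.dist_eq]
      linarith)
  have hperiod : m (a + 2 * Real.pi) = m a + W := by
    have ha' : circleMap 0 1 (a + 2 * Real.pi) ∉ B := by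
      rwa [show circleMap 0 1 (a + 2 * Real.pi) = circleMap 0 1 a from periodic_circleMap 0 1 a]
    refine tendsto_nhds_unique (hlim _ ha') (((hlim a ha).add_const W).congr' ?_)
    filter_upwards [Ioo_mem_nhdsGT hε0] with ε hε
    have h1 := hper ((a : ℂ), ε) (by
      have := hdom a 0 ε (by rwa [add_zero]) hε.1 hε.2
      simpa using this)
    simp only at h1
    push_cast
    exact h1.symm
  rw [hperiod, add_sub_cancel_left, hT4 c] at hjump
  obtain ⟨s, r, e, e', μ, hcor⟩ := P.exists_isBoundaryCorner hloc 0
  obtain ⟨-, -, -, -, -, -, hd1, -⟩ := hcor.exists_angles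
  -- Every contribution carries the factor d = ±1, so the orientation of the parametrisation
  -- cancels.
  have hd0 : (d : ℝ) ≠ 0 := by rcases hd1 with rfl | rfl <;> norm_num
  apply mul_left_cancel₀ hd0
  rw [Finset.mul_sum, ← hjump, hW]
  push_cast
  ring

end CurvatureLinePolygon

end

/-! ### The umbilic excess. -/

theorem mainTheorem3 {M : Type*} [TopologicalSpace M] [T2Space M] [ChartedSpace ℂ M]
    [IsManifold 𝓘(ℂ) ω M] (S : SphereSurface M) (p : ℕ) (P : CurvatureLinePolygon S p) :
    P.umbilics.Finite ∧ P.umbilicExcess = ((p : ℝ) - 4) / 2 := by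
  classical
  have hfin := P.finite_isUmbilic
  refine ⟨(hfin.image P.Φ).subset ?_, ?_⟩
  · rintro _ ⟨⟨w, hw, rfl⟩, hu⟩
    exact ⟨w, ⟨hw, hu⟩, rfl⟩
  set A := hfin.toFinset.filter (fun w => ‖w‖ < 1) with hA
  set E := hfin.toFinset.filter (fun w => ‖w‖ = 1 ∧ w ∉ P.V) with hE
  have hmemA : ∀ w, w ∈ A ↔ ‖w‖ < 1 ∧ S.IsUmbilic (P.Φ w) := by
    intro w
    simp only [hA, Finset.mem_filter, Set.Finite.mem_toFinset, Set.mem_ofPred_eq,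
      mem_closedBall_zero_iff]
    constructor
    · rintro ⟨⟨-, h1⟩, h2⟩; exact ⟨h2, h1⟩
    · rintro ⟨h2, h1⟩; exact ⟨⟨h2.le, h1⟩, h2⟩
  have hmemE : ∀ w, w ∈ E ↔ (‖w‖ = 1 ∧ w ∉ P.V) ∧ S.IsUmbilic (P.Φ w) := by
    intro w
    simp only [hE, Finset.mem_filter, Set.Finite.mem_toFinset, Set.mem_ofPred_eq,
      mem_closedBall_zero_iff]
    constructor
    · rintro ⟨⟨-, h1⟩, h2⟩; exact ⟨h2, h1⟩
    · rintro ⟨h2, h1⟩; exact ⟨⟨h2.1.le, h1⟩, h2⟩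
  have hV1 : ∀ w ∈ P.V, ‖w‖ = 1 := fun w hw => mem_sphere_zero_iff_norm.mp (P.V_subset hw)
  have hdisj : Disjoint P.V E :=
    Finset.disjoint_left.mpr fun w hw hwE => ((hmemE w).mp hwE).1.2 hw
  -- The break points are all vertices, umbilic or not, and the edge umbilics.
  have hsum := P.sum_umbilicOrder (A := A) (B := P.V ∪ E)
    (fun a ha hu => (hmemA a).mpr ⟨mem_ball_zero_iff.mp ha, hu⟩)
    (fun a ha => ((hmemA a).mp ha).1) (fun b hb hu => by
      by_cases hbV : b ∈ P.V
      · exact Finset.mem_union_left _ hbV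
      · exact Finset.mem_union_right _ ((hmemE b).mpr ⟨⟨mem_sphere_zero_iff_norm.mp hb, hbV⟩, hu⟩))
    Finset.subset_union_left (fun b hb => by
      rcases Finset.mem_union.mp hb with h | h
      · exact hV1 b h
      · exact ((hmemE b).mp h).1.1)
  have hface : ∑ᶠ u ∈ P.faceUmbilics, (S.umbilicOrder u : ℝ) =
      ∑ a ∈ A, (S.umbilicOrder (P.Φ a) : ℝ) := by
    have h1 : P.faceUmbilics = P.Φ '' (A : Set ℂ) := by
      ext u
      constructor
      · rintro ⟨⟨w, hw, rfl⟩, hu⟩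
        exact ⟨w, (hmemA w).mpr ⟨mem_ball_zero_iff.mp hw, hu⟩, rfl⟩
      · rintro ⟨w, hw, rfl⟩
        obtain ⟨h2, h3⟩ := (hmemA w).mp hw
        exact ⟨⟨w, mem_ball_zero_iff.mpr h2, rfl⟩, h3⟩
    rw [h1, finsum_mem_image (P.injOn.mono fun w hw =>
      mem_closedBall_zero_iff.mpr ((hmemA w).mp hw).1.le), finsum_mem_coe_finset]
  have hedge : ∑ᶠ u ∈ P.edgeUmbilics, (1 / 2 : ℝ) * S.umbilicOrder u =
      ∑ b ∈ E, (1 / 2 : ℝ) * S.umbilicOrder (P.Φ b) := by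
    have h1 : P.edgeUmbilics = P.Φ '' (E : Set ℂ) := by
      ext u
      constructor
      · rintro ⟨⟨w, hw, rfl⟩, hu⟩
        exact ⟨w, (hmemE w).mpr ⟨⟨mem_sphere_zero_iff_norm.mp hw.1, hw.2⟩, hu⟩, rfl⟩
      · rintro ⟨w, hw, rfl⟩
        obtain ⟨⟨h2, h4⟩, h3⟩ := (hmemE w).mp hw
        exact ⟨⟨w, ⟨mem_sphere_zero_iff_norm.mpr h2, h4⟩, rfl⟩, h3⟩
    rw [h1, finsum_mem_image (P.injOn.mono fun w hw =>
      mem_closedBall_zero_iff.mpr ((hmemE w).mp hw).1.1.le), finsum_mem_coe_finset]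
  -- With angle π/n, a vertex term equals 1/2 minus its jump 2π - (o + 2)π/n divided by 2π; the
  -- halves add up to p/2.
  have hvert : ∑ w ∈ P.V, ((S.umbilicOrder (P.Φ w) : ℝ) + 2 - P.n w) / (2 * P.n w) =
      p / 2 - (∑ w ∈ P.V, (2 * Real.pi -
        (S.umbilicOrder (P.Φ w) + 2) * P.interiorAngle w)) / (2 * Real.pi) := by
    have h1 : (p : ℝ) / 2 = ∑ w ∈ P.V, (1 / 2 : ℝ) := by
      rw [Finset.sum_const, P.card_V]
      simp [div_eq_mul_inv]
    rw [h1, Finset.sum_div, ← Finset.sum_sub_distrib]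
    refine Finset.sum_congr rfl fun w hw => ?_
    have h2 := P.n_pos w hw
    have h3 := Real.pi_pos
    rw [CurvatureLinePolygon.interiorAngle, if_pos hw]
    field_simp
    ring
  -- The angle is π at an edge umbilic, so its jump is -oπ.
  have hedge' : ∑ b ∈ E, (2 * Real.pi - (S.umbilicOrder (P.Φ b) + 2) * P.interiorAngle b) =
      -(2 * Real.pi) * ∑ b ∈ E, (1 / 2 : ℝ) * S.umbilicOrder (P.Φ b) := by
    rw [Finset.mul_sum]
    refine Finset.sum_congr rfl fun b hb => ?_
    rw [CurvatureLinePolygon.interiorAngle, if_neg ((hmemE b).mp hb).1.2]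
    ring
  rw [Finset.sum_union hdisj, hedge'] at hsum
  rw [CurvatureLinePolygon.umbilicExcess, hface, hedge, hvert]
  push_cast at hsum
  have hpi := Real.pi_pos
  have hsum' : ∑ w ∈ P.V, (2 * Real.pi - (S.umbilicOrder (P.Φ w) + 2) * P.interiorAngle w) =
      2 * Real.pi * (∑ a ∈ A, (S.umbilicOrder (P.Φ a) : ℝ) + 2 +
        ∑ b ∈ E, (1 / 2 : ℝ) * S.umbilicOrder (P.Φ b)) := by
    linear_combination -hsum
  rw [hsum', mul_div_cancel_left₀ _ (by positivity)]
  ring
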